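/- Let $X_1\rightrightarrows X_0$ be a Lie groupoid ($X_0,X_1$ finite-dimensional, Hausdorff and second countable, all structure maps smooth, source $s$ and target $t$ submersions, the product $xy$ being defined when $t(x)=s(y)$) which is $s$-connected, i.e. all fibres of $s$ are connected. Let $X_p$ be the manifold of composable $p$-tuples, $\partial:\Omega^k(X_p)\to\Omega^k(X_{p+1})$ the alternating sum of the pullbacks along the face maps, and let $\delta=\partial+(-1)^pd$ on $\Omega^k(X_p)$ be the total differential of the de Rham double complex. Let $\eta+\omega$ be a 3-cocycle with $\eta\in\Omega^1(X_2)$ and $\omega\in\Omega^2(X_1)$, i.e. $\partial\eta=0$, $\partial\omega+d\eta=0$, $d\omega=0$. Suppose that $\omega$ represents an integer class in $H^2_{DR}(X_1)$, realized by a principal $S^1$-bundle $\pi:R_1\to X_1$ ($S^1=\mathbb R/\mathbb Z$) with a connection 1-form $\theta\in\Omega^1(R_1)$ such that $d\theta=-\pi^*\omega$ (the existence of such a pair $(R_1,\theta)$ is equivalent to the integrality of $[\omega]$). Let $\Lambda=\{(x,y,xy):(x,y)\in X_2\}\subset X_1^3$, let $\pi^{-1}(\Lambda)\subset R_1^3$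 be its preimage under $\pi\times\pi\times\pi$, and let $T^2$ act on $\pi^{-1}(\Lambda)$ by $(a,b)\cdot(\tilde x,\tilde y,\tilde z)=(a\tilde x,b\tilde y,ab\,\tilde z)$. The 1-form $(\theta,\theta,-\theta)-\pi^*\mathrm{pr}_{12}^*\eta$ on $\pi^{-1}(\Lambda)$, where $\mathrm{pr}_{12}:\Lambda\to X_2$ is the projection $(x,y,xy)\mapsto(x,y)$, is basic for this action and descends to a flat connection on the $S^1$-bundle $\pi^{-1}(\Lambda)/T^2\to\Lambda$. Assume that this flat bundle has trivial holonomy. Then $R_1$ carries the structure of a Lie groupoid $R_1\rightrightarrows X_0$ making it an $S^1$-central extension of $X_1\rightrightarrows X_0$, i.e. $(\pi,\mathrm{id})$ is a morphism of groupoids and $(a\cdot\tilde x)(b\cdot\tilde y)=ab\cdot(\tilde x\tilde y)$ for all $a,b\in S^1$ and all composable $\tilde x,\tilde y\in R_1$, such that $\theta$ is a pseudo-connection with pseudo-curvature $\eta+\omega$, i.e. $\partial\theta=\pi^*\eta$ on $R_2$ and $d\theta=-\pi^*\omega$. In particular $\eta+\omega$ is of integer class: its class in $H^3_{DR}(X_\bullet)\cong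 H^3(X_\bullet,\mathbb R)$ lies in the image of $H^3(X_\bullet,\mathbb Z)$. -/

import Mathlib

open scoped Manifold ContDiff Topology
open Manifold Set

noncomputable section
section FiberProduct

variable {EM EN EB M N B : Type*}
  [NormedAddCommGroup EM] [NormedSpace ℝ EM] [TopologicalSpace M] [ChartedSpace EM M]
  [NormedAddCommGroup EN] [NormedSpace ℝ EN] [TopologicalSpace N] [ChartedSpace EN N]
  [NormedAddCommGroup EB] [NormedSpace ℝ EB] [TopologicalSpace B] [ChartedSpace EB B]
  {f : M → B} {g : N → B}

/-- The fibre product `M ×_B N` of a smooth map `f` and a submersion `g`. -/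
structure FiberProduct (hf : ContMDiff 𝓘(ℝ, EM) 𝓘(ℝ, EB) ∞ f)
    (hg : IsSubmersion 𝓘(ℝ, EN) 𝓘(ℝ, EB) ∞ g) : Type _ where
  fst : M
  snd : N
  w : f fst = g snd

namespace FiberProduct

variable {hf : ContMDiff 𝓘(ℝ, EM) 𝓘(ℝ, EB) ∞ f} {hg : IsSubmersion 𝓘(ℝ, EN) 𝓘(ℝ, EB) ∞ g}

attribute [ext] FiberProduct

/-- The inclusion into `M × N`. -/
def toProd (p : FiberProduct hf hg) : M × N := (p.fst, p.snd)

/-- The subspace topology of `M × N`. -/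
instance : TopologicalSpace (FiberProduct hf hg) := TopologicalSpace.induced toProd inferInstance

theorem isInducing_toProd : Topology.IsInducing (toProd : FiberProduct hf hg → M × N) := ⟨rfl⟩

theorem continuous_fst : Continuous (fst : FiberProduct hf hg → M) :=
  _root_.continuous_fst.comp isInducing_toProd.continuous
theorem continuous_snd : Continuous (snd : FiberProduct hf hg → N) :=
  _root_.continuous_snd.comp isInducing_toProd.continuous

/-- Charts in which `g` is a linear projection, near a point of the fibre product. -/
abbrev sub (p : FiberProduct hf hg) :
    IsSubmersionAtOfComplement hg.complement 𝓘(ℝ, EN) 𝓘(ℝ, EB) ∞ g p.snd :=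
  hg.isSubmersionOfComplement_complement p.snd

theorem sub_eq (p : FiberProduct hf hg) {y : N} (hy : y ∈ p.sub.domChart.source) :
    p.sub.codChart (g y) = (p.sub.equiv (p.sub.domChart y)).1 := by
  have h0 := p.sub.writtenInCharts
  have h := @h0 (p.sub.domChart y)
    (by rw [p.sub.domChart.extend_target_eq_image_source]; exact mem_image_of_mem _ hy)
  simpa [p.sub.domChart.left_inv hy] using h

/-- The second component of the inverse chart: solve `g y = f x` for `y` in submersion charts. -/
def solve (p : FiberProduct hf hg) (x : M) (k : hg.complement) : N :=
  p.sub.domChart.symm (p.sub.equiv.symm (p.sub.codChart (f x), k))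

theorem g_solve (p : FiberProduct hf hg) {x : M} {k : hg.complement}
    (hx : f x ∈ p.sub.codChart.source)
    (hk : p.sub.equiv.symm (p.sub.codChart (f x), k) ∈ p.sub.domChart.target) :
    f x = g (p.solve x k) := by
  have h1 : p.solve x k ∈ p.sub.domChart.source := p.sub.domChart.map_target hk
  have h2 := p.sub_eq h1
  rw [solve, p.sub.domChart.right_inv hk] at h2
  refine p.sub.codChart.injOn hx (p.sub.source_subset_preimage_source h1) ?_
  rw [solve, h2]; simp

open Classical in
/-- The chart `(x, y) ↦ (φ x, k y)` of the fibre product, where `φ` is a chart of `M` and `k y` is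
the complementary coordinate of `y` in submersion charts of `g`. -/
def chart (p : FiberProduct hf hg) :
    OpenPartialHomeomorph (FiberProduct hf hg) (EM × hg.complement) where
  toFun q := (chartAt EM p.fst q.fst, (p.sub.equiv (p.sub.domChart q.snd)).2)
  invFun v :=
    if h : f ((chartAt EM p.fst).symm v.1) = g (p.solve ((chartAt EM p.fst).symm v.1) v.2) then
      ⟨(chartAt EM p.fst).symm v.1, p.solve ((chartAt EM p.fst).symm v.1) v.2, h⟩ else p
  source := {q | q.fst ∈ (chartAt EM p.fst).source ∧ q.snd ∈ p.sub.domChart.source}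
  target := {v | (v.1 ∈ (chartAt EM p.fst).target ∧
      f ((chartAt EM p.fst).symm v.1) ∈ p.sub.codChart.source) ∧
      p.sub.equiv.symm (p.sub.codChart (f ((chartAt EM p.fst).symm v.1)), v.2)
        ∈ p.sub.domChart.target}
  map_source' := by
    rintro q ⟨h1, h2⟩
    have h3 := p.sub_eq h2
    have h4 : f q.fst = g q.snd := q.w
    refine ⟨⟨(chartAt EM p.fst).map_source h1, ?_⟩, ?_⟩
    · rw [(chartAt EM p.fst).left_inv h1, h4]
      exact p.sub.source_subset_preimage_source h2
    · simp only [(chartAt EM p.fst).left_inv h1, h4, h3]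
      simpa using p.sub.domChart.map_source h2
  map_target' := by
    rintro v ⟨⟨h1, h2⟩, h3⟩
    rw [dif_pos (p.g_solve h2 h3)]
    exact ⟨(chartAt EM p.fst).map_target h1, p.sub.domChart.map_target h3⟩
  left_inv' := by
    rintro q ⟨h1, h2⟩
    have h3 := p.sub_eq h2
    have h4 : f q.fst = g q.snd := q.w
    have h5 : p.solve q.fst (p.sub.equiv (p.sub.domChart q.snd)).2 = q.snd := by
      rw [solve, h4, h3]
      simpa using p.sub.domChart.left_inv h2
    simp only [(chartAt EM p.fst).left_inv h1, h5]
    rw [dif_pos h4]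
  right_inv' := by
    rintro v ⟨⟨h1, h2⟩, h3⟩
    rw [dif_pos (p.g_solve h2 h3)]
    refine Prod.ext ((chartAt EM p.fst).right_inv h1) ?_
    change (p.sub.equiv (p.sub.domChart (p.solve _ _))).2 = _
    rw [solve, p.sub.domChart.right_inv h3]
    simp
  open_source :=
    ((chartAt EM p.fst).open_source.preimage continuous_fst).inter
      (p.sub.domChart.open_source.preimage continuous_snd)
  open_target := by
    have c1 : ContinuousOn (fun v : EM × hg.complement => f ((chartAt EM p.fst).symm v.1))
        (Prod.fst ⁻¹' (chartAt EM p.fst).target) :=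
      hf.continuous.comp_continuousOn
        ((chartAt EM p.fst).continuousOn_symm.comp _root_.continuous_fst.continuousOn
          (fun _ h => h))
    have o1 := c1.isOpen_inter_preimage
      ((chartAt EM p.fst).open_target.preimage _root_.continuous_fst) p.sub.codChart.open_source
    have c2 : ContinuousOn (fun v : EM × hg.complement =>
        p.sub.equiv.symm (p.sub.codChart (f ((chartAt EM p.fst).symm v.1)), v.2))
        (Prod.fst ⁻¹' (chartAt EM p.fst).target ∩
          (fun v : EM × hg.complement => f ((chartAt EM p.fst).symm v.1)) ⁻¹'
            p.sub.codChart.source) :=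
      p.sub.equiv.symm.continuous.comp_continuousOn
        ((p.sub.codChart.continuousOn.comp (c1.mono inter_subset_left) (fun _ h => h.2)).prodMk
          _root_.continuous_snd.continuousOn)
    exact c2.isOpen_inter_preimage o1 p.sub.domChart.open_target
  continuousOn_toFun := by
    refine ContinuousOn.prodMk ?_ ?_
    · exact (chartAt EM p.fst).continuousOn.comp continuous_fst.continuousOn (fun _ h => h.1)
    · exact (_root_.continuous_snd.comp p.sub.equiv.continuous).comp_continuousOn
        (p.sub.domChart.continuousOn.comp continuous_snd.continuousOn (fun _ h => h.2))
  continuousOn_invFun := by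
    refine isInducing_toProd.continuousOn_iff.2 ?_
    have c0 : ContinuousOn (fun v : EM × hg.complement => (chartAt EM p.fst).symm v.1)
        {v | (v.1 ∈ (chartAt EM p.fst).target ∧
      f ((chartAt EM p.fst).symm v.1) ∈ p.sub.codChart.source) ∧
      p.sub.equiv.symm (p.sub.codChart (f ((chartAt EM p.fst).symm v.1)), v.2)
        ∈ p.sub.domChart.target} :=
      (chartAt EM p.fst).continuousOn_symm.comp _root_.continuous_fst.continuousOn
          (fun _ h => h.1.1)
    have c2 := p.sub.domChart.continuousOn_symm.comp
      (p.sub.equiv.symm.continuous.comp_continuousOn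
        ((p.sub.codChart.continuousOn.comp (hf.continuous.comp_continuousOn c0)
          (fun _ h => h.1.2)).prodMk _root_.continuous_snd.continuousOn)) (fun _ h => h.2)
    refine (c0.prodMk c2).congr ?_
    rintro v ⟨⟨h1, h2⟩, h3⟩
    simp only [Function.comp]
    rw [dif_pos (p.g_solve h2 h3)]; rfl

instance : ChartedSpace (EM × hg.complement) (FiberProduct hf hg) where
  atlas := range chart
  chartAt := chart
  mem_chart_source p := ⟨mem_chart_source EM p.fst, p.sub.mem_domChart_source⟩
  chart_mem_atlas p := mem_range_self p


open Classical in
theorem chart_symm_fst (p : FiberProduct hf hg) {v : EM × hg.complement}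
    (hv : v ∈ p.chart.target) : (p.chart.symm v).fst = (chartAt EM p.fst).symm v.1 := by
  change (dite _ _ _ : FiberProduct hf hg).fst = _
  rw [dif_pos (p.g_solve hv.1.2 hv.2)]

open Classical in
theorem chart_symm_snd (p : FiberProduct hf hg) {v : EM × hg.complement}
    (hv : v ∈ p.chart.target) :
    (p.chart.symm v).snd = p.solve ((chartAt EM p.fst).symm v.1) v.2 := by
  change (dite _ _ _ : FiberProduct hf hg).snd = _
  rw [dif_pos (p.g_solve hv.1.2 hv.2)]

theorem contMDiffOn_chart_symm_fst [IsManifold 𝓘(ℝ, EM) ∞ M] (p : FiberProduct hf hg) :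
    ContMDiffOn 𝓘(ℝ, EM × hg.complement) 𝓘(ℝ, EM) ∞ (fun v => (p.chart.symm v).fst)
      p.chart.target := by
  have h : ContMDiffOn 𝓘(ℝ, EM × hg.complement) 𝓘(ℝ, EM) ∞
      (fun v => (chartAt EM p.fst).symm v.1) p.chart.target :=
    (contMDiffOn_chart_symm (x := p.fst)).comp
      (contDiff_fst.contMDiff.contMDiffOn) (fun v hv => hv.1.1)
  exact h.congr fun v hv => p.chart_symm_fst hv

theorem contMDiffOn_chart_symm_snd [IsManifold 𝓘(ℝ, EM) ∞ M] [IsManifold 𝓘(ℝ, EN) ∞ N]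
    [IsManifold 𝓘(ℝ, EB) ∞ B] (p : FiberProduct hf hg) :
    ContMDiffOn 𝓘(ℝ, EM × hg.complement) 𝓘(ℝ, EN) ∞ (fun v => (p.chart.symm v).snd)
      p.chart.target := by
  have h1 : ContMDiffOn 𝓘(ℝ, EM × hg.complement) 𝓘(ℝ, EM) ∞
      (fun v => (chartAt EM p.fst).symm v.1) p.chart.target :=
    (contMDiffOn_chart_symm (x := p.fst)).comp
      (contDiff_fst.contMDiff.contMDiffOn) (fun v hv => hv.1.1)
  have h2 : ContMDiffOn 𝓘(ℝ, EM × hg.complement) 𝓘(ℝ, EB) ∞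
      (fun v => p.sub.codChart (f ((chartAt EM p.fst).symm v.1))) p.chart.target :=
    (contMDiffOn_of_mem_maximalAtlas p.sub.codChart_mem_maximalAtlas).comp
      (hf.comp_contMDiffOn h1) (fun v hv => hv.1.2)
  have h3 : ContMDiffOn 𝓘(ℝ, EM × hg.complement) 𝓘(ℝ, EB × hg.complement) ∞
      (fun v => (p.sub.codChart (f ((chartAt EM p.fst).symm v.1)), v.2)) p.chart.target :=
    h2.prodMk_space contDiff_snd.contMDiff.contMDiffOn
  have h4 : ContMDiffOn 𝓘(ℝ, EM × hg.complement) 𝓘(ℝ, EN) ∞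
      (fun v => p.solve ((chartAt EM p.fst).symm v.1) v.2) p.chart.target :=
    (contMDiffOn_symm_of_mem_maximalAtlas p.sub.domChart_mem_maximalAtlas).comp
      (p.sub.equiv.symm.contDiff.contMDiff.comp_contMDiffOn h3) (fun v hv => hv.2)
  exact h4.congr fun v hv => p.chart_symm_snd hv

/-- A map whose two components are smooth is smooth in every chart. -/
theorem contMDiffOn_chart_comp {EP P : Type*} [NormedAddCommGroup EP] [NormedSpace ℝ EP]
    [TopologicalSpace P] [ChartedSpace EP P]
    [IsManifold 𝓘(ℝ, EM) ∞ M] [IsManifold 𝓘(ℝ, EN) ∞ N] (p : FiberProduct hf hg)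
    {h : P → FiberProduct hf hg} {s : Set P}
    (h1 : ContMDiffOn 𝓘(ℝ, EP) 𝓘(ℝ, EM) ∞ (fun x => (h x).fst) s)
    (h2 : ContMDiffOn 𝓘(ℝ, EP) 𝓘(ℝ, EN) ∞ (fun x => (h x).snd) s)
    (hs : ∀ x ∈ s, h x ∈ p.chart.source) :
    ContMDiffOn 𝓘(ℝ, EP) 𝓘(ℝ, EM × hg.complement) ∞ (fun x => p.chart (h x)) s := by
  have h3 : ContMDiffOn 𝓘(ℝ, EP) 𝓘(ℝ, EM) ∞ (fun x => chartAt EM p.fst (h x).fst) s :=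
    (contMDiffOn_chart (x := p.fst)).comp h1 (fun x hx => (hs x hx).1)
  have h4 : ContMDiffOn 𝓘(ℝ, EP) 𝓘(ℝ, EN) ∞ (fun x => p.sub.domChart (h x).snd) s :=
    (contMDiffOn_of_mem_maximalAtlas p.sub.domChart_mem_maximalAtlas).comp h2
      (fun x hx => (hs x hx).2)
  exact h3.prodMk_space
    ((contDiff_snd.comp p.sub.equiv.contDiff).contMDiff.comp_contMDiffOn h4)

instance [IsManifold 𝓘(ℝ, EM) ∞ M] [IsManifold 𝓘(ℝ, EN) ∞ N] [IsManifold 𝓘(ℝ, EB) ∞ B] :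
    IsManifold 𝓘(ℝ, EM × hg.complement) ∞ (FiberProduct hf hg) := by
  refine isManifold_of_contDiffOn _ _ _ ?_
  rintro _ _ ⟨p, rfl⟩ ⟨q, rfl⟩
  rw [← contMDiffOn_iff_contDiffOn]
  refine q.contMDiffOn_chart_comp (h := p.chart.symm)
    (p.contMDiffOn_chart_symm_fst.mono ?_) (p.contMDiffOn_chart_symm_snd.mono ?_) ?_
  · exact fun x hx => hx.1.1
  · exact fun x hx => hx.1.1
  · exact fun x hx => hx.1.2

theorem contMDiff_fst [IsManifold 𝓘(ℝ, EM) ∞ M] [IsManifold 𝓘(ℝ, EN) ∞ N]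
    [IsManifold 𝓘(ℝ, EB) ∞ B] :
    ContMDiff 𝓘(ℝ, EM × hg.complement) 𝓘(ℝ, EM) ∞ (fst : FiberProduct hf hg → M) := by
  intro p
  have h := p.contMDiffOn_chart_symm_fst.comp
    (contMDiffOn_chart (I := 𝓘(ℝ, EM × hg.complement)) (n := ∞) (x := p))
    (fun q hq => p.chart.map_source hq)
  refine ((h.congr fun q hq => ?_).contMDiffAt ((chartAt _ p).open_source.mem_nhds
    (mem_chart_source _ p)))
  exact congrArg fst (p.chart.left_inv hq).symm

theorem contMDiff_snd [IsManifold 𝓘(ℝ, EM) ∞ M] [IsManifold 𝓘(ℝ, EN) ∞ N]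
    [IsManifold 𝓘(ℝ, EB) ∞ B] :
    ContMDiff 𝓘(ℝ, EM × hg.complement) 𝓘(ℝ, EN) ∞ (snd : FiberProduct hf hg → N) := by
  intro p
  have h := p.contMDiffOn_chart_symm_snd.comp
    (contMDiffOn_chart (I := 𝓘(ℝ, EM × hg.complement)) (n := ∞) (x := p))
    (fun q hq => p.chart.map_source hq)
  refine ((h.congr fun q hq => ?_).contMDiffAt ((chartAt _ p).open_source.mem_nhds
    (mem_chart_source _ p)))
  exact congrArg snd (p.chart.left_inv hq).symm

/-- A map into the fibre product is smooth as soon as its two components are. -/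
theorem contMDiff_of_comp {EP P : Type*} [NormedAddCommGroup EP] [NormedSpace ℝ EP]
    [TopologicalSpace P] [ChartedSpace EP P]
    [IsManifold 𝓘(ℝ, EM) ∞ M] [IsManifold 𝓘(ℝ, EN) ∞ N] [IsManifold 𝓘(ℝ, EB) ∞ B]
    {h : P → FiberProduct hf hg}
    (h1 : ContMDiff 𝓘(ℝ, EP) 𝓘(ℝ, EM) ∞ (fun x => (h x).fst))
    (h2 : ContMDiff 𝓘(ℝ, EP) 𝓘(ℝ, EN) ∞ (fun x => (h x).snd)) :
    ContMDiff 𝓘(ℝ, EP) 𝓘(ℝ, EM × hg.complement) ∞ h := by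
  have hc : Continuous h :=
    isInducing_toProd.continuous_iff.2 (h1.continuous.prodMk h2.continuous)
  intro x
  have ho : IsOpen (h ⁻¹' (h x).chart.source) := (h x).chart.open_source.preimage hc
  have hx : x ∈ h ⁻¹' (h x).chart.source := mem_chart_source (EM × hg.complement) (h x)
  have h3 := (h x).contMDiffOn_chart_comp (h := h) (s := h ⁻¹' (h x).chart.source)
    h1.contMDiffOn h2.contMDiffOn (fun _ hy => hy)
  have h4 := (contMDiffOn_chart_symm (I := 𝓘(ℝ, EM × hg.complement)) (n := ∞) (x := h x)).comp h3
    (fun y hy => (h x).chart.map_source hy)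
  refine (h4.congr fun y hy => ?_).contMDiffAt (ho.mem_nhds hx)
  exact ((h x).chart.left_inv hy).symm

end FiberProduct
end FiberProduct

section DifferentialForms

variable {E M : Type*} [NormedAddCommGroup E] [NormedSpace ℝ E] [TopologicalSpace M]
  [ChartedSpace E M] {EP P : Type*} [NormedAddCommGroup EP] [NormedSpace ℝ EP]
  [TopologicalSpace P] [ChartedSpace EP P] {k : ℕ}

/-- Families of alternating `k`-forms on the tangent spaces of a manifold `M` (modelled on `E`),
with no regularity in the base point; see `DForm.IsSmooth`. -/
abbrev DForm (E M : Type*) [NormedAddCommGroup E] [NormedSpace ℝ E] [TopologicalSpace M]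
    [ChartedSpace E M] (k : ℕ) : Type _ :=
  (x : M) → TangentSpace 𝓘(ℝ, E) x [⋀^Fin k]→L[ℝ] ℝ

namespace DForm

/-- The pullback `f^* α`. -/
def pullback (f : P → M) (α : DForm E M k) : DForm EP P k := fun x =>
  (α (f x)).compContinuousLinearMap (mfderiv 𝓘(ℝ, EP) 𝓘(ℝ, E) f x)

/-- The expression of a form in the chart at `x₀`: its pullback under the inverse chart. -/
def inChart (α : DForm E M k) (x₀ : M) : E → E [⋀^Fin k]→L[ℝ] ℝ := fun e =>
  (α ((chartAt E x₀).symm e)).compContinuousLinearMap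
    (mfderiv 𝓘(ℝ, E) 𝓘(ℝ, E) (chartAt E x₀).symm e)

/-- Smooth differential forms. -/
def IsSmooth (α : DForm E M k) : Prop :=
  ∀ x₀ : M, ContDiffOn ℝ ∞ (α.inChart x₀) (chartAt E x₀).target

/-- The exterior derivative of a form, computed at `x` in the chart at `x`. -/
def extD (α : DForm E M k) : DForm E M (k + 1) := fun x =>
  (extDeriv (α.inChart x) (chartAt E x x)).compContinuousLinearMap
    (mfderiv 𝓘(ℝ, E) 𝓘(ℝ, E) (chartAt E x) x)

end DForm
end DifferentialForms

section LieGroupoids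

/-- A Lie groupoid `X₁ ⇉ X₀`; the product `x y` is defined when `tgt x = src y`. -/
structure LieGroupoid (E₀ E₁ X₀ X₁ : Type*)
    [NormedAddCommGroup E₀] [NormedSpace ℝ E₀] [TopologicalSpace X₀] [ChartedSpace E₀ X₀]
    [NormedAddCommGroup E₁] [NormedSpace ℝ E₁] [TopologicalSpace X₁] [ChartedSpace E₁ X₁] where
  src : X₁ → X₀
  tgt : X₁ → X₀
  isSubmersion_src : IsSubmersion 𝓘(ℝ, E₁) 𝓘(ℝ, E₀) ∞ src
  isSubmersion_tgt : IsSubmersion 𝓘(ℝ, E₁) 𝓘(ℝ, E₀) ∞ tgt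
  mul : FiberProduct isSubmersion_tgt.contMDiff isSubmersion_src → X₁
  unit : X₀ → X₁
  inv : X₁ → X₁
  contMDiff_mul : ContMDiff 𝓘(ℝ, E₁ × isSubmersion_src.complement) 𝓘(ℝ, E₁) ∞ mul
  contMDiff_unit : ContMDiff 𝓘(ℝ, E₀) 𝓘(ℝ, E₁) ∞ unit
  contMDiff_inv : ContMDiff 𝓘(ℝ, E₁) 𝓘(ℝ, E₁) ∞ inv
  src_mul : ∀ p, src (mul p) = src p.fst
  tgt_mul : ∀ p, tgt (mul p) = tgt p.snd
  mul_assoc : ∀ (x y z : X₁) (hxy : tgt x = src y) (hyz : tgt y = src z),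
    mul ⟨mul ⟨x, y, hxy⟩, z, (tgt_mul _).trans hyz⟩ =
      mul ⟨x, mul ⟨y, z, hyz⟩, hxy.trans (src_mul ⟨y, z, hyz⟩).symm⟩
  src_unit : ∀ u, src (unit u) = u
  tgt_unit : ∀ u, tgt (unit u) = u
  unit_mul : ∀ x, mul ⟨unit (src x), x, tgt_unit _⟩ = x
  mul_unit : ∀ x, mul ⟨x, unit (tgt x), (src_unit _).symm⟩ = x
  src_inv : ∀ x, src (inv x) = tgt x
  tgt_inv : ∀ x, tgt (inv x) = src x
  mul_inv : ∀ x, mul ⟨x, inv x, (src_inv x).symm⟩ = unit (src x)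
  inv_mul : ∀ x, mul ⟨inv x, x, tgt_inv x⟩ = unit (tgt x)

namespace LieGroupoid

variable {E₀ E₁ X₀ X₁ : Type*}
  [NormedAddCommGroup E₀] [NormedSpace ℝ E₀] [TopologicalSpace X₀] [ChartedSpace E₀ X₀]
  [NormedAddCommGroup E₁] [NormedSpace ℝ E₁] [TopologicalSpace X₁] [ChartedSpace E₁ X₁]

/-- Every source fibre is connected. -/
def SConnected (G : LieGroupoid E₀ E₁ X₀ X₁) : Prop := ∀ u : X₀, IsConnected (G.src ⁻¹' {u})

/-- The manifold `X₂` of composable pairs. -/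
abbrev Pairs (G : LieGroupoid E₀ E₁ X₀ X₁) : Type _ :=
  FiberProduct G.isSubmersion_tgt.contMDiff G.isSubmersion_src

/-- The model space of `X₂` (and, iterated, of `X₃`). -/
abbrev PairsModel (G : LieGroupoid E₀ E₁ X₀ X₁) : Type _ := E₁ × G.isSubmersion_src.complement

variable {k : ℕ}

/-- The simplicial coboundary `∂ : Ω^k(X₁) → Ω^k(X₂)`. -/
def cobdry₁ (G : LieGroupoid E₀ E₁ X₀ X₁) (α : DForm E₁ X₁ k) : DForm G.PairsModel G.Pairs k :=
  α.pullback FiberProduct.snd - α.pullback G.mul + α.pullback FiberProduct.fst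

variable [IsManifold 𝓘(ℝ, E₀) ∞ X₀] [IsManifold 𝓘(ℝ, E₁) ∞ X₁]

theorem contMDiff_tgt_snd (G : LieGroupoid E₀ E₁ X₀ X₁) :
    ContMDiff 𝓘(ℝ, G.PairsModel) 𝓘(ℝ, E₀) ∞ (fun p : G.Pairs => G.tgt p.snd) :=
  G.isSubmersion_tgt.contMDiff.comp FiberProduct.contMDiff_snd

/-- The manifold `X₃` of composable triples `(x, y, z)`, stored as `((x, y), z)`. -/
abbrev Triples (G : LieGroupoid E₀ E₁ X₀ X₁) : Type _ :=
  FiberProduct G.contMDiff_tgt_snd G.isSubmersion_src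

/-- `(x, y, z) ↦ (y, z)` -/
def tripleFace₀ (G : LieGroupoid E₀ E₁ X₀ X₁) (q : G.Triples) : G.Pairs := ⟨q.fst.snd, q.snd, q.w⟩
/-- `(x, y, z) ↦ (xy, z)` -/
def tripleFace₁ (G : LieGroupoid E₀ E₁ X₀ X₁) (q : G.Triples) : G.Pairs :=
  ⟨G.mul q.fst, q.snd, (G.tgt_mul _).trans q.w⟩
/-- `(x, y, z) ↦ (x, yz)` -/
def tripleFace₂ (G : LieGroupoid E₀ E₁ X₀ X₁) (q : G.Triples) : G.Pairs :=
  ⟨q.fst.fst, G.mul ⟨q.fst.snd, q.snd, q.w⟩, q.fst.w.trans (G.src_mul ⟨q.fst.snd, q.snd, q.w⟩).symm⟩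
/-- `(x, y, z) ↦ (x, y)` -/
def tripleFace₃ (G : LieGroupoid E₀ E₁ X₀ X₁) (q : G.Triples) : G.Pairs := q.fst

/-- The simplicial coboundary `∂ : Ω^k(X₂) → Ω^k(X₃)`. -/
def cobdry₂ (G : LieGroupoid E₀ E₁ X₀ X₁) (α : DForm G.PairsModel G.Pairs k) :
    DForm (G.PairsModel × G.isSubmersion_src.complement) G.Triples k :=
  α.pullback G.tripleFace₀ - α.pullback G.tripleFace₁ + α.pullback G.tripleFace₂ -
    α.pullback G.tripleFace₃

/-- `η + om` with `η ∈ Ω¹(X₂)`, `om ∈ Ω²(X₁)` is a 3-cocycle of the de Rham double complex, whose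
total differential is `∂ + (-1)^p d` on `Ω^•(X_p)`. -/
structure IsThreeCocycle (G : LieGroupoid E₀ E₁ X₀ X₁) (η : DForm G.PairsModel G.Pairs 1)
    (om : DForm E₁ X₁ 2) : Prop where
  smooth_η : η.IsSmooth
  smooth_om : om.IsSmooth
  cobdry_η : G.cobdry₂ η = 0
  cobdry_om_add_extD_η : G.cobdry₁ om + η.extD = 0
  extD_om : om.extD = 0

end LieGroupoid
end LieGroupoids

section CircleBundles

variable {E₁ ER X₁ R : Type*}
  [NormedAddCommGroup E₁] [NormedSpace ℝ E₁] [TopologicalSpace X₁] [ChartedSpace E₁ X₁]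
  [NormedAddCommGroup ER] [NormedSpace ℝ ER] [TopologicalSpace R] [ChartedSpace ER R]
  [MulAction Circle R]

/-- `π : R → X₁` is a smooth principal `S¹`-bundle. -/
structure IsPrincipalCircleBundle (E₁ ER : Type*) {X₁ R : Type*}
    [NormedAddCommGroup E₁] [NormedSpace ℝ E₁] [TopologicalSpace X₁] [ChartedSpace E₁ X₁]
    [NormedAddCommGroup ER] [NormedSpace ℝ ER] [TopologicalSpace R] [ChartedSpace ER R]
    [MulAction Circle R] (π : R → X₁) : Prop where
  contMDiff_smul : ContMDiff ((𝓡 1).prod 𝓘(ℝ, ER)) 𝓘(ℝ, ER) ∞ (fun q : Circle × R => q.1 • q.2)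
  contMDiff_proj : ContMDiff 𝓘(ℝ, ER) 𝓘(ℝ, E₁) ∞ π
  proj_smul : ∀ (s : Circle) (r : R), π (s • r) = π r
  /-- Smooth equivariant local triviality. -/
  locally_trivial : ∀ x : X₁, ∃ e : Bundle.Trivialization Circle π, x ∈ e.baseSet ∧
    ContMDiffOn 𝓘(ℝ, ER) (𝓘(ℝ, E₁).prod (𝓡 1)) ∞ e e.source ∧
    ContMDiffOn (𝓘(ℝ, E₁).prod (𝓡 1)) 𝓘(ℝ, ER) ∞ e.toOpenPartialHomeomorph.symm e.target ∧
    ∀ (s : Circle) (r : R), r ∈ e.source → (e (s • r)).2 = s * (e r).2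

/-- Connection one-forms of a principal `S¹`-bundle with total space `R`, where `S¹ = ℝ/ℤ`:
`θ` is smooth, `S¹`-invariant and takes the value `1` on the generator `ξ` of the action (`ξ` is
the velocity of `τ ↦ exp(2πiτ) • r`). -/
structure IsConnectionForm (θ : DForm ER R 1) : Prop where
  smooth : θ.IsSmooth
  invariant : ∀ s : Circle, DForm.pullback (fun r : R => s • r) θ = θ
  apply_generator : ∀ r : R,
    (DForm.pullback (fun τ : ℝ => Circle.exp (2 * Real.pi * τ) • r) θ : DForm ℝ ℝ 1) 0
      (fun _ => (1 : ℝ)) = 1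

end CircleBundles

namespace LieGroupoid

variable {E₀ E₁ ER X₀ X₁ R : Type*}
  [NormedAddCommGroup E₀] [NormedSpace ℝ E₀] [TopologicalSpace X₀] [ChartedSpace E₀ X₀]
  [NormedAddCommGroup E₁] [NormedSpace ℝ E₁] [TopologicalSpace X₁] [ChartedSpace E₁ X₁]
  [NormedAddCommGroup ER] [NormedSpace ℝ ER] [TopologicalSpace R] [ChartedSpace ER R]
  [MulAction Circle R]

section Holonomy

/-- The graph `Λ ⊆ X₁ × X₁ × X₁` of the multiplication. -/
def graph (G : LieGroupoid E₀ E₁ X₀ X₁) : Set (X₁ × X₁ × X₁) :=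
  {q | ∃ h : G.tgt q.1 = G.src q.2.1, q.2.2 = G.mul ⟨q.1, q.2.1, h⟩}

/-- `π⁻¹(Λ) ⊆ R × R × R`. -/
abbrev OverGraph (G : LieGroupoid E₀ E₁ X₀ X₁) (π : R → X₁) : Type _ :=
  {r : R × R × R // (π r.1, π r.2.1, π r.2.2) ∈ G.graph}

/-- The composite of `π : π⁻¹(Λ) → Λ` with the projection `pr₁₂ : Λ → X₂`. -/
def overGraphToPairs (G : LieGroupoid E₀ E₁ X₀ X₁) (π : R → X₁) (r : G.OverGraph π) : G.Pairs :=
  ⟨π r.1.1, π r.1.2.1, r.2.fst⟩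

/-- The orbit relation of the `T²`-action `(s, t) · (x, y, z) = (s x, t y, (s t) z)`. -/
def torusSetoid (G : LieGroupoid E₀ E₁ X₀ X₁) (π : R → X₁) : Setoid (G.OverGraph π) where
  r a b := ∃ s t : Circle, b.1 = (s • a.1.1, t • a.1.2.1, (s * t) • a.1.2.2)
  iseqv := by
    refine ⟨fun a => ⟨1, 1, by simp⟩, ?_, ?_⟩
    · rintro a b ⟨s, t, h⟩
      refine ⟨s⁻¹, t⁻¹, ?_⟩
      rw [h]
      simp [smul_smul, mul_mul_mul_comm s⁻¹ t⁻¹ s t]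
    · rintro a b c ⟨s, t, h⟩ ⟨s', t', h'⟩
      refine ⟨s' * s, t' * t, ?_⟩
      rw [h', h]
      simp only [smul_smul]
      rw [mul_mul_mul_comm]

/-- The total space `π⁻¹(Λ)/T²`. -/
def FlatBundle (G : LieGroupoid E₀ E₁ X₀ X₁) (π : R → X₁) : Type _ :=
  Quotient (G.torusSetoid π)

/-- The quotient map `τ : π⁻¹(Λ) → π⁻¹(Λ)/T²`. -/
def toFlatBundle (G : LieGroupoid E₀ E₁ X₀ X₁) (π : R → X₁) (r : G.OverGraph π) :
    G.FlatBundle π := Quotient.mk (G.torusSetoid π) r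

/-- The bundle projection `p : π⁻¹(Λ)/T² → Λ`. -/
def flatBundleProj (G : LieGroupoid E₀ E₁ X₀ X₁) {π : R → X₁}
    (P : IsPrincipalCircleBundle E₁ ER π) : G.FlatBundle π → G.graph :=
  Quotient.lift (s := G.torusSetoid π) (fun r => ⟨_, r.2⟩) (by
    rintro a b ⟨s, t, h⟩
    simp [h, P.proj_smul])

/-- The pullback along a map `h : B → π⁻¹(Λ)` of the one-form
`Θ̃ = (θ, θ, -θ) - π^* pr₁₂^* η` on `π⁻¹(Λ)`. -/
def pullTheta (G : LieGroupoid E₀ E₁ X₀ X₁) (π : R → X₁) (η : DForm G.PairsModel G.Pairs 1)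
    (θ : DForm ER R 1) {EB B : Type*} [NormedAddCommGroup EB] [NormedSpace ℝ EB]
    [TopologicalSpace B] [ChartedSpace EB B] (h : B → G.OverGraph π) : DForm EB B 1 :=
  θ.pullback (fun b => (h b).1.1) + θ.pullback (fun b => (h b).1.2.1) -
    θ.pullback (fun b => (h b).1.2.2) - η.pullback (fun b => G.overGraphToPairs π (h b))

/-- Horizontal paths `[0, 1] → π⁻¹(Λ)/T²` for the connection `Θ̂` to which the `T²`-basic form `Θ̃`
descends: the images under `τ` of smooth paths in `π⁻¹(Λ)` on whose velocity vectors `Θ̃` vanishes.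
(All smooth paths in `π⁻¹(Λ)/T²` lift to `π⁻¹(Λ)`, and `τ^* Θ̂ = Θ̃`.) -/
def IsHorizontal (G : LieGroupoid E₀ E₁ X₀ X₁) (π : R → X₁) (η : DForm G.PairsModel G.Pairs 1)
    (θ : DForm ER R 1) (q : unitInterval → G.FlatBundle π) : Prop :=
  ∃ c : ℝ → G.OverGraph π,
    ContMDiff 𝓘(ℝ, ℝ) 𝓘(ℝ, ER) ∞ (fun τ => (c τ).1.1) ∧
    ContMDiff 𝓘(ℝ, ℝ) 𝓘(ℝ, ER) ∞ (fun τ => (c τ).1.2.1) ∧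
    ContMDiff 𝓘(ℝ, ℝ) 𝓘(ℝ, ER) ∞ (fun τ => (c τ).1.2.2) ∧
    (∀ τ : unitInterval, (G.pullTheta π η θ c : DForm ℝ ℝ 1) τ = 0) ∧
    ∀ τ : unitInterval, q τ = G.toFlatBundle π (c τ)

/-- The flat bundle `p : π⁻¹(Λ)/T² → Λ` has trivial holonomy: every horizontal path lying over a
loop in `Λ` is closed. -/
def HolonomyFree (G : LieGroupoid E₀ E₁ X₀ X₁) {π : R → X₁} (P : IsPrincipalCircleBundle E₁ ER π)
    (η : DForm G.PairsModel G.Pairs 1) (θ : DForm ER R 1) : Prop :=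
  ∀ q : unitInterval → G.FlatBundle π, G.IsHorizontal π η θ q →
    G.flatBundleProj P (q 0) = G.flatBundleProj P (q 1) → q 0 = q 1

end Holonomy

section CentralExtensions

/-- An `S¹`-central extension of `X₁ ⇉ X₀` with bundle projection `π : R → X₁`: a Lie groupoid
`R ⇉ X₀` such that `(π, id)` is a morphism of groupoids, `π` is a principal `S¹`-bundle, and
`(s • a) (t • b) = (s t) • (a b)`. -/
structure CentralExtension (ER : Type*) {R : Type*}
    [NormedAddCommGroup ER] [NormedSpace ℝ ER] [TopologicalSpace R] [ChartedSpace ER R]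
    [MulAction Circle R] (G : LieGroupoid E₀ E₁ X₀ X₁) (π : R → X₁)
    extends LieGroupoid E₀ ER X₀ R where
  isPrincipal : IsPrincipalCircleBundle E₁ ER π
  src_eq : ∀ a, src a = G.src (π a)
  tgt_eq : ∀ a, tgt a = G.tgt (π a)
  proj_mul : ∀ (a b : R) (h : tgt a = src b),
    π (mul ⟨a, b, h⟩) = G.mul ⟨π a, π b, by rw [← src_eq, ← tgt_eq, h]⟩
  proj_unit : ∀ u, π (unit u) = G.unit u
  smul_mul_smul : ∀ (s t : Circle) (a b : R) (h : tgt a = src b),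
    mul ⟨s • a, t • b, by
      rw [tgt_eq, src_eq, isPrincipal.proj_smul, isPrincipal.proj_smul, ← src_eq, ← tgt_eq, h]⟩ =
      (s * t) • mul ⟨a, b, h⟩

namespace CentralExtension

variable {G : LieGroupoid E₀ E₁ X₀ X₁} {π : R → X₁}

/-- The map `R₂ → X₂` induced by `π`. -/
def pairsProj (Γ : CentralExtension ER G π) (p : Γ.toLieGroupoid.Pairs) : G.Pairs :=
  ⟨π p.fst, π p.snd, by rw [← Γ.src_eq, ← Γ.tgt_eq, p.w]⟩

/-- The connection form `θ` is a pseudo-connection of the extension, with pseudo-curvature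
`η + om`: `∂θ = π^* η` in `Ω¹(R₂)` and `dθ = -π^* om` in `Ω²(R)`. -/
structure IsPseudoConnection (Γ : CentralExtension ER G π) (θ : DForm ER R 1)
    (η : DForm G.PairsModel G.Pairs 1) (om : DForm E₁ X₁ 2) : Prop where
  isConnectionForm : IsConnectionForm θ
  cobdry_eq : Γ.toLieGroupoid.cobdry₁ θ = η.pullback Γ.pairsProj
  extD_eq : θ.extD = -om.pullback π

end CentralExtension
end CentralExtensions

section IntegerClasses

/-- The manifold `X_p` of composable `p`-tuples, presented as functors from the pair groupoid on
`{0, …, p}`: `arr i j` is the composite arrow from vertex `i` to vertex `j`, so that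
`(arr 0 1, arr 1 2, …)` is the composable `p`-tuple, and `arr 0 0` is a unit. -/
@[ext]
structure Nerve (G : LieGroupoid E₀ E₁ X₀ X₁) (p : ℕ) where
  arr : Fin (p + 1) → Fin (p + 1) → X₁
  w : ∀ i j k, G.tgt (arr i j) = G.src (arr j k)
  mul_arr : ∀ i j k, G.mul ⟨arr i j, arr j k, w i j k⟩ = arr i k

/-- The face map `X_{p+1} → X_p` omitting the `i`-th vertex. -/
def Nerve.face {G : LieGroupoid E₀ E₁ X₀ X₁} {p : ℕ} (i : Fin (p + 2)) (a : G.Nerve (p + 1)) :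
    G.Nerve p where
  arr j k := a.arr (i.succAbove j) (i.succAbove k)
  w _ _ _ := a.w _ _ _
  mul_arr _ _ _ := a.mul_arr _ _ _

/-- The pair `(arr 0 1, arr 1 2)` of a point of `X₂`. -/
def Nerve.toPair {G : LieGroupoid E₀ E₁ X₀ X₁} (a : G.Nerve 2) : G.Pairs :=
  ⟨a.arr 0 1, a.arr 1 2, a.w 0 1 2⟩

/-- Smooth singular `q`-simplices in `X_p`; smoothness on the standard simplex means smooth
extendability to the ambient space, and is tested on the components in `X₁`. -/
@[ext]
structure SingularSimplex (G : LieGroupoid E₀ E₁ X₀ X₁) (p q : ℕ) where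
  toFun : stdSimplex ℝ (Fin (q + 1)) → G.Nerve p
  smooth : ∀ i j, ∃ f : (Fin (q + 1) → ℝ) → X₁,
    ContMDiff 𝓘(ℝ, Fin (q + 1) → ℝ) 𝓘(ℝ, E₁) ∞ f ∧ ∀ x : stdSimplex ℝ (Fin (q + 1)), f x.1 = (toFun x).arr i j

/-- The `i`-th coface `Δ^q → Δ^{q+1}`, inserting a zero barycentric coordinate at `i`. -/
def simplexCoface {q : ℕ} (i : Fin (q + 2)) (x : stdSimplex ℝ (Fin (q + 1))) :
    stdSimplex ℝ (Fin (q + 2)) :=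
  ⟨i.insertNth (α := fun _ => ℝ) 0 x.1, by
    refine ⟨fun j => ?_, ?_⟩
    · refine Fin.succAboveCases i ?_ (fun k => ?_) j
      · simp
      · simpa using x.2.1 k
    · rw [Fin.sum_univ_succAbove _ i]
      simpa using x.2.2⟩

namespace SingularSimplex

variable {G : LieGroupoid E₀ E₁ X₀ X₁} {p q : ℕ}

/-- The `i`-th face of a simplex in `X_{p+1}` in the simplicial direction. -/
def nerveFace (i : Fin (p + 2)) (σ : G.SingularSimplex (p + 1) q) : G.SingularSimplex p q where
  toFun x := (σ.toFun x).face i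
  smooth _ _ := σ.smooth _ _

/-- The `i`-th face of a singular `(q+1)`-simplex. -/
def singularFace (i : Fin (q + 2)) (σ : G.SingularSimplex p (q + 1)) : G.SingularSimplex p q where
  toFun x := σ.toFun (simplexCoface i x)
  smooth j k := by
    obtain ⟨f, hf, h⟩ := σ.smooth j k
    refine ⟨fun x => f (i.insertNth (α := fun _ => ℝ) 0 x), hf.comp ?_, fun x => h (simplexCoface i x)⟩
    rw [contMDiff_iff_contDiff, contDiff_pi]
    intro l
    refine Fin.succAboveCases i ?_ (fun m => ?_) l
    · simpa using contDiff_const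
    · simpa using contDiff_apply ℝ ℝ m

end SingularSimplex

/-- Cochains of the double complex `C^q(X_p; A)` of smooth singular cochains. -/
abbrev Cochain (G : LieGroupoid E₀ E₁ X₀ X₁) (A : Type*) : Type _ :=
  ∀ p q : ℕ, G.SingularSimplex p q → A

namespace Cochain

variable {G : LieGroupoid E₀ E₁ X₀ X₁} {A : Type*} [AddCommGroup A]

/-- Concentrated in total degree `n`. -/
def IsHomogeneous (c : G.Cochain A) (n : ℕ) : Prop := ∀ p q, p + q ≠ n → c p q = 0

/-- The simplicial differential `∂ : C^q(X_p) → C^q(X_{p+1})`. -/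
def simplicialD (c : G.Cochain A) : G.Cochain A
  | 0, _, _ => 0
  | p + 1, q, σ => ∑ i : Fin (p + 2), (-1 : ℤ) ^ (i : ℕ) • c p q (σ.nerveFace i)

/-- The singular differential `C^q(X_p) → C^{q+1}(X_p)`. -/
def singularD (c : G.Cochain A) : G.Cochain A
  | _, 0, _ => 0
  | p, q + 1, σ => ∑ i : Fin (q + 2), (-1 : ℤ) ^ (i : ℕ) • c p q (σ.singularFace i)

/-- The total differential `∂ + (-1)^p d`. -/
def totalD (c : G.Cochain A) : G.Cochain A := fun p q σ =>
  c.simplicialD p q σ + (-1 : ℤ) ^ p • c.singularD p q σ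

end Cochain

open Classical in
/-- The integral of a `k`-form over a singular `k`-simplex `σ`, that is, of its pullback along
`e ↦ σ (1 - ∑ eᵢ, e₁, …, e_k)` over `{e | eᵢ ≥ 0, ∑ eᵢ ≤ 1}`. -/
def integrate {E M : Type*} [NormedAddCommGroup E] [NormedSpace ℝ E] [TopologicalSpace M]
    [ChartedSpace E M] {k : ℕ} (α : DForm E M k) (σ : stdSimplex ℝ (Fin (k + 1)) → M) : ℝ :=
  ∫ e in {e : Fin k → ℝ | Fin.cons (1 - ∑ i, e i) e ∈ stdSimplex ℝ (Fin (k + 1))},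
    (DForm.pullback (fun e' : Fin k → ℝ =>
      if h : Fin.cons (1 - ∑ i, e' i) e' ∈ stdSimplex ℝ (Fin (k + 1)) then σ ⟨_, h⟩
      else σ ⟨Pi.single 0 1, single_mem_stdSimplex ℝ 0⟩) α : DForm (Fin k → ℝ) (Fin k → ℝ) k) e
      (fun i => (Pi.single i 1 : Fin k → ℝ))

/-- The image of `η + om` under the de Rham map to real singular cochains. -/
def deRhamCochain (G : LieGroupoid E₀ E₁ X₀ X₁) (η : DForm G.PairsModel G.Pairs 1)
    (om : DForm E₁ X₁ 2) : G.Cochain ℝ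
  | 2, 1, σ => integrate η (fun x => (σ.toFun x).toPair)
  | 1, 2, σ => integrate om (fun x => (σ.toFun x).arr 0 1)
  | _, _, _ => 0

/-- The class of the 3-cocycle `η + om` lies in the image of
`H³(X_•, ℤ) → H³(X_•, ℝ) ≅ H³_DR(X_•)`: its de Rham cochain is cohomologous to an integer
3-cocycle. -/
def IsIntegerClass (G : LieGroupoid E₀ E₁ X₀ X₁) (η : DForm G.PairsModel G.Pairs 1)
    (om : DForm E₁ X₁ 2) : Prop :=
  ∃ (z : G.Cochain ℤ) (b : G.Cochain ℝ), z.IsHomogeneous 3 ∧ b.IsHomogeneous 2 ∧ z.totalD = 0 ∧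
    G.deRhamCochain η om = (fun p q σ => (z p q σ : ℝ)) + b.totalD

end IntegerClasses

end LieGroupoid

end

/-! The product. On `π⁻¹(Λ)` the form `(θ, θ, -θ) - η` has differential `-(∂ω + dη) = 0`, so every
chart of `X₂` carries flat lifts `(x, y, z)` near its centre (`exists_flat_lift`, from the Poincaré
lemma). Horizontal transport commutes with constant rotations by all of `T³`, and `T³` is transitive
on the fibres over `X₂`. Trivial holonomy says that transport over a loop moves a point only inside
its orbit under `T² = {(s, t, st)}`. Choosing one base point in each transport class modulo `T³`
therefore singles out one `T²`-orbit in every fibre, compatibly with transport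
(`exists_flat_section`). These orbits form the graph of a map `z = μ(x, y)`: invariance under `T²`
is bilinearity of `μ`, and invariance under transport makes `μ` agree locally with a flat lift.
Hence `μ` is smooth and `∂θ = π^*η` (`exists_isFlatMul`, `IsFlatMul.mdifferentiableAt_mul`).

The groupoid axioms. The two bracketings of a triple product differ by a phase depending only on the
point of `X₃`. They pull `θ` back to the same form because `∂η = 0`, so this phase is locally
constant. Connectedness of the source fibres deforms `(x, y, z)` to `(x, y, 1)`, then to `(x, 1,
1)`, then to `(1, 1, 1)`, where the phase is `1` because an idempotent lies over every unit
(`IsFlatMul.assoc`). Idempotents over a unit are unique and serve as units of the extension;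
inverses then follow from associativity (`IsFlatMul.exists_unit_inv`).

Integrality. Fix a set-theoretic section `r` of `π`. Let `ℓ` be a logarithm of horizontal transport
along 1-simplices of `X₁`, and `κ` a logarithm of the phase of `μ`, both measured against `r`. With
`b = -ℓ - κ`, the de Rham cochain minus `D b` takes integer values. In bidegree `(1, 2)` this is the
curvature formula for holonomy around a triangle; in `(2, 1)` it expresses that `μ` multiplies
horizontal paths up to the integral of `η`; in `(3, 0)` it is associativity of `μ`.

It remains to see that this integer cochain `z` is closed. Its coboundary is `D` of the de Rham
cochain, hence integer valued. On the other hand that value varies continuously when a simplex is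
contracted to a point, and it vanishes on constant simplices; so it is zero
(`totalD_deRhamCochain_eq_zero`). This replaces Stokes' theorem for the forms themselves. -/

set_option linter.unusedSectionVars false

/-! ### Smooth dependence of the pullback of an alternating map on both arguments. -/

namespace ContinuousAlternatingMap

variable {E F G : Type*} [NormedAddCommGroup E] [NormedSpace ℝ E] [NormedAddCommGroup F]
  [NormedSpace ℝ F] [NormedAddCommGroup G] [NormedSpace ℝ G] {k : ℕ}

/-- The projection of multilinear maps onto alternating maps. -/
noncomputable def skewProjection :
    ContinuousMultilinearMap ℝ (fun _ : Fin k => E) F →L[ℝ] E [⋀^Fin k]→L[ℝ] F where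
  toFun f := ((k.factorial : ℝ)⁻¹) • ContinuousMultilinearMap.alternatization f
  map_add' f g := by simp
  map_smul' c f := by
    ext v
    simp only [ContinuousMultilinearMap.alternatization_apply_apply, smul_apply,
      _root_.smul_apply, RingHom.id_apply, Finset.smul_sum]
    refine Finset.sum_congr rfl fun σ _ => ?_
    rw [smul_comm (Equiv.Perm.sign σ) c, smul_comm ((k.factorial : ℝ)⁻¹) c]
  cont := by
    refine Continuous.const_smul (c := ((k.factorial : ℝ)⁻¹))
      (g := fun f : ContinuousMultilinearMap ℝ (fun _ : Fin k => E) F =>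
        ContinuousMultilinearMap.alternatization f) ?_
    refine isUniformEmbedding_toContinuousMultilinearMap.isEmbedding.continuous_iff.2 ?_
    refine continuous_finsetSum (Finset.univ : Finset (Equiv.Perm (Fin k)))
      (f := fun σ (f : ContinuousMultilinearMap ℝ (fun _ : Fin k => E) F) =>
        Equiv.Perm.sign σ • f.domDomCongr σ) fun σ _ => ?_
    exact ((ContinuousMultilinearMap.domDomCongrₗᵢ ℝ E F σ).continuous).const_smul
      (Equiv.Perm.sign σ)

theorem skewProjection_coe (f : E [⋀^Fin k]→L[ℝ] F) :
    skewProjection (E := E) (F := F) (k := k) f.toContinuousMultilinearMap = f := by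
  ext v
  change (k.factorial : ℝ)⁻¹ • ContinuousMultilinearMap.alternatization f.toContinuousMultilinearMap v = _
  rw [ContinuousMultilinearMap.alternatization_apply_apply]
  have h : ∀ σ : Equiv.Perm (Fin k), Equiv.Perm.sign σ • f.toContinuousMultilinearMap (v ∘ σ)
      = f v := by
    intro σ
    change Equiv.Perm.sign σ • f.toAlternatingMap (v ∘ σ) = _
    rw [AlternatingMap.map_perm, smul_smul, Int.units_mul_self, one_smul]
    rfl
  rw [Finset.sum_congr rfl (fun σ _ => h σ), Finset.sum_const, Finset.card_univ,
    Fintype.card_perm, Fintype.card_fin, ← Nat.cast_smul_eq_nsmul ℝ, smul_smul,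
    inv_mul_cancel₀ (by positivity), one_smul]

/-- For multilinear maps the pullback is linear in the form and multilinear in the family of linear
maps, hence smooth. The continuous linear retraction `skewProjection` brings the values back to
alternating maps without changing them. -/
theorem contDiff_compContinuousLinearMap {n : ℕ∞ω} :
    ContDiff ℝ n (fun p : (F [⋀^Fin k]→L[ℝ] G) × (E →L[ℝ] F) =>
      p.1.compContinuousLinearMap p.2) := by
  have h1 : ContDiff ℝ n (fun p : (F [⋀^Fin k]→L[ℝ] G) × (E →L[ℝ] F) =>
      (ContinuousMultilinearMap.compContinuousLinearMapContinuousMultilinear ℝ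
        (fun _ : Fin k => E) (fun _ : Fin k => F) G (fun _ => p.2))
        p.1.toContinuousMultilinearMap) := by
    refine ContDiff.clm_apply ?_ ?_
    · exact (ContinuousMultilinearMap.contDiff _).comp (contDiff_pi.2 fun _ => contDiff_snd)
    · exact (toContinuousMultilinearMapLI (𝕜 := ℝ) (E := F) (F := G)
        (ι := Fin k)).contDiff.comp contDiff_fst
  have h2 := (skewProjection (E := E) (F := G) (k := k)).contDiff.comp h1
  exact (funext fun p : (F [⋀^Fin k]→L[ℝ] G) × (E →L[ℝ] F) => (skewProjection_coe (p.1.compContinuousLinearMap p.2)).symm :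
    _ = skewProjection ∘ _) ▸ h2

end ContinuousAlternatingMap

/-! ### Pullbacks of forms to normed spaces and naturality of the exterior derivative. -/

namespace DForm

variable {E M : Type*} [NormedAddCommGroup E] [NormedSpace ℝ E] [TopologicalSpace M]
  [ChartedSpace E M] {EP P : Type*} [NormedAddCommGroup EP] [NormedSpace ℝ EP]
  [TopologicalSpace P] [ChartedSpace EP P] {EQ Q : Type*} [NormedAddCommGroup EQ]
  [NormedSpace ℝ EQ] [TopologicalSpace Q] [ChartedSpace EQ Q]
  {V : Type*} [NormedAddCommGroup V] [NormedSpace ℝ V] {k : ℕ}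

/-- The pullback of a form along a map from a normed space, as a form on that space. -/
noncomputable def along (α : DForm E M k) (F : V → M) : V → V [⋀^Fin k]→L[ℝ] ℝ := fun v => α.pullback (EP := V) F v

theorem pullback_apply (α : DForm E M k) (f : P → M) (x : P) (w : Fin k → TangentSpace 𝓘(ℝ, EP) x) :
    α.pullback (EP := EP) f x w = α (f x) (fun i => mfderiv 𝓘(ℝ, EP) 𝓘(ℝ, E) f x (w i)) := rfl

theorem pullback_comp_apply (α : DForm E M k) {f : P → M} {g : Q → P} {x : Q}
    (hf : MDifferentiableAt 𝓘(ℝ, EP) 𝓘(ℝ, E) f (g x))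
    (hg : MDifferentiableAt 𝓘(ℝ, EQ) 𝓘(ℝ, EP) g x) :
    (pullback (EP := EP) f α).pullback (EP := EQ) g x = α.pullback (f ∘ g) x := by
  ext w
  rw [pullback_apply, pullback_apply, pullback_apply, mfderiv_comp x hf hg]
  rfl

theorem along_apply (α : DForm E M k) (F : V → M) (v : V) (w : Fin k → V) :
    α.along F v w = α (F v) (fun i => mfderiv 𝓘(ℝ, V) 𝓘(ℝ, E) F v (w i)) := rfl

theorem pullback_congr (α : DForm E M k) {f g : P → M} {x : P} (h : f =ᶠ[𝓝 x] g) :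
    α.pullback (EP := EP) f x = α.pullback g x := by
  ext w
  rw [pullback_apply, pullback_apply, h.mfderiv_eq, h.eq_of_nhds]

theorem along_congr (α : DForm E M k) {F G : V → M} {v : V} (h : F =ᶠ[𝓝 v] G) :
    α.along F v = α.along G v := α.pullback_congr h

/-- In a chart around `F v`, the pullback along `F` is the pullback of the chart expression. -/
theorem along_eq_inChart [IsManifold 𝓘(ℝ, E) ∞ M] (α : DForm E M k) {F : V → M} {v : V} {x₀ : M}
    (hF : MDifferentiableAt 𝓘(ℝ, V) 𝓘(ℝ, E) F v) (hx : F v ∈ (chartAt E x₀).source) :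
    α.along F v = (α.inChart x₀ (chartAt E x₀ (F v))).compContinuousLinearMap
      (fderiv ℝ (fun u => chartAt E x₀ (F u)) v) := by
  have h1 : MDifferentiableAt 𝓘(ℝ, E) 𝓘(ℝ, E) (chartAt E x₀) (F v) :=
    (mdifferentiable_chart x₀).mdifferentiableAt hx
  have h2 : MDifferentiableAt 𝓘(ℝ, E) 𝓘(ℝ, E) (chartAt E x₀).symm (chartAt E x₀ (F v)) :=
    (mdifferentiable_chart x₀).mdifferentiableAt_symm ((chartAt E x₀).map_source hx)
  have h3 : F =ᶠ[𝓝 v] (chartAt E x₀).symm ∘ (fun u => chartAt E x₀ (F u)) := by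
    filter_upwards [hF.continuousAt.preimage_mem_nhds ((chartAt E x₀).open_source.mem_nhds hx)]
      with u hu using ((chartAt E x₀).left_inv hu).symm
  have h4 : MDifferentiableAt 𝓘(ℝ, V) 𝓘(ℝ, E) (fun u => chartAt E x₀ (F u)) v := h1.comp v hF
  rw [along_congr α h3]
  ext w
  rw [along_apply, mfderiv_comp v h2 h4, mfderiv_eq_fderiv]
  rfl

theorem IsSmooth.contDiffOn_along [IsManifold 𝓘(ℝ, E) ∞ M] {α : DForm E M k} (hα : α.IsSmooth)
    {F : V → M} {U : Set V} (hU : IsOpen U) (hF : ContMDiffOn 𝓘(ℝ, V) 𝓘(ℝ, E) ∞ F U) :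
    ContDiffOn ℝ ∞ (α.along F) U := by
  intro v hv
  set x₀ := F v
  set W := U ∩ F ⁻¹' (chartAt E x₀).source
  have hW : IsOpen W := hF.continuousOn.isOpen_inter_preimage hU (chartAt E x₀).open_source
  have hvW : v ∈ W := ⟨hv, mem_chart_source E x₀⟩
  have h1 : ContDiffOn ℝ ∞ (fun u => chartAt E x₀ (F u)) W :=
    contMDiffOn_iff_contDiffOn.1
      ((contMDiffOn_chart (x := x₀)).comp (hF.mono inter_subset_left) (fun u hu => hu.2))
  have h2 : ContDiffOn ℝ ∞ (fun u => fderiv ℝ (fun u => chartAt E x₀ (F u)) u) W :=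
    h1.fderiv_of_isOpen hW (by simp)
  have h3 : ContDiffOn ℝ ∞ (fun u => α.inChart x₀ (chartAt E x₀ (F u))) W :=
    (hα x₀).comp h1 fun u hu => (chartAt E x₀).map_source hu.2
  have h4 := (ContinuousAlternatingMap.contDiff_compContinuousLinearMap (n := ∞)).comp_contDiffOn
    (h3.prodMk h2)
  refine (ContDiffAt.congr_of_eventuallyEq (h4.contDiffAt (hW.mem_nhds hvW)) ?_).contDiffWithinAt
  filter_upwards [hW.mem_nhds hvW] with u hu
  exact along_eq_inChart α ((hF.contMDiffAt (hU.mem_nhds hu.1)).mdifferentiableAt (by simp)) hu.2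

/-- `extD` at the point `F v` is computed in the chart at `F v`. Working in exactly that chart
reduces the claim to naturality of `extDeriv` for maps of normed spaces, with no comparison of
different charts. -/
theorem IsSmooth.extDeriv_along [IsManifold 𝓘(ℝ, E) ∞ M] {α : DForm E M k} (hα : α.IsSmooth)
    {F : V → M} {U : Set V} (hU : IsOpen U) (hF : ContMDiffOn 𝓘(ℝ, V) 𝓘(ℝ, E) ∞ F U)
    {v : V} (hv : v ∈ U) : extDeriv (α.along F) v = α.extD.along F v := by
  set x₀ := F v
  set W := U ∩ F ⁻¹' (chartAt E x₀).source
  have hW : IsOpen W := hF.continuousOn.isOpen_inter_preimage hU (chartAt E x₀).open_source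
  have hvW : v ∈ W := ⟨hv, mem_chart_source E x₀⟩
  have h1 : ContDiffOn ℝ ∞ (fun u => chartAt E x₀ (F u)) W :=
    contMDiffOn_iff_contDiffOn.1
      ((contMDiffOn_chart (x := x₀)).comp (hF.mono inter_subset_left) (fun u hu => hu.2))
  have hd : ∀ u ∈ W, MDifferentiableAt 𝓘(ℝ, V) 𝓘(ℝ, E) F u := fun u hu =>
    (hF.contMDiffAt (hU.mem_nhds hu.1)).mdifferentiableAt (by simp)
  have h5 : α.along F =ᶠ[𝓝 v] fun u => (α.inChart x₀ (chartAt E x₀ (F u))).compContinuousLinearMap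
      (fderiv ℝ (fun u => chartAt E x₀ (F u)) u) := by
    filter_upwards [hW.mem_nhds hvW] with u hu using along_eq_inChart α (hd u hu) hu.2
  have ht : chartAt E x₀ (F v) ∈ (chartAt E x₀).target :=
    (chartAt E x₀).map_source (mem_chart_source E x₀)
  rw [h5.extDeriv_eq, extDeriv_pullback (r := ∞) (f := fun u => chartAt E x₀ (F u))
    (((hα x₀).contDiffAt ((chartAt E x₀).open_target.mem_nhds ht)).differentiableAt (by simp))
    (h1.contDiffAt (hW.mem_nhds hvW)) (by
      rw [minSmoothness_of_isRCLikeNormedField]; exact WithTop.coe_le_coe.2 le_top)]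
  ext w
  rw [along_apply]
  have h6 : fderiv ℝ (fun u => chartAt E x₀ (F u)) v =
      (mfderiv 𝓘(ℝ, E) 𝓘(ℝ, E) (chartAt E x₀) (F v)).comp (mfderiv 𝓘(ℝ, V) 𝓘(ℝ, E) F v) := by
    rw [← mfderiv_eq_fderiv]
    exact mfderiv_comp v ((mdifferentiable_chart x₀).mdifferentiableAt (mem_chart_source E x₀))
      (hd v hvW)
  rw [h6]
  rfl

end DForm

/-! ### One-forms on normed spaces and the Poincaré lemma. -/

section OneForms

variable {V : Type*} [NormedAddCommGroup V] [NormedSpace ℝ V]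

/-- A one-form as a family of linear functionals. -/
noncomputable def oneFormCLM (β : V → V [⋀^Fin 1]→L[ℝ] ℝ) (v : V) : V →L[ℝ] ℝ :=
  (ContinuousAlternatingMap.ofSubsingletonLIE (𝕜 := ℝ) (E := V) (F := ℝ) (0 : Fin 1)).symm (β v)

theorem oneFormCLM_apply (β : V → V [⋀^Fin 1]→L[ℝ] ℝ) (v w : V) :
    oneFormCLM β v w = β v (fun _ => w) := rfl

theorem ContDiffOn.oneFormCLM {β : V → V [⋀^Fin 1]→L[ℝ] ℝ} {n : ℕ∞ω} {B : Set V}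
    (h : ContDiffOn ℝ n β B) : ContDiffOn ℝ n (oneFormCLM β) B :=
  (ContinuousAlternatingMap.ofSubsingletonLIE (𝕜 := ℝ) (E := V) (F := ℝ) (0 : Fin 1)).symm.contDiff.comp_contDiffOn h

/-- Rewrites closedness of a one-form as symmetry of the derivative of the associated functional,
the form in which the Poincaré lemma takes it. -/
theorem extDeriv_oneForm_apply {β : V → V [⋀^Fin 1]→L[ℝ] ℝ} {v : V}
    (h : DifferentiableAt ℝ β v) (w : Fin 2 → V) :
    extDeriv β v w =
      fderiv ℝ (oneFormCLM β) v (w 0) (w 1) - fderiv ℝ (oneFormCLM β) v (w 1) (w 0) := by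
  have hd : DifferentiableAt ℝ (oneFormCLM β) v :=
    (ContinuousAlternatingMap.ofSubsingletonLIE (𝕜 := ℝ) (E := V) (F := ℝ) (0 : Fin 1)).symm.differentiable.differentiableAt.comp v h
  have key : ∀ u x : V, fderiv ℝ (oneFormCLM β) v x u = fderiv ℝ (fun y => β y (fun _ => u)) v x := by
    intro u x
    have := hd.hasFDerivAt.clm_apply (hasFDerivAt_const u v)
    rw [show (fun y => β y (fun _ => u)) = fun y => oneFormCLM β y u from rfl, this.fderiv]
    simp
  rw [extDeriv_apply h, Fin.sum_univ_two, key, key, sub_eq_add_neg]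
  have e0 : (0 : Fin 2).removeNth w = fun _ => w 1 := by
    ext i; fin_cases i; rfl
  have e1 : (1 : Fin 2).removeNth w = fun _ => w 0 := by
    ext i; fin_cases i; rfl
  simp [e0, e1]

/-- Poincaré lemma for smooth one-forms on open convex sets. -/
theorem exists_primitive_of_closed {β : V → V [⋀^Fin 1]→L[ℝ] ℝ} {B : Set V} (hB : IsOpen B)
    (hc : Convex ℝ B) {n : ℕ∞ω} (hn : n ≠ 0) (hβ : ContDiffOn ℝ n β B)
    (hd : ∀ v ∈ B, extDeriv β v = 0) :
    ∃ φ : V → ℝ, ∀ v ∈ B, HasFDerivAt φ (oneFormCLM β v) v := by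
  refine hc.exists_forall_hasFDerivAt_of_fderiv_symmetric hB
    (hβ.oneFormCLM.differentiableOn hn) fun a ha x y => ?_
  have h := extDeriv_oneForm_apply ((hβ.contDiffAt (hB.mem_nhds ha)).differentiableAt hn) ![x, y]
  rw [hd a ha] at h
  simpa [sub_eq_zero] using h.symm

theorem contDiffOn_primitive {φ : V → ℝ} {β : V → V [⋀^Fin 1]→L[ℝ] ℝ} {B : Set V} (hB : IsOpen B)
    (hβ : ContDiffOn ℝ ∞ β B) (h : ∀ v ∈ B, HasFDerivAt φ (oneFormCLM β v) v) :
    ContDiffOn ℝ ∞ φ B := by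
  rw [contDiffOn_infty_iff_fderiv_of_isOpen hB]
  exact ⟨fun v hv => (h v hv).differentiableAt.differentiableWithinAt,
    hβ.oneFormCLM.congr fun v hv => (h v hv).fderiv⟩

end OneForms

/-! ### The circle as `ℝ/ℤ`: exponential, local logarithms, phases. -/

section CirclePhase

/-- The point `exp (2πiτ)` of the circle. -/
noncomputable def cexp (τ : ℝ) : Circle := Circle.exp (2 * Real.pi * τ)

theorem cexp_zero : cexp 0 = 1 := by simp [cexp]
theorem cexp_add (a b : ℝ) : cexp (a + b) = cexp a * cexp b := by
  simp [cexp, mul_add, Circle.exp_add]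
theorem cexp_neg (a : ℝ) : cexp (-a) = (cexp a)⁻¹ := by simp [cexp, Circle.exp_neg]
theorem cexp_sub (a b : ℝ) : cexp (a - b) = cexp a * (cexp b)⁻¹ := by
  rw [sub_eq_add_neg, cexp_add, cexp_neg]

theorem cexp_eq_one_iff {a : ℝ} : cexp a = 1 ↔ ∃ n : ℤ, a = n := by
  rw [cexp, Circle.exp_eq_one]
  have := Real.two_pi_pos.ne'
  refine exists_congr fun n => ?_
  constructor
  · intro h
    apply mul_left_cancel₀ this
    rw [h]; ring
  · rintro rfl; ring

theorem contMDiff_cexp : ContMDiff 𝓘(ℝ, ℝ) (𝓡 1) ∞ cexp :=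
  contMDiff_circleExp.comp (contDiff_const.mul contDiff_id).contMDiff

/-- Rotating `s₀` to `1` before taking the argument moves the branch cut to the antipode of `s₀`.
The logarithm inverts `cexp` on the whole circle; only its smoothness is restricted to `U`. -/
theorem exists_circle_log (s₀ : Circle) : ∃ (ℓ : Circle → ℝ) (U : Set Circle), IsOpen U ∧ s₀ ∈ U ∧
    ContMDiffOn (𝓡 1) 𝓘(ℝ, ℝ) ∞ ℓ U ∧ ∀ s, cexp (ℓ s) = s := by
  have h2 := Real.two_pi_pos.ne'
  refine ⟨fun s => (Complex.arg (s / s₀ : Circle) + Complex.arg s₀) / (2 * Real.pi),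
    {s | ((s / s₀ : Circle) : ℂ) ∈ Complex.slitPlane}, ?_, ?_, ?_, ?_⟩
  · exact Complex.isOpen_slitPlane.preimage
      (continuous_subtype_val.comp (continuous_id.div_const s₀))
  · simp
  · intro s hs
    have hmul : ContMDiff (𝓡 1) (𝓡 1) ∞ (fun s : Circle => s / s₀) := by
      simp_rw [div_eq_mul_inv]
      exact contMDiff_mul_right
    have : Fact (Module.finrank ℝ ℂ = 1 + 1) := finrank_real_complex_fact'
    have hc : ContMDiffAt (𝓡 1) 𝓘(ℝ, ℂ) ∞ (fun s : Circle => ((s / s₀ : Circle) : ℂ)) s :=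
      (contMDiff_coe_sphere (n := 1) (E := ℂ)).contMDiffAt.comp s hmul.contMDiffAt
    have hl : ContDiffAt ℝ ∞ (fun z : ℂ => (Complex.log z).im) ((s / s₀ : Circle) : ℂ) :=
      Complex.imCLM.contDiff.contDiffAt.comp _ ((Complex.contDiffAt_log hs).restrict_scalars ℝ)
    have h3 := hl.contMDiffAt.comp s hc
    have h4 : ContDiff ℝ ∞ (fun x : ℝ => (x + Complex.arg s₀) / (2 * Real.pi)) :=
      (contDiff_id.add contDiff_const).div_const _
    refine (((h4.contMDiff.contMDiffAt).comp s h3).congr_of_eventuallyEq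
      (Filter.Eventually.of_forall fun q => ?_)).contMDiffWithinAt
    simp [Complex.log_im]
  · intro s
    rw [cexp, mul_div_cancel₀ _ h2, Circle.exp_add, Circle.exp_arg, Circle.exp_arg]
    simp

theorem cexp_surjective : Function.Surjective cexp := fun s => by
  obtain ⟨ℓ, -, -, -, -, h⟩ := exists_circle_log s
  exact ⟨_, h s⟩

open Classical in
/-- The element of the circle which moves `a` to `b` (and `1` if there is none). -/
noncomputable def phase {R : Type*} [MulAction Circle R] (a b : R) : Circle :=
  if h : ∃ s : Circle, s • a = b then h.choose else 1

end CirclePhase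

/-! ### Principal circle bundles: simply transitive fibres, regularity of phases, local sections. -/

namespace IsPrincipalCircleBundle

variable {E₁ ER X₁ R : Type*}
  [NormedAddCommGroup E₁] [NormedSpace ℝ E₁] [TopologicalSpace X₁] [ChartedSpace E₁ X₁]
  [NormedAddCommGroup ER] [NormedSpace ℝ ER] [TopologicalSpace R] [ChartedSpace ER R]
  [MulAction Circle R] {π : R → X₁} (P : IsPrincipalCircleBundle E₁ ER π)
include P

theorem exists_smul_eq {a b : R} (h : π a = π b) : ∃ s : Circle, s • a = b := by
  obtain ⟨e, he, -, -, hs⟩ := P.locally_trivial (π a)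
  have ha : a ∈ e.source := e.mem_source.2 he
  have hb : b ∈ e.source := e.mem_source.2 (h ▸ he)
  refine ⟨(e b).2 * ((e a).2)⁻¹, ?_⟩
  have hsa : ((e b).2 * ((e a).2)⁻¹) • a ∈ e.source := by
    rw [e.mem_source, P.proj_smul]; exact he
  refine e.injOn hsa hb (Prod.ext (?_ : (e _).1 = (e _).1) (?_ : (e _).2 = (e _).2))
  · rw [e.coe_fst hsa, e.coe_fst hb, P.proj_smul, h]
  · rw [hs _ _ ha]; simp

theorem smul_left_cancel {a : R} {s t : Circle} (h : s • a = t • a) : s = t := by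
  obtain ⟨e, he, -, -, hs⟩ := P.locally_trivial (π a)
  have ha : a ∈ e.source := e.mem_source.2 he
  have h1 := hs s a ha
  rw [h, hs t a ha] at h1
  exact (mul_right_cancel h1).symm

theorem phase_smul {a b : R} (h : π a = π b) : phase a b • a = b := by
  have h1 := P.exists_smul_eq h
  rw [phase, dif_pos h1]
  exact h1.choose_spec

theorem phase_eq {a b : R} {s : Circle} (h : s • a = b) : phase a b = s := by
  refine P.smul_left_cancel (a := a) ?_
  rw [h, P.phase_smul]
  rw [← h, P.proj_smul]

theorem phase_self (a : R) : phase a a = 1 := P.phase_eq (one_smul _ a)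

theorem phase_smul_left {a b : R} (h : π a = π b) (s : Circle) :
    phase (s • a) b = s⁻¹ * phase a b :=
  P.phase_eq (by rw [smul_smul, mul_right_comm, inv_mul_cancel, one_mul, P.phase_smul h])

theorem phase_mul_phase {a b c : R} (h : π a = π b) (h' : π b = π c) :
    phase a b * phase b c = phase a c :=
  (P.phase_eq (by rw [mul_comm, mul_smul, P.phase_smul h, P.phase_smul h'])).symm

/-- Near a given fibre the phase is the quotient of the fibre coordinates. -/
theorem exists_coordinate (x : X₁) : ∃ (U : Set R) (ψ : R → Circle), IsOpen U ∧ π ⁻¹' {x} ⊆ U ∧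
    ContMDiffOn 𝓘(ℝ, ER) (𝓡 1) ∞ ψ U ∧
    ∀ a ∈ U, ∀ b ∈ U, π a = π b → phase a b = ψ b * (ψ a)⁻¹ := by
  obtain ⟨e, he, h1, -, hs⟩ := P.locally_trivial x
  refine ⟨e.source, fun r => (e r).2, e.open_source, ?_, ?_, ?_⟩
  · rintro r rfl
    exact e.mem_source.2 he
  · exact contMDiff_snd.comp_contMDiffOn h1
  · intro a ha b hb h
    refine P.phase_eq ?_
    have hsa : ((e b).2 * ((e a).2)⁻¹) • a ∈ e.source := by
      rw [e.mem_source, P.proj_smul]; exact e.mem_source.1 ha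
    refine e.injOn hsa hb (Prod.ext (?_ : (e _).1 = (e _).1) (?_ : (e _).2 = (e _).2))
    · rw [e.coe_fst hsa, e.coe_fst hb, P.proj_smul, h]
    · rw [hs _ _ ha]; simp

section Regularity

variable {EQ Q : Type*} [NormedAddCommGroup EQ] [NormedSpace ℝ EQ] [TopologicalSpace Q]
  [ChartedSpace EQ Q] {F G : Q → R} {p : Q}

/-- Locally the phase is a quotient of fibre coordinates, so it inherits the regularity of `F` and
`G`. Three grades are needed: lifts over charts are smooth, lifts with prescribed `θ` are only
differentiable, and path lifts are only continuous at the ends of the interval. -/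
theorem contMDiffAt_phase (hF : ContMDiffAt 𝓘(ℝ, EQ) 𝓘(ℝ, ER) ∞ F p)
    (hG : ContMDiffAt 𝓘(ℝ, EQ) 𝓘(ℝ, ER) ∞ G p) (h : ∀ᶠ q in 𝓝 p, π (F q) = π (G q)) :
    ContMDiffAt 𝓘(ℝ, EQ) (𝓡 1) ∞ (fun q => phase (F q) (G q)) p := by
  obtain ⟨U, ψ, hU, hx, hψ, hph⟩ := P.exists_coordinate (π (F p))
  have hFU : F p ∈ U := hx rfl
  have hGU : G p ∈ U := hx h.self_of_nhds.symm
  have h1 := (hψ.contMDiffAt (hU.mem_nhds hGU)).comp p hG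
  have h2 := (hψ.contMDiffAt (hU.mem_nhds hFU)).comp p hF
  refine (h1.mul h2.inv).congr_of_eventuallyEq ?_
  filter_upwards [h, hF.continuousAt (hU.mem_nhds hFU), hG.continuousAt (hU.mem_nhds hGU)]
    with q hq hq1 hq2 using hph _ hq1 _ hq2 hq

theorem mdifferentiableAt_phase (hF : MDifferentiableAt 𝓘(ℝ, EQ) 𝓘(ℝ, ER) F p)
    (hG : MDifferentiableAt 𝓘(ℝ, EQ) 𝓘(ℝ, ER) G p) (h : ∀ᶠ q in 𝓝 p, π (F q) = π (G q)) :
    MDifferentiableAt 𝓘(ℝ, EQ) (𝓡 1) (fun q => phase (F q) (G q)) p := by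
  obtain ⟨U, ψ, hU, hx, hψ, hph⟩ := P.exists_coordinate (π (F p))
  have hFU : F p ∈ U := hx rfl
  have hGU : G p ∈ U := hx h.self_of_nhds.symm
  have h1 := ((hψ.contMDiffAt (hU.mem_nhds hGU)).mdifferentiableAt (by simp)).comp p hG
  have h2 := ((hψ.contMDiffAt (hU.mem_nhds hFU)).mdifferentiableAt (by simp)).comp p hF
  have hm : MDifferentiableAt ((𝓡 1).prod (𝓡 1)) (𝓡 1)
      (fun q : Circle × Circle => q.1 * q.2⁻¹) (ψ (G p), ψ (F p)) :=
    ((contMDiff_fst.mul contMDiff_snd.inv).contMDiffAt (n := ∞)).mdifferentiableAt (by simp)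
  refine (hm.comp p (h1.prodMk h2)).congr_of_eventuallyEq ?_
  filter_upwards [h, hF.continuousAt (hU.mem_nhds hFU), hG.continuousAt (hU.mem_nhds hGU)]
    with q hq hq1 hq2 using hph _ hq1 _ hq2 hq

omit [ChartedSpace EQ Q] [NormedSpace ℝ EQ] [NormedAddCommGroup EQ] in
theorem continuousWithinAt_phase {s : Set Q} (hF : ContinuousWithinAt F s p)
    (hG : ContinuousWithinAt G s p) (hp : p ∈ s) (h : ∀ q ∈ s, π (F q) = π (G q)) :
    ContinuousWithinAt (fun q => phase (F q) (G q)) s p := by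
  obtain ⟨U, ψ, hU, hx, hψ, hph⟩ := P.exists_coordinate (π (F p))
  have hFU : F p ∈ U := hx rfl
  have hGU : G p ∈ U := hx (h p hp).symm
  have h1 := (hψ.contMDiffAt (hU.mem_nhds hGU)).continuousAt.comp_continuousWithinAt hG
  have h2 := (hψ.contMDiffAt (hU.mem_nhds hFU)).continuousAt.comp_continuousWithinAt hF
  refine (h1.mul h2.inv).congr_of_eventuallyEq ?_ (hph _ hFU _ hGU (h p hp))
  filter_upwards [self_mem_nhdsWithin, hF (hU.mem_nhds hFU), hG (hU.mem_nhds hGU)]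
    with q hq hq1 hq2 using hph _ hq1 _ hq2 (h q hq)

end Regularity

/-- Local sections. -/
theorem exists_section (x : X₁) : ∃ (U : Set X₁) (σ : X₁ → R), IsOpen U ∧ x ∈ U ∧
    ContMDiffOn 𝓘(ℝ, E₁) 𝓘(ℝ, ER) ∞ σ U ∧ ∀ y ∈ U, π (σ y) = y := by
  obtain ⟨e, he, -, h2, -⟩ := P.locally_trivial x
  refine ⟨e.baseSet, fun y => e.toOpenPartialHomeomorph.symm (y, 1), e.open_baseSet, he, ?_, ?_⟩
  · exact h2.comp (contMDiff_id.prodMk contMDiff_const).contMDiffOn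
      fun y hy => e.mem_target.2 hy
  · intro y hy
    exact e.proj_symm_apply (e.mem_target.2 hy)

theorem surjective : Function.Surjective π := fun x => by
  obtain ⟨U, σ, -, hx, -, h⟩ := P.exists_section x
  exact ⟨_, h x hx⟩

end IsPrincipalCircleBundle

/-! ### Connection forms and rotation by a variable phase. -/

section ConnectionForms

theorem oneForm_smul {V : Type*} [NormedAddCommGroup V] [NormedSpace ℝ V] (f : V [⋀^Fin 1]→L[ℝ] ℝ)
    (a : ℝ) (v : V) : f (fun _ => a • v) = a * f (fun _ => v) :=
  map_smul ((ContinuousAlternatingMap.ofSubsingletonLIE (𝕜 := ℝ) (E := V) (F := ℝ) (0 : Fin 1)).symm f) a v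

theorem oneForm_add {V : Type*} [NormedAddCommGroup V] [NormedSpace ℝ V] (f : V [⋀^Fin 1]→L[ℝ] ℝ)
    (v w : V) : f (fun _ => v + w) = f (fun _ => v) + f (fun _ => w) :=
  map_add ((ContinuousAlternatingMap.ofSubsingletonLIE (𝕜 := ℝ) (E := V) (F := ℝ) (0 : Fin 1)).symm f) v w

theorem clm_real_apply {V : Type*} [NormedAddCommGroup V] [NormedSpace ℝ V] (f : ℝ →L[ℝ] V)
    (a : ℝ) : f a = a • f 1 := by
  rw [← map_smul, smul_eq_mul, mul_one]

variable {E₁ ER X₁ R : Type*}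
  [NormedAddCommGroup E₁] [NormedSpace ℝ E₁] [TopologicalSpace X₁] [ChartedSpace E₁ X₁]
  [NormedAddCommGroup ER] [NormedSpace ℝ ER] [TopologicalSpace R] [ChartedSpace ER R]
  [MulAction Circle R] {π : R → X₁} {EQ Q : Type*} [NormedAddCommGroup EQ] [NormedSpace ℝ EQ]
  [TopologicalSpace Q] [ChartedSpace EQ Q]

theorem IsPrincipalCircleBundle.contMDiff_cexp_smul (P : IsPrincipalCircleBundle E₁ ER π) :
    ContMDiff (𝓘(ℝ, ℝ).prod 𝓘(ℝ, ER)) 𝓘(ℝ, ER) ∞ (fun q : ℝ × R => cexp q.1 • q.2) :=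
  P.contMDiff_smul.comp ((contMDiff_cexp.comp contMDiff_fst).prodMk contMDiff_snd)

theorem IsPrincipalCircleBundle.contMDiff_const_smul (P : IsPrincipalCircleBundle E₁ ER π)
    (s : Circle) : ContMDiff 𝓘(ℝ, ER) 𝓘(ℝ, ER) ∞ (fun r : R => s • r) :=
  P.contMDiff_smul.comp (contMDiff_const.prodMk contMDiff_id)

theorem IsConnectionForm.pullback_const_smul {θ : DForm ER R 1} (hθ : IsConnectionForm θ)
    (P : IsPrincipalCircleBundle E₁ ER π) (s : Circle) {F : Q → R} {p : Q}
    (hF : MDifferentiableAt 𝓘(ℝ, EQ) 𝓘(ℝ, ER) F p) :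
    θ.pullback (EP := EQ) (fun q => s • F q) p = θ.pullback (EP := EQ) F p := by
  have h := DForm.pullback_comp_apply θ (f := fun r : R => s • r) (g := F) (x := p)
    ((P.contMDiff_const_smul s).mdifferentiable (by simp) _) hF
  rw [hθ.invariant s] at h
  exact h.symm

/-- The definition normalises `θ` on the velocity of the action at time `0` only; the group law
`cexp τ = cexp (τ - τ₀) * cexp τ₀` carries this to every time `τ₀`. -/
theorem IsConnectionForm.apply_velocity {θ : DForm ER R 1} (hθ : IsConnectionForm θ)
    (P : IsPrincipalCircleBundle E₁ ER π) (r : R) (τ₀ a : ℝ) :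
    θ (cexp τ₀ • r) (fun _ => mfderiv 𝓘(ℝ, ℝ) 𝓘(ℝ, ER) (fun τ : ℝ => cexp τ • r) τ₀ a) = a := by
  have hsm : ∀ r : R, MDifferentiable 𝓘(ℝ, ℝ) 𝓘(ℝ, ER) (fun τ : ℝ => cexp τ • r) := fun r =>
    (P.contMDiff_cexp_smul.comp (contMDiff_id.prodMk contMDiff_const)).mdifferentiable (by simp)
  have h0 : θ (cexp (0 : ℝ) • (cexp τ₀ • r)) (fun _ => mfderiv 𝓘(ℝ, ℝ) 𝓘(ℝ, ER)
      (fun τ : ℝ => cexp τ • (cexp τ₀ • r)) (0 : ℝ) (1 : ℝ)) = 1 :=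
    hθ.apply_generator (cexp τ₀ • r)
  have h1 : (fun τ : ℝ => cexp τ • r) = (fun τ : ℝ => cexp τ • (cexp τ₀ • r)) ∘ (fun τ => τ - τ₀) := by
    ext τ
    simp [smul_smul, ← cexp_add]
  have h2 : HasMFDerivAt 𝓘(ℝ, ℝ) 𝓘(ℝ, ℝ) (fun τ : ℝ => τ - τ₀) τ₀ (ContinuousLinearMap.id ℝ ℝ) :=
    ((hasFDerivAt_id τ₀).sub_const τ₀).hasMFDerivAt
  have h3 : HasMFDerivAt 𝓘(ℝ, ℝ) 𝓘(ℝ, ER) (fun τ : ℝ => cexp τ • (cexp τ₀ • r)) (τ₀ - τ₀)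
      (mfderiv 𝓘(ℝ, ℝ) 𝓘(ℝ, ER) (fun τ : ℝ => cexp τ • (cexp τ₀ • r)) (τ₀ - τ₀)) :=
    (hsm (cexp τ₀ • r) _).hasMFDerivAt
  have h4 := (HasMFDerivAt.comp (f := fun τ : ℝ => τ - τ₀) τ₀ h3 h2).mfderiv
  rw [← h1] at h4
  rw [h4]
  -- The time `τ₀ - τ₀` occurs inside the types of tangent vectors; replacing it by a variable equal
  -- to `0` makes substitution possible.
  have h5 : ∀ (x : ℝ), x = 0 → θ (cexp τ₀ • r) (fun _ => mfderiv 𝓘(ℝ, ℝ) 𝓘(ℝ, ER)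
      (fun τ : ℝ => cexp τ • (cexp τ₀ • r)) x a) = a := by
    rintro x rfl
    have h6 : cexp (0 : ℝ) • (cexp τ₀ • r) = cexp τ₀ • r := by rw [cexp_zero, one_smul]
    have h7 := oneForm_smul (V := ER) (θ (cexp (0 : ℝ) • (cexp τ₀ • r))) a
      (mfderiv 𝓘(ℝ, ℝ) 𝓘(ℝ, ER) (fun τ : ℝ => cexp τ • (cexp τ₀ • r)) (0 : ℝ) (1 : ℝ))
    have h8 : mfderiv 𝓘(ℝ, ℝ) 𝓘(ℝ, ER) (fun τ : ℝ => cexp τ • (cexp τ₀ • r)) (0 : ℝ) a =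
        a • mfderiv 𝓘(ℝ, ℝ) 𝓘(ℝ, ER) (fun τ : ℝ => cexp τ • (cexp τ₀ • r)) (0 : ℝ) (1 : ℝ) :=
      clm_real_apply (V := ER) (mfderiv 𝓘(ℝ, ℝ) 𝓘(ℝ, ER)
        (fun τ : ℝ => cexp τ • (cexp τ₀ • r)) (0 : ℝ)) a
    have h9 : ∀ r' : R, r' = cexp τ₀ • r → ∀ x : ER,
        (θ (cexp τ₀ • r) (fun _ => x) : ℝ) = θ r' (fun _ => x) := by
      rintro _ rfl x; rfl
    refine (h9 _ h6 _).trans ?_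
    rw [h8]
    exact h7.trans ((congrArg (fun x : ℝ => a * x) h0).trans (mul_one a))
  exact h5 _ (sub_self τ₀)

/-- The derivative of a real function on a manifold. -/
noncomputable def realDeriv (φ : Q → ℝ) (p : Q) (w : TangentSpace 𝓘(ℝ, EQ) p) : ℝ :=
  mfderiv 𝓘(ℝ, EQ) 𝓘(ℝ, ℝ) φ p w

/-- The pullback of a connection form along a map rotated by a real phase. -/
theorem IsConnectionForm.pullback_cexp_smul {θ : DForm ER R 1} (hθ : IsConnectionForm θ)
    (P : IsPrincipalCircleBundle E₁ ER π) {F : Q → R} {φ : Q → ℝ} {p : Q}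
    (hF : MDifferentiableAt 𝓘(ℝ, EQ) 𝓘(ℝ, ER) F p)
    (hφ : MDifferentiableAt 𝓘(ℝ, EQ) 𝓘(ℝ, ℝ) φ p) (w : TangentSpace 𝓘(ℝ, EQ) p) :
    θ.pullback (EP := EQ) (fun q => cexp (φ q) • F q) p (fun _ => w) =
      θ.pullback (EP := EQ) F p (fun _ => w) + realDeriv φ p w := by
  have hΨ : MDifferentiableAt (𝓘(ℝ, ℝ).prod 𝓘(ℝ, ER)) 𝓘(ℝ, ER) (fun q : ℝ × R => cexp q.1 • q.2)
      (φ p, F p) := P.contMDiff_cexp_smul.mdifferentiable (by simp) _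
  -- Product rule for the action: a vertical part, on which `θ` returns `dφ`, and a rotated part, on
  -- which invariance of `θ` returns `F^*θ`.
  have h1 : mfderiv 𝓘(ℝ, EQ) 𝓘(ℝ, ER) (fun q => cexp (φ q) • F q) p w =
      mfderiv 𝓘(ℝ, ℝ) 𝓘(ℝ, ER) (fun τ : ℝ => cexp τ • F p) (φ p) (mfderiv 𝓘(ℝ, EQ) 𝓘(ℝ, ℝ) φ p w) +
      mfderiv 𝓘(ℝ, ER) 𝓘(ℝ, ER) (fun r : R => cexp (φ p) • r) (F p)
        (mfderiv 𝓘(ℝ, EQ) 𝓘(ℝ, ER) F p w) := by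
    have h2 := mfderiv_comp_apply p hΨ (hφ.prodMk hF) w
    refine h2.trans ?_
    rw [mfderiv_prod_eq_add_apply hΨ, hφ.mfderiv_prod hF]
    rfl
  have h3 := hθ.apply_velocity P (F p) (φ p) (mfderiv 𝓘(ℝ, EQ) 𝓘(ℝ, ℝ) φ p w)
  have h4 : θ.pullback (EP := ER) (fun r : R => cexp (φ p) • r) (F p)
      (fun _ => mfderiv 𝓘(ℝ, EQ) 𝓘(ℝ, ER) F p w) = θ (F p)
      (fun _ => mfderiv 𝓘(ℝ, EQ) 𝓘(ℝ, ER) F p w) := by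
    rw [hθ.invariant]
  rw [DForm.pullback_apply, h1]
  refine (oneForm_add (V := ER) (θ (cexp (φ p) • F p)) _ _).trans ?_
  rw [add_comm]
  exact congrArg₂ (fun x y : ℝ => x + y) h4 h3

/-- Two maps into the bundle with the same projection differ locally by a real phase. -/
theorem IsPrincipalCircleBundle.exists_angle (P : IsPrincipalCircleBundle E₁ ER π) {F G : Q → R}
    {p : Q} (hF : ContinuousAt F p) (hG : ContinuousAt G p)
    (h : ∀ᶠ q in 𝓝 p, π (F q) = π (G q)) :
    ∃ φ : Q → ℝ, (∀ᶠ q in 𝓝 p, G q = cexp (φ q) • F q) ∧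
      ∀ᶠ q in 𝓝 p, MDifferentiableAt 𝓘(ℝ, EQ) 𝓘(ℝ, ER) F q →
        MDifferentiableAt 𝓘(ℝ, EQ) 𝓘(ℝ, ER) G q → MDifferentiableAt 𝓘(ℝ, EQ) 𝓘(ℝ, ℝ) φ q := by
  obtain ⟨ℓ, U, hU, hs, hℓ, hexp⟩ := exists_circle_log (phase (F p) (G p))
  obtain ⟨W, hW, hWo, hpW⟩ := mem_nhds_iff.1 h
  have hc : ContinuousAt (fun q => phase (F q) (G q)) p :=
    (P.continuousWithinAt_phase hF.continuousWithinAt hG.continuousWithinAt hpW hW).continuousAt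
      (hWo.mem_nhds hpW)
  refine ⟨fun q => ℓ (phase (F q) (G q)), ?_, ?_⟩
  · filter_upwards [h] with q hq
    rw [hexp, P.phase_smul hq]
  · filter_upwards [h.eventually_nhds, hc (hU.mem_nhds hs)] with q hq hqU h1 h2
    exact ((hℓ.contMDiffAt (hU.mem_nhds hqU)).mdifferentiableAt (by simp)).comp q
      (P.mdifferentiableAt_phase h1 h2 hq)

variable {V : Type*} [NormedAddCommGroup V] [NormedSpace ℝ V]

theorem IsConnectionForm.along_cexp_smul {θ : DForm ER R 1} (hθ : IsConnectionForm θ)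
    (P : IsPrincipalCircleBundle E₁ ER π) {F : V → R} {φ : V → ℝ} {v : V}
    (hF : MDifferentiableAt 𝓘(ℝ, V) 𝓘(ℝ, ER) F v) (hφ : DifferentiableAt ℝ φ v) (w : V) :
    θ.along (fun q => cexp (φ q) • F q) v (fun _ => w) =
      θ.along F v (fun _ => w) + fderiv ℝ φ v w := by
  have h := hθ.pullback_cexp_smul P hF hφ.mdifferentiableAt w
  have h' : realDeriv (EQ := V) φ v w = fderiv ℝ φ v w :=
    congrArg (fun f : V →L[ℝ] ℝ => f w) mfderiv_eq_fderiv
  rw [h'] at h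
  exact h

/-- Two maps with the same projection and the same pullback of the connection form differ by a
constant phase. -/
theorem IsConnectionForm.exists_smul_eq_of_along_eq {θ : DForm ER R 1} (hθ : IsConnectionForm θ)
    (P : IsPrincipalCircleBundle E₁ ER π) {F G : V → R} {U : Set V} (hU : IsOpen U)
    (hc : IsPreconnected U)
    (hF : ∀ v ∈ U, MDifferentiableAt 𝓘(ℝ, V) 𝓘(ℝ, ER) F v)
    (hG : ∀ v ∈ U, MDifferentiableAt 𝓘(ℝ, V) 𝓘(ℝ, ER) G v)
    (h : ∀ v ∈ U, π (F v) = π (G v))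
    (he : ∀ v ∈ U, ∀ w, θ.along F v (fun _ => w) = θ.along G v (fun _ => w)) :
    ∀ v ∈ U, ∀ v' ∈ U, phase (F v) (G v) = phase (F v') (G v') := by
  -- On a small ball the phase is `cexp φ` with `dφ = G^*θ - F^*θ = 0`.
  have hloc : IsLocallyConstant (fun v : U => phase (F v) (G v)) := by
    rw [IsLocallyConstant.iff_eventually_eq]
    rintro ⟨v, hv⟩
    have hUv := hU.mem_nhds hv
    obtain ⟨φ, h1, h2⟩ := P.exists_angle (EQ := V) (hF v hv).continuousAt (hG v hv).continuousAt
      (Filter.mem_of_superset hUv h)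
    obtain ⟨ε, hε, hball⟩ := Metric.eventually_nhds_iff_ball.1
      (h1.eventually_nhds.and (h2.and hUv))
    have hφ : ∀ u ∈ Metric.ball v ε, DifferentiableAt ℝ φ u := fun u hu =>
      ((hball u hu).2.1 (hF u (hball u hu).2.2) (hG u (hball u hu).2.2)).differentiableAt
    have hd : ∀ u ∈ Metric.ball v ε, fderiv ℝ φ u = 0 := by
      intro u hu
      obtain ⟨h3, h4, h5⟩ := hball u hu
      ext w
      have h6 := hθ.along_cexp_smul P (hF u h5) (hφ u hu) w
      rw [← DForm.along_congr θ h3, ← he u h5] at h6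
      simpa using h6
    have hconst : ∀ u ∈ Metric.ball v ε, φ u = φ v := fun u hu =>
      (convex_ball v ε).is_const_of_fderivWithin_eq_zero (𝕜 := ℝ)
        (fun x hx => (hφ x hx).differentiableWithinAt)
        (fun x hx => by rw [fderivWithin_of_isOpen Metric.isOpen_ball hx, hd x hx])
        hu (Metric.mem_ball_self hε)
    have hm : ∀ᶠ u in 𝓝 v, u ∈ Metric.ball v ε := Metric.ball_mem_nhds v hε
    have key : ∀ u ∈ Metric.ball v ε, phase (F u) (G u) = cexp (φ v) := fun u hu =>
      P.phase_eq (by rw [← hconst u hu]; exact (hball u hu).1.self_of_nhds.symm)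
    filter_upwards [continuous_subtype_val.continuousAt.eventually hm] with u hu
    rw [key u hu, key v (Metric.mem_ball_self hε)]
  have := isPreconnected_iff_preconnectedSpace.1 hc
  intro v hv v' hv'
  exact hloc.apply_eq_of_preconnectedSpace ⟨v, hv⟩ ⟨v', hv'⟩

end ConnectionForms

/-! ### Linearity and functoriality of `along`. -/

namespace DForm

variable {E M : Type*} [NormedAddCommGroup E] [NormedSpace ℝ E] [TopologicalSpace M]
  [ChartedSpace E M] {EP P : Type*} [NormedAddCommGroup EP] [NormedSpace ℝ EP]
  [TopologicalSpace P] [ChartedSpace EP P]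
  {V : Type*} [NormedAddCommGroup V] [NormedSpace ℝ V] {k : ℕ}

theorem along_comp (α : DForm E M k) {f : P → M} {F : V → P} {v : V}
    (hf : MDifferentiableAt 𝓘(ℝ, EP) 𝓘(ℝ, E) f (F v))
    (hF : MDifferentiableAt 𝓘(ℝ, V) 𝓘(ℝ, EP) F v) :
    (α.pullback (EP := EP) f).along F v = α.along (fun u => f (F u)) v :=
  α.pullback_comp_apply hf hF

theorem along_add (α β : DForm E M k) (F : V → M) (v : V) :
    (α + β).along F v = α.along F v + β.along F v := rfl

theorem along_sub (α β : DForm E M k) (F : V → M) (v : V) :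
    (α - β).along F v = α.along F v - β.along F v := rfl

theorem along_neg (α : DForm E M k) (F : V → M) (v : V) :
    (-α).along F v = -α.along F v := rfl

end DForm

/-! ### Flat lifts over charts of `X₂`. -/

namespace LieGroupoid

variable {E₀ E₁ ER X₀ X₁ R : Type*}
  [NormedAddCommGroup E₀] [NormedSpace ℝ E₀] [TopologicalSpace X₀] [ChartedSpace E₀ X₀]
  [NormedAddCommGroup E₁] [NormedSpace ℝ E₁] [TopologicalSpace X₁] [ChartedSpace E₁ X₁]
  [NormedAddCommGroup ER] [NormedSpace ℝ ER] [TopologicalSpace R] [ChartedSpace ER R]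
  [MulAction Circle R]
  [IsManifold 𝓘(ℝ, E₀) ∞ X₀] [IsManifold 𝓘(ℝ, E₁) ∞ X₁] [IsManifold 𝓘(ℝ, ER) ∞ R]
  {V : Type*} [NormedAddCommGroup V] [NormedSpace ℝ V]

/-- The pulled back form `(θ, θ, -θ) - pr₁₂^* η` is closed along lifts of maps to `X₂`. -/
theorem extDeriv_flatness_eq_zero (G : LieGroupoid E₀ E₁ X₀ X₁)
    {η : DForm G.PairsModel G.Pairs 1} {om : DForm E₁ X₁ 2} (hc : G.IsThreeCocycle η om)
    {π : R → X₁} (P : IsPrincipalCircleBundle E₁ ER π) {θ : DForm ER R 1}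
    (hθ : IsConnectionForm θ) (hcurv : θ.extD = -om.pullback π)
    {B : Set V} (hB : IsOpen B) {c : V → G.Pairs} {x y z : V → R}
    (hcs : ContMDiffOn 𝓘(ℝ, V) 𝓘(ℝ, G.PairsModel) ∞ c B)
    (hx : ContMDiffOn 𝓘(ℝ, V) 𝓘(ℝ, ER) ∞ x B) (hy : ContMDiffOn 𝓘(ℝ, V) 𝓘(ℝ, ER) ∞ y B)
    (hz : ContMDiffOn 𝓘(ℝ, V) 𝓘(ℝ, ER) ∞ z B)
    (hpx : ∀ v ∈ B, π (x v) = (c v).fst) (hpy : ∀ v ∈ B, π (y v) = (c v).snd)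
    (hpz : ∀ v ∈ B, π (z v) = G.mul (c v)) {v : V} (hv : v ∈ B) :
    extDeriv (θ.along x + θ.along y - θ.along z - η.along c) v = 0 := by
  have hBv := hB.mem_nhds hv
  have dd : ∀ F : V → R, ContMDiffOn 𝓘(ℝ, V) 𝓘(ℝ, ER) ∞ F B → DifferentiableAt ℝ (θ.along F) v :=
    fun F hF => ((hθ.smooth.contDiffOn_along hB hF).contDiffAt hBv).differentiableAt (by simp)
  have de : DifferentiableAt ℝ (η.along c) v :=
    ((hc.smooth_η.contDiffOn_along hB hcs).contDiffAt hBv).differentiableAt (by simp)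
  have hcm : MDifferentiableAt 𝓘(ℝ, V) 𝓘(ℝ, G.PairsModel) c v :=
    (hcs.contMDiffAt hBv).mdifferentiableAt (by simp)
  -- Each of the three lifts contributes the curvature pulled back along its own face map `X₂ → X₁`;
  -- with their signs they add up to `-∂ω`.
  have dθ : ∀ (F : V → R) (f : G.Pairs → X₁), ContMDiffOn 𝓘(ℝ, V) 𝓘(ℝ, ER) ∞ F B →
      ContMDiff 𝓘(ℝ, G.PairsModel) 𝓘(ℝ, E₁) ∞ f → (∀ v ∈ B, π (F v) = f (c v)) →
      extDeriv (θ.along F) v = -(om.pullback (EP := G.PairsModel) f).along c v := by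
    intro F f hF hf h
    have hFv := (hF.contMDiffAt hBv).mdifferentiableAt (n := ∞) (by simp)
    rw [hθ.smooth.extDeriv_along hB hF hv, hcurv, DForm.along_neg,
      DForm.along_comp om (P.contMDiff_proj.mdifferentiable (by simp) _) hFv,
      DForm.along_comp om (hf.mdifferentiable (by simp) _) hcm]
    exact congrArg _ (om.along_congr (Filter.mem_of_superset hBv h))
  have h1 := dθ x _ hx FiberProduct.contMDiff_fst hpx
  have h2 := dθ y _ hy FiberProduct.contMDiff_snd hpy
  have h3 := dθ z _ hz G.contMDiff_mul hpz
  have h4 := hc.smooth_η.extDeriv_along hB hcs hv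
  have sub : ∀ α β : V → V [⋀^Fin 1]→L[ℝ] ℝ, DifferentiableAt ℝ α v → DifferentiableAt ℝ β v →
      extDeriv (α - β) v = extDeriv α v - extDeriv β v := by
    intro α β hα hβ
    have e : α - β = α + (-1 : ℝ) • β := by
      ext u w; simp [sub_eq_add_neg]
    rw [e, extDeriv_add hα (hβ.const_smul _), extDeriv_smul, neg_one_smul, sub_eq_add_neg]
  rw [sub _ _ (((dd x hx).add (dd y hy)).sub (dd z hz)) de,
    sub _ _ ((dd x hx).add (dd y hy)) (dd z hz), extDeriv_add (dd x hx) (dd y hy), h1, h2, h3, h4]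
  have h5 : (G.cobdry₁ om + η.extD).along c v = 0 := by
    rw [hc.cobdry_om_add_extD_η]; rfl
  rw [DForm.along_add, cobdry₁, DForm.along_add, DForm.along_sub] at h5
  rw [← neg_eq_zero, ← h5]
  abel

/-- Flat lifts of a chart of `X₂`. -/
theorem exists_flat_lift (G : LieGroupoid E₀ E₁ X₀ X₁)
    {η : DForm G.PairsModel G.Pairs 1} {om : DForm E₁ X₁ 2} (hc : G.IsThreeCocycle η om)
    {π : R → X₁} (P : IsPrincipalCircleBundle E₁ ER π) {θ : DForm ER R 1}
    (hθ : IsConnectionForm θ) (hcurv : θ.extD = -om.pullback π) (p₀ : G.Pairs) :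
    ∃ (B : Set G.PairsModel) (x y z : G.PairsModel → R), IsOpen B ∧ Convex ℝ B ∧
      chartAt G.PairsModel p₀ p₀ ∈ B ∧ B ⊆ (chartAt G.PairsModel p₀).target ∧
      ContMDiffOn 𝓘(ℝ, G.PairsModel) 𝓘(ℝ, ER) ∞ x B ∧
      ContMDiffOn 𝓘(ℝ, G.PairsModel) 𝓘(ℝ, ER) ∞ y B ∧
      ContMDiffOn 𝓘(ℝ, G.PairsModel) 𝓘(ℝ, ER) ∞ z B ∧
      (∀ v ∈ B, π (x v) = ((chartAt G.PairsModel p₀).symm v).fst) ∧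
      (∀ v ∈ B, π (y v) = ((chartAt G.PairsModel p₀).symm v).snd) ∧
      (∀ v ∈ B, π (z v) = G.mul ((chartAt G.PairsModel p₀).symm v)) ∧
      ∀ v ∈ B, ∀ w, θ.along x v (fun _ => w) + θ.along y v (fun _ => w) =
        θ.along z v (fun _ => w) + η.along (chartAt G.PairsModel p₀).symm v (fun _ => w) := by
  set κ := chartAt G.PairsModel p₀
  have hκ : ContMDiffOn 𝓘(ℝ, G.PairsModel) 𝓘(ℝ, G.PairsModel) ∞ κ.symm κ.target :=
    contMDiffOn_chart_symm
  have h0 : κ p₀ ∈ κ.target := κ.map_source (mem_chart_source _ p₀)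
  have h00 : κ.symm (κ p₀) = p₀ := κ.left_inv (mem_chart_source _ p₀)
  have loc : ∀ f : G.Pairs → X₁, ContMDiff 𝓘(ℝ, G.PairsModel) 𝓘(ℝ, E₁) ∞ f →
      ∃ (W : Set G.PairsModel) (F : G.PairsModel → R), IsOpen W ∧ κ p₀ ∈ W ∧ W ⊆ κ.target ∧
        ContMDiffOn 𝓘(ℝ, G.PairsModel) 𝓘(ℝ, ER) ∞ F W ∧ ∀ v ∈ W, π (F v) = f (κ.symm v) := by
    intro f hf
    obtain ⟨U, σ, hU, hxU, hσ, hσ'⟩ := P.exists_section (f p₀)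
    have hfc := hf.comp_contMDiffOn hκ
    refine ⟨κ.target ∩ (f ∘ κ.symm) ⁻¹' U, σ ∘ f ∘ κ.symm,
      hfc.continuousOn.isOpen_inter_preimage κ.open_target hU, ⟨h0, ?_⟩, inter_subset_left, ?_, ?_⟩
    · simpa [h00] using hxU
    · exact hσ.comp (hfc.mono inter_subset_left) fun v hv => hv.2
    · exact fun v hv => hσ' _ hv.2
  obtain ⟨W₁, x, hW₁, hm₁, ht, hx, hpx⟩ := loc _ FiberProduct.contMDiff_fst
  obtain ⟨W₂, y, hW₂, hm₂, -, hy, hpy⟩ := loc _ FiberProduct.contMDiff_snd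
  obtain ⟨W₃, z, hW₃, hm₃, -, hz, hpz⟩ := loc _ G.contMDiff_mul
  obtain ⟨ε, hε, hball⟩ := Metric.isOpen_iff.1 ((hW₁.inter hW₂).inter hW₃) (κ p₀)
    ⟨⟨hm₁, hm₂⟩, hm₃⟩
  set B := Metric.ball (κ p₀) ε
  have b1 : B ⊆ W₁ := fun v hv => (hball hv).1.1
  have b2 : B ⊆ W₂ := fun v hv => (hball hv).1.2
  have b3 : B ⊆ W₃ := fun v hv => (hball hv).2
  have hB : IsOpen B := Metric.isOpen_ball
  have hcB := hκ.mono (b1.trans ht)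
  have hβ : ContDiffOn ℝ ∞ (θ.along x + θ.along y - θ.along z - η.along κ.symm) B :=
    (((hθ.smooth.contDiffOn_along hB (hx.mono b1)).add
      (hθ.smooth.contDiffOn_along hB (hy.mono b2))).sub
      (hθ.smooth.contDiffOn_along hB (hz.mono b3))).sub (hc.smooth_η.contDiffOn_along hB hcB)
  -- Starting from arbitrary local sections, `φ` is a primitive of the failure of flatness; rotating
  -- the third lift by `φ` removes it.
  obtain ⟨φ, hφ⟩ := exists_primitive_of_closed hB (convex_ball _ _) (by simp) hβ fun v hv =>
    extDeriv_flatness_eq_zero G hc P hθ hcurv hB hcB (hx.mono b1) (hy.mono b2) (hz.mono b3)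
      (fun v hv => hpx v (b1 hv)) (fun v hv => hpy v (b2 hv)) (fun v hv => hpz v (b3 hv)) hv
  have hφs := contDiffOn_primitive hB hβ hφ
  refine ⟨B, x, y, fun v => cexp (φ v) • z v, hB, convex_ball _ _, Metric.mem_ball_self hε,
    b1.trans ht, hx.mono b1, hy.mono b2, ?_, fun v hv => hpx v (b1 hv), fun v hv => hpy v (b2 hv),
    ?_, ?_⟩
  · exact P.contMDiff_cexp_smul.comp_contMDiffOn (hφs.contMDiffOn.prodMk (hz.mono b3))
  · intro v hv
    rw [P.proj_smul, hpz v (b3 hv)]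
  · intro v hv w
    rw [hθ.along_cexp_smul P ((hz.contMDiffAt (hW₃.mem_nhds (b3 hv))).mdifferentiableAt (by simp))
      (hφ v hv).differentiableAt, (hφ v hv).fderiv, oneFormCLM_apply]
    change _ = _ + (θ.along x v (fun _ => w) + θ.along y v (fun _ => w) - θ.along z v (fun _ => w)
      - η.along κ.symm v (fun _ => w)) + _
    ring

end LieGroupoid

/-! ### Horizontal transport in `π⁻¹(Λ)`. -/

namespace LieGroupoid

variable {E₀ E₁ ER X₀ X₁ R : Type*}
  [NormedAddCommGroup E₀] [NormedSpace ℝ E₀] [TopologicalSpace X₀] [ChartedSpace E₀ X₀]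
  [NormedAddCommGroup E₁] [NormedSpace ℝ E₁] [TopologicalSpace X₁] [ChartedSpace E₁ X₁]
  [NormedAddCommGroup ER] [NormedSpace ℝ ER] [TopologicalSpace R] [ChartedSpace ER R]
  [MulAction Circle R]

section Transport

variable (G : LieGroupoid E₀ E₁ X₀ X₁) {π : R → X₁} (P : IsPrincipalCircleBundle E₁ ER π)
  (η : DForm G.PairsModel G.Pairs 1) (θ : DForm ER R 1)

/-- A path in `π⁻¹(Λ)` with smooth components. -/
structure IsSmoothPath (ER : Type*) [NormedAddCommGroup ER] [NormedSpace ℝ ER]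
    [ChartedSpace ER R] (G : LieGroupoid E₀ E₁ X₀ X₁) (π : R → X₁) (c : ℝ → G.OverGraph π) :
    Prop where
  fst : ContMDiff 𝓘(ℝ, ℝ) 𝓘(ℝ, ER) ∞ (fun τ => (c τ).1.1)
  snd : ContMDiff 𝓘(ℝ, ℝ) 𝓘(ℝ, ER) ∞ (fun τ => (c τ).1.2.1)
  thd : ContMDiff 𝓘(ℝ, ℝ) 𝓘(ℝ, ER) ∞ (fun τ => (c τ).1.2.2)

/-- `a` and `b` are the ends of a horizontal path in `π⁻¹(Λ)` which is constant near its ends. -/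
def Transports (a b : G.OverGraph π) : Prop :=
  ∃ (c : ℝ → G.OverGraph π) (t₀ t₁ : ℝ), t₀ < t₁ ∧ IsSmoothPath ER G π c ∧
    (∀ τ, (G.pullTheta π η θ c : DForm ℝ ℝ 1) τ = 0) ∧ (∀ τ ≤ t₀, c τ = a) ∧ ∀ τ, t₁ ≤ τ → c τ = b

variable {G η θ}

theorem overGraph_ext {a b : G.OverGraph π} (h1 : a.1.1 = b.1.1) (h2 : a.1.2.1 = b.1.2.1)
    (h3 : a.1.2.2 = b.1.2.2) : a = b :=
  Subtype.ext (Prod.ext h1 (Prod.ext h2 h3))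

theorem overGraph_mul (a : G.OverGraph π) : π a.1.2.2 = G.mul (G.overGraphToPairs π a) := a.2.snd

/-- The action of the three-torus on `π⁻¹(Λ)`. -/
noncomputable def rot (s t u : Circle) (a : G.OverGraph π) : G.OverGraph π :=
  ⟨(s • a.1.1, t • a.1.2.1, u • a.1.2.2), by
    simp only [P.proj_smul]; exact a.2⟩

theorem overGraphToPairs_rot (s t u : Circle) (a : G.OverGraph π) :
    G.overGraphToPairs π (rot P s t u a) = G.overGraphToPairs π a :=
  FiberProduct.ext (P.proj_smul _ _) (P.proj_smul _ _)

theorem rot_rot (s t u s' t' u' : Circle) (a : G.OverGraph π) :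
    rot P s t u (rot P s' t' u' a) = rot P (s * s') (t * t') (u * u') a :=
  overGraph_ext (smul_smul _ _ _) (smul_smul _ _ _) (smul_smul _ _ _)

theorem rot_one (a : G.OverGraph π) : rot P 1 1 1 a = a :=
  overGraph_ext (one_smul _ _) (one_smul _ _) (one_smul _ _)

-- The third component lies over the product of the projections of the first two, so it too is
-- determined by the pair up to a rotation; hence the three-torus is transitive on the fibres over
-- `X₂`.
include P in
theorem exists_rot_eq {a b : G.OverGraph π} (h : G.overGraphToPairs π a = G.overGraphToPairs π b) :
    ∃ s t u, b = rot P s t u a := by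
  obtain ⟨s, hs⟩ := P.exists_smul_eq (a := a.1.1) (b := b.1.1) (congrArg FiberProduct.fst h)
  obtain ⟨t, ht⟩ := P.exists_smul_eq (a := a.1.2.1) (b := b.1.2.1) (congrArg FiberProduct.snd h)
  obtain ⟨u, hu⟩ := P.exists_smul_eq (a := a.1.2.2) (b := b.1.2.2) 
    ((overGraph_mul a).trans ((congrArg G.mul h).trans (overGraph_mul b).symm))
  exact ⟨s, t, u, overGraph_ext hs.symm ht.symm hu.symm⟩

include P in
theorem exists_over (p : G.Pairs) : ∃ a : G.OverGraph π, G.overGraphToPairs π a = p := by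
  obtain ⟨x, hx⟩ := P.surjective p.fst
  obtain ⟨y, hy⟩ := P.surjective p.snd
  obtain ⟨z, hz⟩ := P.surjective (G.mul p)
  refine ⟨⟨(x, y, z), ?_⟩, FiberProduct.ext hx hy⟩
  simp only [hx, hy, hz]
  exact ⟨p.w, rfl⟩

section

variable {EB B : Type*} [NormedAddCommGroup EB] [NormedSpace ℝ EB]
  [TopologicalSpace B] [ChartedSpace EB B]

theorem pullTheta_eq (h : B → G.OverGraph π) (b : B) :
    (G.pullTheta π η θ h : DForm EB B 1) b = θ.pullback (EP := EB) (fun b => (h b).1.1) b +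
      θ.pullback (EP := EB) (fun b => (h b).1.2.1) b -
      θ.pullback (EP := EB) (fun b => (h b).1.2.2) b -
      η.pullback (EP := EB) (fun b => G.overGraphToPairs π (h b)) b := rfl

theorem pullTheta_congr {h h' : B → G.OverGraph π} {b : B}
    (e : h =ᶠ[𝓝 b] h') :
    (G.pullTheta π η θ h : DForm EB B 1) b = (G.pullTheta π η θ h' : DForm EB B 1) b := by
  have e1 : (fun b => (h b).1.1) =ᶠ[𝓝 b] fun b => (h' b).1.1 := e.fun_comp (fun a => a.1.1)
  have e2 : (fun b => (h b).1.2.1) =ᶠ[𝓝 b] fun b => (h' b).1.2.1 := e.fun_comp (fun a => a.1.2.1)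
  have e3 : (fun b => (h b).1.2.2) =ᶠ[𝓝 b] fun b => (h' b).1.2.2 := e.fun_comp (fun a => a.1.2.2)
  have e4 : (fun b => G.overGraphToPairs π (h b)) =ᶠ[𝓝 b] fun b => G.overGraphToPairs π (h' b) :=
    e.fun_comp (fun a => G.overGraphToPairs π a)
  rw [pullTheta_eq, pullTheta_eq, DForm.pullback_congr θ e1, DForm.pullback_congr θ e2,
    DForm.pullback_congr θ e3, DForm.pullback_congr η e4]

theorem _root_.DForm.pullback_const {E M : Type*} [NormedAddCommGroup E] [NormedSpace ℝ E]
    [TopologicalSpace M] [ChartedSpace E M] (α : DForm E M 1) (m : M) (b : B) :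
    α.pullback (EP := EB) (fun _ => m) b = 0 := by
  ext w
  rw [DForm.pullback_apply, mfderiv_const]
  exact (α m).map_coord_zero (0 : Fin 1) rfl

theorem pullTheta_const (a : G.OverGraph π) (b : B) :
    (G.pullTheta π η θ (fun _ => a) : DForm EB B 1) b = 0 := by
  rw [pullTheta_eq, DForm.pullback_const, DForm.pullback_const, DForm.pullback_const,
    DForm.pullback_const]
  simp

end

theorem transports_refl (a : G.OverGraph π) : Transports (ER := ER) G η θ a a :=
  ⟨fun _ => a, 0, 1, zero_lt_one, ⟨contMDiff_const, contMDiff_const, contMDiff_const⟩,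
    pullTheta_const a, fun _ _ => rfl, fun _ _ => rfl⟩

/-- Constant rotations preserve `θ`, and the `η` term sees only the base. The relation `u = st` is
not required, so transport commutes with the whole of `T³`. -/
theorem pullTheta_rot (hθ : IsConnectionForm θ) {c : ℝ → G.OverGraph π}
    (hc : IsSmoothPath ER G π c) (s t u : Circle) (τ : ℝ) :
    (G.pullTheta π η θ (fun τ => rot P s t u (c τ)) : DForm ℝ ℝ 1) τ =
      (G.pullTheta π η θ c : DForm ℝ ℝ 1) τ := by
  rw [pullTheta_eq, pullTheta_eq]
  have h1 := hθ.pullback_const_smul P s (hc.fst.mdifferentiable (by simp) τ)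
  have h2 := hθ.pullback_const_smul P t (hc.snd.mdifferentiable (by simp) τ)
  have h3 := hθ.pullback_const_smul P u (hc.thd.mdifferentiable (by simp) τ)
  have h4 : (fun b => G.overGraphToPairs π (rot P s t u (c b))) =
      fun b => G.overGraphToPairs π (c b) := funext fun b => overGraphToPairs_rot P s t u (c b)
  rw [h4]
  exact congrArg₂ _ (congrArg₂ _ (congrArg₂ _ h1 h2) h3) rfl

theorem IsSmoothPath.rot {c : ℝ → G.OverGraph π} (hc : IsSmoothPath ER G π c) (s t u : Circle) :
    IsSmoothPath ER G π (fun τ => LieGroupoid.rot P s t u (c τ)) :=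
  ⟨(P.contMDiff_const_smul s).comp hc.fst, (P.contMDiff_const_smul t).comp hc.snd,
    (P.contMDiff_const_smul u).comp hc.thd⟩

theorem Transports.rot (hθ : IsConnectionForm θ) {a b : G.OverGraph π}
    (h : Transports (ER := ER) G η θ a b) (s t u : Circle) :
    Transports (ER := ER) G η θ (LieGroupoid.rot P s t u a) (LieGroupoid.rot P s t u b) := by
  obtain ⟨c, t₀, t₁, ht, hc, h0, ha, hb⟩ := h
  refine ⟨_, t₀, t₁, ht, hc.rot P s t u, fun τ => ?_, fun τ h => ?_, fun τ h => ?_⟩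
  · rw [pullTheta_rot P hθ hc, h0]
  · rw [ha τ h]
  · rw [hb τ h]

theorem IsSmoothPath.comp {c : ℝ → G.OverGraph π} (hc : IsSmoothPath ER G π c) {g : ℝ → ℝ}
    (hg : ContDiff ℝ ∞ g) : IsSmoothPath ER G π (fun τ => c (g τ)) :=
  ⟨hc.fst.comp hg.contMDiff, hc.snd.comp hg.contMDiff, hc.thd.comp hg.contMDiff⟩

variable [IsManifold 𝓘(ℝ, E₀) ∞ X₀] [IsManifold 𝓘(ℝ, E₁) ∞ X₁]

include P in
theorem IsSmoothPath.contMDiff_overGraphToPairs {c : ℝ → G.OverGraph π}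
    (hc : IsSmoothPath ER G π c) :
    ContMDiff 𝓘(ℝ, ℝ) 𝓘(ℝ, G.PairsModel) ∞ (fun τ => G.overGraphToPairs π (c τ)) :=
  FiberProduct.contMDiff_of_comp (P.contMDiff_proj.comp hc.fst) (P.contMDiff_proj.comp hc.snd)

include P in
theorem pullTheta_comp {c : ℝ → G.OverGraph π} (hc : IsSmoothPath ER G π c) {g : ℝ → ℝ}
    (hg : ContDiff ℝ ∞ g) (h0 : ∀ τ, (G.pullTheta π η θ c : DForm ℝ ℝ 1) τ = 0) (τ : ℝ) :
    (G.pullTheta π η θ (fun τ => c (g τ)) : DForm ℝ ℝ 1) τ = 0 := by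
  have hg' : MDifferentiableAt 𝓘(ℝ, ℝ) 𝓘(ℝ, ℝ) g τ := hg.contMDiff.mdifferentiable (by simp) τ
  have h1 := DForm.pullback_comp_apply θ (hc.fst.mdifferentiable (by simp) (g τ)) hg'
  have h2 := DForm.pullback_comp_apply θ (hc.snd.mdifferentiable (by simp) (g τ)) hg'
  have h3 := DForm.pullback_comp_apply θ (hc.thd.mdifferentiable (by simp) (g τ)) hg'
  have h4 := DForm.pullback_comp_apply η
    ((hc.contMDiff_overGraphToPairs P).mdifferentiable (by simp) (g τ)) hg'
  have h5 : (DForm.pullback (EP := ℝ) g (G.pullTheta π η θ c : DForm ℝ ℝ 1)) τ = 0 := by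
    refine ContinuousAlternatingMap.ext fun w => ?_
    rw [DForm.pullback_apply, h0]
    rfl
  rw [pullTheta_eq]
  refine Eq.trans ?_ h5
  exact congrArg₂ _ (congrArg₂ _ (congrArg₂ _ h1.symm h2.symm) h3.symm) h4.symm

include P in
theorem Transports.symm {a b : G.OverGraph π} (h : Transports (ER := ER) G η θ a b) :
    Transports (ER := ER) G η θ b a := by
  obtain ⟨c, t₀, t₁, ht, hc, h0, ha, hb⟩ := h
  exact ⟨fun τ => c (-τ), -t₁, -t₀, by linarith, hc.comp contDiff_neg,
    pullTheta_comp P hc contDiff_neg h0, fun τ h => hb _ (by linarith),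
    fun τ h => ha _ (by linarith)⟩

include P in
theorem Transports.trans {a b d : G.OverGraph π} (h : Transports (ER := ER) G η θ a b)
    (h' : Transports (ER := ER) G η θ b d) : Transports (ER := ER) G η θ a d := by
  obtain ⟨c, t₀, t₁, ht, hc, h0, ha, hb⟩ := h
  obtain ⟨c', u₀, u₁, hu, hc', h0', ha', hb'⟩ := h'
  set g : ℝ → ℝ := fun τ => τ - (t₁ + 1 - u₀)
  have hg : ContDiff ℝ ∞ g := contDiff_id.sub contDiff_const
  -- The shift `g` creates a plateau `[t₁, t₁ + 1]` on which both paths equal `b`. Switching in its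
  -- middle makes `k` coincide with one of them near every time, so smoothness and horizontality are
  -- local checks.
  set k : ℝ → G.OverGraph π := fun τ => if τ < t₁ + 1 / 2 then c τ else c' (g τ)
  have k1 : ∀ τ, τ < t₁ + 1 → k τ = c τ := by
    intro τ h
    by_cases h' : τ < t₁ + 1 / 2
    · exact if_pos h'
    · simp only [k, if_neg h']
      rw [hb τ (by linarith), ha' _ (by simp only [g]; linarith)]
  have k2 : ∀ τ, t₁ < τ → k τ = c' (g τ) := by
    intro τ h
    by_cases h' : τ < t₁ + 1 / 2
    · simp only [k, if_pos h']
      rw [hb τ h.le, ha' _ (by simp only [g]; linarith)]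
    · exact if_neg h'
  have loc : ∀ τ, k =ᶠ[𝓝 τ] c ∨ k =ᶠ[𝓝 τ] fun τ => c' (g τ) := by
    intro τ
    rcases lt_or_ge τ (t₁ + 1) with h | h
    · exact Or.inl (Filter.mem_of_superset (Iio_mem_nhds h) k1)
    · exact Or.inr (Filter.mem_of_superset (Ioi_mem_nhds (by linarith)) k2)
  have hcg := hc'.comp hg
  -- Since `g (t₁ + 1) = u₀`, the final time is `u₁ + t₁ + 1 + |u₀|`; the summand `|u₀|` ensures
  -- both that it exceeds `t₀` and that `g τ ≥ u₁` beyond it, whatever the sign of `u₀`.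
  refine ⟨k, t₀, g (t₁ + 1) + u₁ - u₀ + t₁ + 1 + |u₀|, ?_, ⟨fun τ => ?_, fun τ => ?_, fun τ => ?_⟩,
    fun τ => ?_, fun τ h => ?_, fun τ h => ?_⟩
  · simp only [g]; linarith [neg_abs_le u₀]
  · rcases loc τ with h | h
    · exact (hc.fst τ).congr_of_eventuallyEq (h.fun_comp fun a => a.1.1)
    · exact (hcg.fst τ).congr_of_eventuallyEq (h.fun_comp fun a => a.1.1)
  · rcases loc τ with h | h
    · exact (hc.snd τ).congr_of_eventuallyEq (h.fun_comp fun a => a.1.2.1)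
    · exact (hcg.snd τ).congr_of_eventuallyEq (h.fun_comp fun a => a.1.2.1)
  · rcases loc τ with h | h
    · exact (hc.thd τ).congr_of_eventuallyEq (h.fun_comp fun a => a.1.2.2)
    · exact (hcg.thd τ).congr_of_eventuallyEq (h.fun_comp fun a => a.1.2.2)
  · rcases loc τ with h | h
    · rw [pullTheta_congr h, h0]
    · rw [pullTheta_congr h, pullTheta_comp P hc' hg h0']
  · rw [k1 τ (by linarith), ha τ h]
  · simp only [g] at h
    have := neg_abs_le u₀
    rw [k2 τ (by linarith), hb' _ (by simp only [g]; linarith)]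

/-- A horizontal path over a loop is closed. -/
theorem HolonomyFree.exists_rot_eq {P : IsPrincipalCircleBundle E₁ ER π}
    (hhol : G.HolonomyFree P η θ) {a b : G.OverGraph π} (h : Transports (ER := ER) G η θ a b)
    (hab : G.overGraphToPairs π a = G.overGraphToPairs π b) :
    ∃ s t : Circle, b = LieGroupoid.rot P s t (s * t) a := by
  obtain ⟨c, t₀, t₁, ht, hc, h0, ha, hb⟩ := h
  -- The holonomy hypothesis concerns paths on `[0, 1]`, so `[t₀, t₁]` is rescaled.
  set g : ℝ → ℝ := fun τ => t₀ + τ * (t₁ - t₀)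
  have hg : ContDiff ℝ ∞ g := contDiff_const.add (contDiff_id.mul contDiff_const)
  have g0 : c (g 0) = a := ha _ (by simp [g])
  have g1 : c (g 1) = b := hb _ (by simp [g])
  have hcg := hc.comp hg
  have h1 := hhol (fun τ => G.toFlatBundle π (c (g τ)))
    ⟨fun τ => c (g τ), hcg.fst, hcg.snd, hcg.thd, fun τ => pullTheta_comp P hc hg h0 τ,
      fun τ => rfl⟩
  simp only [Icc.coe_zero, Icc.coe_one, g0, g1] at h1
  obtain ⟨s, t, hst⟩ := Quotient.exact (h1 (Subtype.ext (Prod.ext (congrArg FiberProduct.fst hab)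
    (Prod.ext (congrArg FiberProduct.snd hab) (by
      exact (overGraph_mul a).trans ((congrArg G.mul hab).trans (overGraph_mul b).symm))))))
  exact ⟨s, t, Subtype.ext hst⟩

/-- Flat lifts over a convex set are transports of each other. -/
theorem transports_of_flat {V : Type*} [NormedAddCommGroup V] [NormedSpace ℝ V] {B : Set V}
    (hB : IsOpen B) (hconv : Convex ℝ B) {c : V → G.Pairs} {x y z : V → R}
    (hcs : ContMDiffOn 𝓘(ℝ, V) 𝓘(ℝ, G.PairsModel) ∞ c B)
    (hx : ContMDiffOn 𝓘(ℝ, V) 𝓘(ℝ, ER) ∞ x B) (hy : ContMDiffOn 𝓘(ℝ, V) 𝓘(ℝ, ER) ∞ y B)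
    (hz : ContMDiffOn 𝓘(ℝ, V) 𝓘(ℝ, ER) ∞ z B)
    (hpx : ∀ v ∈ B, π (x v) = (c v).fst) (hpy : ∀ v ∈ B, π (y v) = (c v).snd)
    (hpz : ∀ v ∈ B, π (z v) = G.mul (c v))
    (hflat : ∀ v ∈ B, ∀ w, θ.along x v (fun _ => w) + θ.along y v (fun _ => w) =
        θ.along z v (fun _ => w) + η.along c v (fun _ => w))
    {v v' : V} (hv : v ∈ B) (hv' : v' ∈ B) {a a' : G.OverGraph π}
    (ha : a.1 = (x v, y v, z v)) (ha' : a'.1 = (x v', y v', z v')) :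
    Transports (ER := ER) G η θ a a' := by
  -- A segment traversed with a smooth step is constant for `τ ≤ 0` and for `τ ≥ 1`, as `Transports`
  -- demands.
  set γ : ℝ → V := fun τ => v + Real.smoothTransition τ • (v' - v)
  have hγ : ContDiff ℝ ∞ γ :=
    contDiff_const.add ((Real.smoothTransition.contDiff).smul contDiff_const)
  have hγB : ∀ τ, γ τ ∈ B := fun τ => hconv.add_smul_sub_mem hv hv'
    ⟨Real.smoothTransition.nonneg τ, Real.smoothTransition.le_one τ⟩
  have hmem : ∀ u ∈ B, (π (x u), π (y u), π (z u)) ∈ G.graph := by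
    intro u hu
    rw [hpx u hu, hpy u hu, hpz u hu]
    exact ⟨(c u).w, rfl⟩
  have hBn : ∀ τ, B ∈ 𝓝 (γ τ) := fun τ => hB.mem_nhds (hγB τ)
  have hγm : ContMDiff 𝓘(ℝ, ℝ) 𝓘(ℝ, V) ∞ γ := hγ.contMDiff
  have comp : ∀ F : V → R, ContMDiffOn 𝓘(ℝ, V) 𝓘(ℝ, ER) ∞ F B →
      ContMDiff 𝓘(ℝ, ℝ) 𝓘(ℝ, ER) ∞ (fun τ => F (γ τ)) := fun F hF =>
    hF.comp_contMDiff hγm hγB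
  refine ⟨fun τ => ⟨(x (γ τ), y (γ τ), z (γ τ)), hmem _ (hγB τ)⟩, 0, 1, zero_lt_one,
    ⟨comp x hx, comp y hy, comp z hz⟩, fun τ => ?_, fun τ h => ?_, fun τ h => ?_⟩
  · have hγd : MDifferentiableAt 𝓘(ℝ, ℝ) 𝓘(ℝ, V) γ τ := hγm.mdifferentiable (by simp) τ
    have pb : ∀ F : V → R, ContMDiffOn 𝓘(ℝ, V) 𝓘(ℝ, ER) ∞ F B →
        (DForm.pullback (EP := V) F θ).pullback (EP := ℝ) γ τ =
          θ.pullback (EP := ℝ) (F ∘ γ) τ := fun F hF =>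
      DForm.pullback_comp_apply θ ((hF.contMDiffAt (hBn τ)).mdifferentiableAt (by simp)) hγd
    have pe := DForm.pullback_comp_apply η
      ((hcs.contMDiffAt (hBn τ)).mdifferentiableAt (by simp)) hγd
    have e1 : (fun b : ℝ => G.overGraphToPairs π (⟨(x (γ b), y (γ b), z (γ b)),
        hmem _ (hγB b)⟩ : G.OverGraph π)) = c ∘ γ :=
      funext fun b => FiberProduct.ext (hpx _ (hγB b)) (hpy _ (hγB b))
    rw [pullTheta_eq, e1]
    refine ContinuousAlternatingMap.ext fun w => ?_
    have key := hflat (γ τ) (hγB τ) (mfderiv 𝓘(ℝ, ℝ) 𝓘(ℝ, V) γ τ (w 0))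
    have hw : w = fun _ => w 0 := funext fun i => by rw [Subsingleton.elim i 0]
    have ev : ∀ F : V → R, (DForm.pullback (EP := V) F θ).pullback (EP := ℝ) γ τ w =
        θ.along F (γ τ) (fun _ => mfderiv 𝓘(ℝ, ℝ) 𝓘(ℝ, V) γ τ (w 0)) := by
      intro F
      rw [hw]; rfl
    have ev' : (DForm.pullback (EP := V) c η).pullback (EP := ℝ) γ τ w =
        η.along c (γ τ) (fun _ => mfderiv 𝓘(ℝ, ℝ) 𝓘(ℝ, V) γ τ (w 0)) := by
      rw [hw]; rfl
    have t1 := (congrArg (fun f => f w) (pb x hx)).symm.trans (ev x)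
    have t2 := (congrArg (fun f => f w) (pb y hy)).symm.trans (ev y)
    have t3 := (congrArg (fun f => f w) (pb z hz)).symm.trans (ev z)
    have t4 := (congrArg (fun f => f w) pe).symm.trans ev'
    change θ.pullback (EP := ℝ) (x ∘ γ) τ w + θ.pullback (EP := ℝ) (y ∘ γ) τ w -
      θ.pullback (EP := ℝ) (z ∘ γ) τ w - η.pullback (EP := ℝ) (c ∘ γ) τ w = 0
    linarith
  · refine Subtype.ext ?_
    simp [γ, Real.smoothTransition.zero_of_nonpos h, ha]
  · refine Subtype.ext ?_
    simp [γ, Real.smoothTransition.one_of_one_le h, ha']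

end Transport
end LieGroupoid

/-! ### The global flat section and the multiplication it defines. -/

namespace LieGroupoid

variable {E₀ E₁ ER X₀ X₁ R : Type*}
  [NormedAddCommGroup E₀] [NormedSpace ℝ E₀] [TopologicalSpace X₀] [ChartedSpace E₀ X₀]
  [NormedAddCommGroup E₁] [NormedSpace ℝ E₁] [TopologicalSpace X₁] [ChartedSpace E₁ X₁]
  [NormedAddCommGroup ER] [NormedSpace ℝ ER] [TopologicalSpace R] [ChartedSpace ER R]
  [MulAction Circle R] [IsManifold 𝓘(ℝ, E₀) ∞ X₀] [IsManifold 𝓘(ℝ, E₁) ∞ X₁]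

section FlatSection

variable {G : LieGroupoid E₀ E₁ X₀ X₁} {π : R → X₁} (P : IsPrincipalCircleBundle E₁ ER π)
  {η : DForm G.PairsModel G.Pairs 1} {θ : DForm ER R 1}

/-- Without holonomy, the flat bundle `π⁻¹(Λ)/T²` has a global flat section. -/
theorem exists_flat_section (hθ : IsConnectionForm θ) (hhol : G.HolonomyFree P η θ) :
    ∃ S : G.OverGraph π → Prop, (∀ a s t, S a → S (rot P s t (s * t) a)) ∧
      (∀ p, ∃ a, G.overGraphToPairs π a = p ∧ S a) ∧
      (∀ a b, S a → S b → G.overGraphToPairs π a = G.overGraphToPairs π b →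
        ∃ s t, b = rot P s t (s * t) a) ∧
      ∀ a b, Transports (ER := ER) G η θ a b → S a → S b := by
  -- Transport modulo `T³`. A class is a union of whole fibres over `X₂`, and choosing one
  -- representative in each class fixes the section on that class.
  let W : Setoid (G.OverGraph π) :=
    { r := fun a b => ∃ s t u, Transports (ER := ER) G η θ a (rot P s t u b)
      iseqv := by
        refine ⟨fun a => ⟨1, 1, 1, ?_⟩, ?_, ?_⟩
        · rw [rot_one]; exact transports_refl a
        · rintro a b ⟨s, t, u, h⟩
          refine ⟨s⁻¹, t⁻¹, u⁻¹, ?_⟩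
          have := (h.symm P).rot P hθ s⁻¹ t⁻¹ u⁻¹
          rwa [rot_rot, inv_mul_cancel, inv_mul_cancel, inv_mul_cancel, rot_one] at this
        · rintro a b c ⟨s, t, u, h⟩ ⟨s', t', u', h'⟩
          refine ⟨s * s', t * t', u * u', ?_⟩
          have := h.trans P (h'.rot P hθ s t u)
          rwa [rot_rot] at this }
  have mk_rot : ∀ s t u (a : G.OverGraph π),
      (Quotient.mk W (rot P s t u a)) = Quotient.mk W a := fun s t u a =>
    (Quotient.sound (show W.r a (rot P s t u a) from ⟨s⁻¹, t⁻¹, u⁻¹, by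
      rw [rot_rot, inv_mul_cancel, inv_mul_cancel, inv_mul_cancel, rot_one]
      exact transports_refl a⟩)).symm
  have mk_tr : ∀ a b : G.OverGraph π, Transports (ER := ER) G η θ a b →
      Quotient.mk W a = Quotient.mk W b := fun a b h =>
    Quotient.sound (show W.r a b from ⟨1, 1, 1, by rwa [rot_one]⟩)
  have hst : ∀ s t : Circle, (s * t)⁻¹ = s⁻¹ * t⁻¹ := fun s t =>
    _root_.mul_inv s t
  -- The section consists of the points that, up to `T²` only, are reached by transport from the
  -- chosen representative of their class.
  refine ⟨fun a => ∃ s t, Transports (ER := ER) G η θ (Quotient.mk W a).out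
    (rot P s t (s * t) a), ?_, ?_, ?_, ?_⟩
  · rintro a s t ⟨s', t', h⟩
    refine ⟨s' * s⁻¹, t' * t⁻¹, ?_⟩
    rw [mk_rot, rot_rot]
    rwa [inv_mul_cancel_right, inv_mul_cancel_right, mul_mul_mul_comm s' s⁻¹ t' t⁻¹, ← hst,
      inv_mul_cancel_right]
  · intro p
    obtain ⟨a, ha⟩ := exists_over P p
    obtain ⟨s, t, u, h⟩ : W.r (Quotient.mk W a).out a := Quotient.exact (Quotient.out_eq _)
    refine ⟨rot P s t u a, (overGraphToPairs_rot P s t u a).trans ha, 1, 1, ?_⟩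
    rw [mul_one, rot_one, mk_rot]
    exact h
  · rintro a b ⟨s, t, h⟩ ⟨s', t', h'⟩ hab
    have e : Quotient.mk W a = Quotient.mk W b := by
      obtain ⟨s, t, u, rfl⟩ := exists_rot_eq P hab
      exact (mk_rot s t u a).symm
    rw [e] at h
    have h2 := (h.symm P).trans P h'
    -- Going back from `a` to the representative and on to `b` is a transport between `T²`-rotates
    -- of `a` and `b` over a loop. Here triviality of the holonomy enters.
    obtain ⟨σ, τ, hr⟩ := hhol.exists_rot_eq h2 (by
      rw [overGraphToPairs_rot, overGraphToPairs_rot, hab])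
    refine ⟨s'⁻¹ * (σ * s), t'⁻¹ * (τ * t), ?_⟩
    have h3 := congrArg (rot P s'⁻¹ t'⁻¹ (s' * t')⁻¹) hr
    rw [rot_rot, rot_rot, rot_rot, inv_mul_cancel, inv_mul_cancel, inv_mul_cancel, rot_one] at h3
    rw [h3]
    rw [_root_.mul_assoc, _root_.mul_assoc, _root_.mul_assoc, hst, mul_mul_mul_comm σ τ s t,
      mul_mul_mul_comm s'⁻¹ t'⁻¹]
  · rintro a b h ⟨s, t, h'⟩
    refine ⟨s, t, ?_⟩
    rw [← mk_tr a b h]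
    exact h'.trans P (h.rot P hθ s t (s * t))

/-- A fibrewise bilinear lift `μ` of the multiplication of `G` to a circle bundle, which is
locally given by flat lifts. -/
structure IsFlatMul (ER : Type*) [NormedAddCommGroup ER] [NormedSpace ℝ ER] [ChartedSpace ER R]
    (G : LieGroupoid E₀ E₁ X₀ X₁) (π : R → X₁) (η : DForm G.PairsModel G.Pairs 1)
    (θ : DForm ER R 1) (μ : R → R → R) : Prop where
  proj : ∀ a b (h : G.tgt (π a) = G.src (π b)), π (μ a b) = G.mul ⟨π a, π b, h⟩
  smul_smul : ∀ (s t : Circle) (a b : R), G.tgt (π a) = G.src (π b) →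
    μ (s • a) (t • b) = (s * t) • μ a b
  flat : ∀ p₀ : G.Pairs, ∃ (B : Set G.PairsModel) (x y : G.PairsModel → R), IsOpen B ∧
      chartAt G.PairsModel p₀ p₀ ∈ B ∧ B ⊆ (chartAt G.PairsModel p₀).target ∧
      ContMDiffOn 𝓘(ℝ, G.PairsModel) 𝓘(ℝ, ER) ∞ x B ∧
      ContMDiffOn 𝓘(ℝ, G.PairsModel) 𝓘(ℝ, ER) ∞ y B ∧
      ContMDiffOn 𝓘(ℝ, G.PairsModel) 𝓘(ℝ, ER) ∞ (fun v => μ (x v) (y v)) B ∧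
      (∀ v ∈ B, π (x v) = ((chartAt G.PairsModel p₀).symm v).fst) ∧
      (∀ v ∈ B, π (y v) = ((chartAt G.PairsModel p₀).symm v).snd) ∧
      ∀ v ∈ B, ∀ w, θ.along x v (fun _ => w) + θ.along y v (fun _ => w) =
        θ.along (fun v => μ (x v) (y v)) v (fun _ => w) +
          η.along (chartAt G.PairsModel p₀).symm v (fun _ => w)

-- The flat section meets each fibre in one `T²`-orbit, and `T²` acts freely through the first two
-- coordinates, so it is the graph of a function of these. Its `T²`-invariance gives bilinearity.
-- Its invariance under transport forces it to contain the flat lift through any of its points,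
-- which gives smoothness and the identity for `θ`.
include P in
theorem exists_isFlatMul [IsManifold 𝓘(ℝ, ER) ∞ R] {om : DForm E₁ X₁ 2} (hc : G.IsThreeCocycle η om)
    (hθ : IsConnectionForm θ) (hcurv : θ.extD = -om.pullback π) (hhol : G.HolonomyFree P η θ) :
    ∃ μ : R → R → R, IsFlatMul ER G π η θ μ := by
  classical
  obtain ⟨S, hrot, hex, huniq, htr⟩ := exists_flat_section P hθ hhol
  have ex : ∀ a b, G.tgt (π a) = G.src (π b) → ∃ z, ∃ h, S ⟨(a, b, z), h⟩ := by
    intro a b h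
    obtain ⟨c, hc, hS⟩ := hex ⟨π a, π b, h⟩
    obtain ⟨s, hs⟩ := P.exists_smul_eq (congrArg FiberProduct.fst hc)
    obtain ⟨t, ht⟩ := P.exists_smul_eq (congrArg FiberProduct.snd hc)
    refine ⟨(s * t) • c.1.2.2, ?_⟩
    have e := hrot c s t hS
    have e2 : (rot P s t (s * t) c).1 = (a, b, (s * t) • c.1.2.2) :=
      Prod.ext hs (Prod.ext ht rfl)
    exact ⟨e2 ▸ (rot P s t (s * t) c).2, by convert e using 1; exact Subtype.ext e2.symm⟩
  -- The product is made total, with an irrelevant value off composable pairs, so that composability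
  -- proofs do not enter its type.
  let μ : R → R → R := fun a b =>
    if h : ∃ z, ∃ h, S ⟨(a, b, z), h⟩ then h.choose else a
  have μS : ∀ a b, G.tgt (π a) = G.src (π b) → ∃ h, S ⟨(a, b, μ a b), h⟩ := by
    intro a b h
    have h' := ex a b h
    simp only [μ, dif_pos h']
    exact h'.choose_spec
  -- The element of `T²` relating the two points fixes `a` and `b`, hence is trivial, hence fixes
  -- `z`.
  have un : ∀ a b z z' h h', S ⟨(a, b, z), h⟩ → S ⟨(a, b, z'), h'⟩ → z = z' := by
    intro a b z z' h h' hS hS'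
    obtain ⟨s, t, e⟩ := huniq _ _ hS hS' rfl
    have e := congrArg Subtype.val e
    have e1 : b = t • b := congrArg (fun q => q.2.1) e
    have e0 : a = s • a := congrArg (fun q => q.1) e
    have e2 : z' = (s * t) • z := congrArg (fun q => q.2.2) e
    have s1 : s = 1 := P.smul_left_cancel (a := a) (by rw [one_smul, ← e0])
    have t1 : t = 1 := P.smul_left_cancel (a := b) (by rw [one_smul, ← e1])
    rw [e2, s1, t1, mul_one, one_smul]
  refine ⟨μ, ⟨fun a b h => (μS a b h).1.2, fun s t a b h => ?_, fun p₀ => ?_⟩⟩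
  · obtain ⟨h1, hS⟩ := μS a b h
    obtain ⟨h2, hS2⟩ := μS (s • a) (t • b) (by rw [P.proj_smul, P.proj_smul, h])
    exact un _ _ _ _ _ _ hS2 (hrot _ s t hS)
  · obtain ⟨B, x, y, z, hB, hconv, h0, hBt, hx, hy, hz, hpx, hpy, hpz, hfl⟩ :=
      exists_flat_lift G hc P hθ hcurv p₀
    have hmem : ∀ u ∈ B, G.tgt (π (x u)) = G.src (π (y u)) := by
      intro u hu
      rw [hpx u hu, hpy u hu]
      exact FiberProduct.w _
    have hπ : ∀ v ∈ B, π (z v) = π (μ (x v) (y v)) := by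
      intro v hv
      obtain ⟨h1, -⟩ := μS _ _ (hmem v hv)
      refine Eq.trans ?_ h1.2.symm
      rw [hpz v hv]
      exact congrArg G.mul (FiberProduct.ext (hpx v hv).symm (hpy v hv).symm)
    -- The constant `k` aligns the flat lift with `μ` at the centre of the chart; transport then
    -- propagates the agreement over all of `B`.
    obtain ⟨k, hk⟩ := P.exists_smul_eq (hπ _ h0)
    have hkz : ContMDiffOn 𝓘(ℝ, G.PairsModel) 𝓘(ℝ, ER) ∞ (fun v => k • z v) B :=
      (P.contMDiff_const_smul k).comp_contMDiffOn hz
    have hkfl : ∀ v ∈ B, ∀ w, θ.along x v (fun _ => w) + θ.along y v (fun _ => w) =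
        θ.along (fun v => k • z v) v (fun _ => w) +
          η.along (chartAt G.PairsModel p₀).symm v (fun _ => w) := by
      intro v hv w
      rw [hfl v hv w]
      have := hθ.pullback_const_smul P k
        ((hz.contMDiffAt (hB.mem_nhds hv)).mdifferentiableAt (by simp))
      exact congrArg (fun f : G.PairsModel [⋀^Fin 1]→L[ℝ] ℝ => f (fun _ => w) + _) this.symm
    have hkpz : ∀ v ∈ B, π (k • z v) = G.mul ((chartAt G.PairsModel p₀).symm v) := by
      intro v hv
      rw [P.proj_smul, hpz v hv]
    have e : ∀ v ∈ B, k • z v = μ (x v) (y v) := by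
      intro v hv
      obtain ⟨h1, hS⟩ := μS _ _ (hmem _ h0)
      have hg : (π (x v), π (y v), π (k • z v)) ∈ G.graph := by
        rw [hpx v hv, hpy v hv, hkpz v hv]
        exact ⟨FiberProduct.w _, rfl⟩
      have h2 := htr _ ⟨(x v, y v, k • z v), hg⟩ (transports_of_flat hB hconv
        (contMDiffOn_chart_symm.mono hBt) hx hy hkz hpx hpy hkpz hkfl h0 hv
        (by simp only [hk]) rfl) hS
      exact un _ _ _ _ _ _ h2 (μS _ _ (hmem v hv)).2
    refine ⟨B, x, y, hB, h0, hBt, hx, hy, hkz.congr fun v hv => (e v hv).symm, hpx, hpy,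
      fun v hv w => ?_⟩
    rw [hkfl v hv w]
    exact congrArg (fun f : G.PairsModel [⋀^Fin 1]→L[ℝ] ℝ => f (fun _ => w) + _)
      (θ.along_congr (Filter.mem_of_superset (hB.mem_nhds hv) e))

end FlatSection
end LieGroupoid

/-! ### Regularity, multiplicativity of `θ`, and associativity. -/

namespace LieGroupoid

variable {E₀ E₁ ER X₀ X₁ R : Type*}
  [NormedAddCommGroup E₀] [NormedSpace ℝ E₀] [TopologicalSpace X₀] [ChartedSpace E₀ X₀]
  [NormedAddCommGroup E₁] [NormedSpace ℝ E₁] [TopologicalSpace X₁] [ChartedSpace E₁ X₁]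
  [NormedAddCommGroup ER] [NormedSpace ℝ ER] [TopologicalSpace R] [ChartedSpace ER R]
  [MulAction Circle R] [IsManifold 𝓘(ℝ, E₀) ∞ X₀] [IsManifold 𝓘(ℝ, E₁) ∞ X₁]

section Faces

variable (G : LieGroupoid E₀ E₁ X₀ X₁)

theorem contMDiff_tripleFace₃ : ContMDiff 𝓘(ℝ, G.PairsModel × G.isSubmersion_src.complement)
    𝓘(ℝ, G.PairsModel) ∞ G.tripleFace₃ :=
  FiberProduct.contMDiff_fst (hf := G.contMDiff_tgt_snd) (hg := G.isSubmersion_src)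

theorem contMDiff_tripleFace₀ : ContMDiff 𝓘(ℝ, G.PairsModel × G.isSubmersion_src.complement)
    𝓘(ℝ, G.PairsModel) ∞ G.tripleFace₀ :=
  FiberProduct.contMDiff_of_comp (FiberProduct.contMDiff_snd.comp G.contMDiff_tripleFace₃)
    (FiberProduct.contMDiff_snd (hf := G.contMDiff_tgt_snd) (hg := G.isSubmersion_src))

theorem contMDiff_tripleFace₁ : ContMDiff 𝓘(ℝ, G.PairsModel × G.isSubmersion_src.complement)
    𝓘(ℝ, G.PairsModel) ∞ G.tripleFace₁ :=
  FiberProduct.contMDiff_of_comp (G.contMDiff_mul.comp G.contMDiff_tripleFace₃)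
    (FiberProduct.contMDiff_snd (hf := G.contMDiff_tgt_snd) (hg := G.isSubmersion_src))

theorem contMDiff_tripleFace₂ : ContMDiff 𝓘(ℝ, G.PairsModel × G.isSubmersion_src.complement)
    𝓘(ℝ, G.PairsModel) ∞ G.tripleFace₂ :=
  have h : ContMDiff 𝓘(ℝ, G.PairsModel × G.isSubmersion_src.complement) 𝓘(ℝ, E₁) ∞
      (fun q : G.Triples => q.fst.fst) := FiberProduct.contMDiff_fst.comp G.contMDiff_tripleFace₃
  FiberProduct.contMDiff_of_comp h
    (G.contMDiff_mul.comp G.contMDiff_tripleFace₀)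

end Faces

namespace IsFlatMul

variable {G : LieGroupoid E₀ E₁ X₀ X₁} {π : R → X₁}
  {η : DForm G.PairsModel G.Pairs 1} {θ : DForm ER R 1} {μ : R → R → R}

/-- Here `A, B, C` stand for the values of `θ` on two lifts and their product, `x, y, z` for those
on the flat lifts, `a, b, s` for the derivatives of the angles between them, and `D` for the value
of `η`. -/
theorem _root_.eq_add_of_rotated {A B C D x y z x' y' z' e a b s : ℝ} (hA : A = x + a) (hB : B = y + b)
    (hC : C = z + s) (hs : s = a + b) (hx : x' = x) (hy : y' = y) (hz : z' = z) (he : e = D)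
    (h : x' + y' = z' + e) : A + B = C + D := by
  linarith

/-- The letters are values of `θ` on factors and partial products, `l` and `m` those on the two
bracketings. The `e`'s are the values of `η` on the four faces of a triple, and the last hypothesis
is `∂η = 0`. -/
theorem _root_.eq_of_bracketings {x y z xy yz l m e0 e1 e2 e3 : ℝ} (h0 : y + z = yz + e0)
    (h1 : xy + z = l + e1) (h2 : x + yz = m + e2) (h3 : x + y = xy + e3)
    (h : e0 - e1 + e2 - e3 = 0) : l = m := by
  linarith

section Regularity

variable {EQ Q : Type*} [NormedAddCommGroup EQ] [NormedSpace ℝ EQ] [TopologicalSpace Q]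
  [ChartedSpace EQ Q] {f g : Q → R} {c : Q → G.Pairs} {q : Q}

/-- Smoothness of `μ` is given only along particular local lifts. Any other lifts differ from these
by smooth phases, and bilinearity takes the phases out of the product. -/
theorem contMDiffAt_mul (hμ : IsFlatMul ER G π η θ μ) (P : IsPrincipalCircleBundle E₁ ER π)
    (hf : ContMDiffAt 𝓘(ℝ, EQ) 𝓘(ℝ, ER) ∞ f q) (hg : ContMDiffAt 𝓘(ℝ, EQ) 𝓘(ℝ, ER) ∞ g q)
    (hc : ContMDiffAt 𝓘(ℝ, EQ) 𝓘(ℝ, G.PairsModel) ∞ c q)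
    (h1 : ∀ᶠ p in 𝓝 q, π (f p) = (c p).fst) (h2 : ∀ᶠ p in 𝓝 q, π (g p) = (c p).snd) :
    ContMDiffAt 𝓘(ℝ, EQ) 𝓘(ℝ, ER) ∞ (fun p => μ (f p) (g p)) q := by
  obtain ⟨B, x, y, hB, h0, hBt, hx, hy, hz, hpx, hpy, -⟩ := hμ.flat (c q)
  set κ := chartAt G.PairsModel (c q)
  have hv : ContMDiffAt 𝓘(ℝ, EQ) 𝓘(ℝ, G.PairsModel) ∞ (fun p => κ (c p)) q :=
    ContMDiffAt.comp q (contMDiffAt_of_mem_maximalAtlas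
      (IsManifold.chart_mem_maximalAtlas _) (mem_chart_source _ (c q))) hc
  have hBn : B ∈ 𝓝 (κ (c q)) := hB.mem_nhds h0
  have ev : ∀ᶠ p in 𝓝 q, κ (c p) ∈ B ∧ κ.symm (κ (c p)) = c p :=
    (hv.continuousAt.eventually hBn).and ((hc.continuousAt.eventually
      (κ.open_source.mem_nhds (mem_chart_source _ (c q)))).mono fun p hp => κ.left_inv hp)
  have ex : ∀ᶠ p in 𝓝 q, π (x (κ (c p))) = π (f p) := by
    filter_upwards [ev, h1] with p hp h
    rw [hpx _ hp.1, hp.2, h]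
  have ey : ∀ᶠ p in 𝓝 q, π (y (κ (c p))) = π (g p) := by
    filter_upwards [ev, h2] with p hp h
    rw [hpy _ hp.1, hp.2, h]
  have hxv : ContMDiffAt 𝓘(ℝ, EQ) 𝓘(ℝ, ER) ∞ (fun p => x (κ (c p))) q :=
    (hx.contMDiffAt hBn).comp q hv
  have hyv : ContMDiffAt 𝓘(ℝ, EQ) 𝓘(ℝ, ER) ∞ (fun p => y (κ (c p))) q :=
    (hy.contMDiffAt hBn).comp q hv
  have hzv : ContMDiffAt 𝓘(ℝ, EQ) 𝓘(ℝ, ER) ∞ (fun p => μ (x (κ (c p))) (y (κ (c p)))) q :=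
    (hz.contMDiffAt hBn).comp q hv
  have e : (fun p => μ (f p) (g p)) =ᶠ[𝓝 q] fun p =>
      (phase (x (κ (c p))) (f p) * phase (y (κ (c p))) (g p)) •
        μ (x (κ (c p))) (y (κ (c p))) := by
    filter_upwards [ev, ex, ey] with p hp hx hy
    rw [← hμ.smul_smul, P.phase_smul hx, P.phase_smul hy]
    rw [hpx _ hp.1, hpy _ hp.1]
    exact FiberProduct.w _
  refine ContMDiffAt.congr_of_eventuallyEq ?_ e
  exact (P.contMDiff_smul _).comp q
    (((P.contMDiffAt_phase hxv hf ex).mul (P.contMDiffAt_phase hyv hg ey)).prodMk hzv)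

/-- The infinitesimal form of `∂θ = π^*η`. Relative to the flat lifts, `f` and `g` acquire angles
`φ` and `ψ` and the product acquires `φ + ψ`, so both sides change by the same amount. Mere
differentiability is assumed because the factors may be path lifts. -/
theorem mdifferentiableAt_mul (hμ : IsFlatMul ER G π η θ μ) (P : IsPrincipalCircleBundle E₁ ER π)
    (hθ : IsConnectionForm θ)
    (hf : MDifferentiableAt 𝓘(ℝ, EQ) 𝓘(ℝ, ER) f q) (hg : MDifferentiableAt 𝓘(ℝ, EQ) 𝓘(ℝ, ER) g q)
    (hc : MDifferentiableAt 𝓘(ℝ, EQ) 𝓘(ℝ, G.PairsModel) c q)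
    (h1 : ∀ᶠ p in 𝓝 q, π (f p) = (c p).fst) (h2 : ∀ᶠ p in 𝓝 q, π (g p) = (c p).snd) :
    MDifferentiableAt 𝓘(ℝ, EQ) 𝓘(ℝ, ER) (fun p => μ (f p) (g p)) q ∧
    ∀ w, θ.pullback (EP := EQ) f q (fun _ => w) + θ.pullback (EP := EQ) g q (fun _ => w) =
      θ.pullback (EP := EQ) (fun p => μ (f p) (g p)) q (fun _ => w) +
        η.pullback (EP := EQ) c q (fun _ => w) := by
  obtain ⟨B, x, y, hB, h0, hBt, hx, hy, hz, hpx, hpy, hfl⟩ := hμ.flat (c q)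
  set κ := chartAt G.PairsModel (c q)
  have hv : MDifferentiableAt 𝓘(ℝ, EQ) 𝓘(ℝ, G.PairsModel) (fun p => κ (c p)) q :=
    MDifferentiableAt.comp q ((contMDiffAt_of_mem_maximalAtlas (n := ∞)
      (IsManifold.chart_mem_maximalAtlas _) (mem_chart_source _ (c q))).mdifferentiableAt
        (by simp)) hc
  have hBn : B ∈ 𝓝 (κ (c q)) := hB.mem_nhds h0
  have ev : ∀ᶠ p in 𝓝 q, κ (c p) ∈ B ∧ κ.symm (κ (c p)) = c p :=
    (hv.continuousAt.eventually hBn).and ((hc.continuousAt.eventually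
      (κ.open_source.mem_nhds (mem_chart_source _ (c q)))).mono fun p hp => κ.left_inv hp)
  have ex : ∀ᶠ p in 𝓝 q, π (x (κ (c p))) = π (f p) := by
    filter_upwards [ev, h1] with p hp h
    rw [hpx _ hp.1, hp.2, h]
  have ey : ∀ᶠ p in 𝓝 q, π (y (κ (c p))) = π (g p) := by
    filter_upwards [ev, h2] with p hp h
    rw [hpy _ hp.1, hp.2, h]
  have dx := (hx.contMDiffAt hBn).mdifferentiableAt (n := ∞) (by simp)
  have dy := (hy.contMDiffAt hBn).mdifferentiableAt (n := ∞) (by simp)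
  have dz := (hz.contMDiffAt hBn).mdifferentiableAt (n := ∞) (by simp)
  have hxv : MDifferentiableAt 𝓘(ℝ, EQ) 𝓘(ℝ, ER) (fun p => x (κ (c p))) q := dx.comp q hv
  have hyv : MDifferentiableAt 𝓘(ℝ, EQ) 𝓘(ℝ, ER) (fun p => y (κ (c p))) q := dy.comp q hv
  have hzv : MDifferentiableAt 𝓘(ℝ, EQ) 𝓘(ℝ, ER)
    (fun p => μ (x (κ (c p))) (y (κ (c p)))) q := dz.comp q hv
  obtain ⟨φ, hφ, hφd⟩ := P.exists_angle (EQ := EQ) hxv.continuousAt hf.continuousAt ex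
  obtain ⟨ψ, hψ, hψd⟩ := P.exists_angle (EQ := EQ) hyv.continuousAt hg.continuousAt ey
  have φd := hφd.self_of_nhds hxv hf
  have ψd := hψd.self_of_nhds hyv hg
  have φψ : MDifferentiableAt 𝓘(ℝ, EQ) 𝓘(ℝ, ℝ) (fun p => φ p + ψ p) q := φd.add ψd
  have e : (fun p => μ (f p) (g p)) =ᶠ[𝓝 q] fun p =>
      cexp (φ p + ψ p) • μ (x (κ (c p))) (y (κ (c p))) := by
    filter_upwards [ev, hφ, hψ] with p hp hx hy
    rw [cexp_add, ← hμ.smul_smul, hx, hy]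
    rw [hpx _ hp.1, hpy _ hp.1]
    exact FiberProduct.w _
  refine ⟨MDifferentiableAt.congr_of_eventuallyEq ?_ e, fun w => ?_⟩
  · exact ((P.contMDiff_cexp_smul.mdifferentiable (by simp) _).comp q (φψ.prodMk hzv))
  · have a1 := (congrArg (fun F => F (fun _ => w)) (DForm.pullback_congr (EP := EQ) θ hφ)).trans
      (hθ.pullback_cexp_smul P hxv φd w)
    have a2 := (congrArg (fun F => F (fun _ => w)) (DForm.pullback_congr (EP := EQ) θ hψ)).trans
      (hθ.pullback_cexp_smul P hyv ψd w)
    have a3 := (congrArg (fun F => F (fun _ => w)) (DForm.pullback_congr (EP := EQ) θ e)).trans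
      (hθ.pullback_cexp_smul P hzv φψ w)
    have a4 : realDeriv (EQ := EQ) (fun p => φ p + ψ p) q w = realDeriv φ q w + realDeriv ψ q w :=
      congrArg (fun F : EQ →L[ℝ] ℝ => F w) (mfderiv_add φd ψd)
    have b1 := congrArg (fun F => F (fun _ => w)) (DForm.pullback_comp_apply θ
      (g := fun p => κ (c p)) dx hv)
    have b2 := congrArg (fun F => F (fun _ => w)) (DForm.pullback_comp_apply θ
      (g := fun p => κ (c p)) dy hv)
    have b3 := congrArg (fun F => F (fun _ => w)) (DForm.pullback_comp_apply θ
      (g := fun p => κ (c p)) dz hv)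
    have dκ : MDifferentiableAt 𝓘(ℝ, G.PairsModel) 𝓘(ℝ, G.PairsModel) κ.symm (κ (c q)) :=
      ((contMDiffOn_chart_symm (n := ∞)).contMDiffAt
        (κ.open_target.mem_nhds (hBt h0))).mdifferentiableAt (by simp)
    have b4 := congrArg (fun F => F (fun _ => w)) ((DForm.pullback_comp_apply η
      (g := fun p => κ (c p)) dκ hv).trans
      (DForm.pullback_congr (EP := EQ) η (ev.mono fun p hp => hp.2)))
    have key := hfl _ h0 (mfderiv 𝓘(ℝ, EQ) 𝓘(ℝ, G.PairsModel) (fun p => κ (c p)) q w)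
    exact eq_add_of_rotated a1 a2 a3 a4 b1 b2 b3 b4 key

end Regularity

section Associativity

variable (hμ : IsFlatMul ER G π η θ μ)

include hμ

theorem tgt_mul {a b : R} (h : G.tgt (π a) = G.src (π b)) : G.tgt (π (μ a b)) = G.tgt (π b) := by
  rw [hμ.proj a b h, G.tgt_mul]

theorem src_mul {a b : R} (h : G.tgt (π a) = G.src (π b)) : G.src (π (μ a b)) = G.src (π a) := by
  rw [hμ.proj a b h, G.src_mul]

theorem proj_assoc {a b c : R} (h : G.tgt (π a) = G.src (π b)) (h' : G.tgt (π b) = G.src (π c)) :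
    π (μ (μ a b) c) = π (μ a (μ b c)) := by
  rw [hμ.proj _ _ ((hμ.tgt_mul h).trans h'), hμ.proj _ _ (h.trans (hμ.src_mul h').symm)]
  refine Eq.trans ?_ ((G.mul_assoc (π a) (π b) (π c) h h').trans ?_)
  · exact congrArg G.mul (FiberProduct.ext (hμ.proj a b h) rfl)
  · exact congrArg G.mul (FiberProduct.ext rfl (hμ.proj b c h').symm)

/-- Both bracketings of a triple product of lifts are locally related by a constant phase. -/
theorem exists_associator_const [IsManifold 𝓘(ℝ, ER) ∞ R] {om : DForm E₁ X₁ 2}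
    (hc : G.IsThreeCocycle η om)
    (P : IsPrincipalCircleBundle E₁ ER π) (hθ : IsConnectionForm θ) (q : G.Triples) :
    ∃ (W : Set G.Triples) (x y z : G.Triples → R) (k : Circle), W ∈ 𝓝 q ∧
      ∀ p ∈ W, π (x p) = p.fst.fst ∧ π (y p) = p.fst.snd ∧ π (z p) = p.snd ∧
        μ (x p) (μ (y p) (z p)) = k • μ (μ (x p) (y p)) (z p) := by
  set κ := chartAt (G.PairsModel × G.isSubmersion_src.complement) q
  have hκ : ContMDiffOn 𝓘(ℝ, G.PairsModel × G.isSubmersion_src.complement)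
    𝓘(ℝ, G.PairsModel × G.isSubmersion_src.complement) ∞ κ.symm κ.target :=
    contMDiffOn_chart_symm
  have h0 : κ q ∈ κ.target := κ.map_source (mem_chart_source _ q)
  have h00 : κ.symm (κ q) = q := κ.left_inv (mem_chart_source _ q)
  have loc : ∀ f : G.Triples → X₁, ContMDiff 𝓘(ℝ, G.PairsModel × G.isSubmersion_src.complement)
      𝓘(ℝ, E₁) ∞ f → ∃ (W : Set (G.PairsModel × G.isSubmersion_src.complement))
        (F : G.PairsModel × G.isSubmersion_src.complement → R), IsOpen W ∧ κ q ∈ W ∧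
        W ⊆ κ.target ∧ ContMDiffOn 𝓘(ℝ, G.PairsModel × G.isSubmersion_src.complement) 𝓘(ℝ, ER) ∞
          F W ∧ ∀ v ∈ W, π (F v) = f (κ.symm v) := by
    intro f hf
    obtain ⟨U, σ, hU, hxU, hσ, hσ'⟩ := P.exists_section (f q)
    have hfc := hf.comp_contMDiffOn hκ
    refine ⟨κ.target ∩ (f ∘ κ.symm) ⁻¹' U, σ ∘ f ∘ κ.symm,
      hfc.continuousOn.isOpen_inter_preimage κ.open_target hU, ⟨h0, ?_⟩, inter_subset_left, ?_, ?_⟩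
    · simpa [h00] using hxU
    · exact hσ.comp (hfc.mono inter_subset_left) fun v hv => hv.2
    · exact fun v hv => hσ' _ hv.2
  obtain ⟨W₁, x, hW₁, hm₁, ht, hx, hpx⟩ :=
    loc _ (FiberProduct.contMDiff_fst.comp G.contMDiff_tripleFace₃)
  obtain ⟨W₂, y, hW₂, hm₂, -, hy, hpy⟩ :=
    loc _ (FiberProduct.contMDiff_snd.comp G.contMDiff_tripleFace₃)
  obtain ⟨W₃, z, hW₃, hm₃, -, hz, hpz⟩ :=
    loc _ (FiberProduct.contMDiff_snd (hf := G.contMDiff_tgt_snd) (hg := G.isSubmersion_src))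
  obtain ⟨ε, hε, hball⟩ := Metric.isOpen_iff.1 ((hW₁.inter hW₂).inter hW₃) (κ q)
    ⟨⟨hm₁, hm₂⟩, hm₃⟩
  set B := Metric.ball (κ q) ε
  have b1 : B ⊆ W₁ := fun v hv => (hball hv).1.1
  have b2 : B ⊆ W₂ := fun v hv => (hball hv).1.2
  have b3 : B ⊆ W₃ := fun v hv => (hball hv).2
  have hB : IsOpen B := Metric.isOpen_ball
  have hBt : B ⊆ κ.target := b1.trans ht
  have hcomp : ∀ v ∈ B, G.tgt (π (x v)) = G.src (π (y v)) := by
    intro v hv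
    rw [hpx v (b1 hv), hpy v (b2 hv)]
    exact FiberProduct.w _
  have hcomp' : ∀ v ∈ B, G.tgt (π (y v)) = G.src (π (z v)) := by
    intro v hv
    rw [hpy v (b2 hv), hpz v (b3 hv)]
    exact (κ.symm v).w
  have md : ∀ {F : G.PairsModel × G.isSubmersion_src.complement → R}
      {W : Set (G.PairsModel × G.isSubmersion_src.complement)},
      ContMDiffOn 𝓘(ℝ, G.PairsModel × G.isSubmersion_src.complement) 𝓘(ℝ, ER) ∞ F W → B ⊆ W →
      ∀ v ∈ B, MDifferentiableAt 𝓘(ℝ, G.PairsModel × G.isSubmersion_src.complement) 𝓘(ℝ, ER)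
        F v := fun hF hW v hv =>
    (hF.contMDiffAt (Filter.mem_of_superset (hB.mem_nhds hv) hW)).mdifferentiableAt (by simp)
  have cd : ∀ {f : G.Triples → G.Pairs},
      ContMDiff 𝓘(ℝ, G.PairsModel × G.isSubmersion_src.complement) 𝓘(ℝ, G.PairsModel) ∞ f →
      ∀ v ∈ B, MDifferentiableAt 𝓘(ℝ, G.PairsModel × G.isSubmersion_src.complement)
        𝓘(ℝ, G.PairsModel) (fun v => f (κ.symm v)) v := fun hf v hv =>
    (hf.comp_contMDiffOn hκ).contMDiffAt (κ.open_target.mem_nhds (hBt hv)) |>.mdifferentiableAt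
      (by simp)
  have ev : ∀ v ∈ B, ∀ {p : G.PairsModel × G.isSubmersion_src.complement → Prop},
    (∀ u ∈ B, p u) → ∀ᶠ u in 𝓝 v, p u := fun v hv p h => Filter.mem_of_superset (hB.mem_nhds hv) h
  -- `m0`, …, `m3` are the multiplicativity of `θ` over the four faces `(y, z)`, `(xy, z)`, `(x,
  -- yz)`, `(x, y)`.
  have m3 := fun v hv => hμ.mdifferentiableAt_mul P hθ (md hx b1 v hv) (md hy b2 v hv)
    (cd G.contMDiff_tripleFace₃ v hv) (ev v hv fun u hu => hpx u (b1 hu))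
    (ev v hv fun u hu => hpy u (b2 hu))
  have m0 := fun v hv => hμ.mdifferentiableAt_mul P hθ (md hy b2 v hv) (md hz b3 v hv)
    (cd G.contMDiff_tripleFace₀ v hv) (ev v hv fun u hu => hpy u (b2 hu))
    (ev v hv fun u hu => hpz u (b3 hu))
  have m1 := fun v hv => hμ.mdifferentiableAt_mul P hθ (m3 v hv).1 (md hz b3 v hv)
    (cd G.contMDiff_tripleFace₁ v hv) (ev v hv fun u hu => by
      rw [hμ.proj _ _ (hcomp u hu)]
      exact congrArg G.mul (FiberProduct.ext (hpx u (b1 hu)) (hpy u (b2 hu))))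
    (ev v hv fun u hu => hpz u (b3 hu))
  have m2 := fun v hv => hμ.mdifferentiableAt_mul P hθ (md hx b1 v hv) (m0 v hv).1
    (cd G.contMDiff_tripleFace₂ v hv) (ev v hv fun u hu => hpx u (b1 hu))
    (ev v hv fun u hu => by
      rw [hμ.proj _ _ (hcomp' u hu)]
      exact congrArg G.mul (FiberProduct.ext (hpy u (b2 hu)) (hpz u (b3 hu))))
  have hπ : ∀ v ∈ B, π (μ (μ (x v) (y v)) (z v)) = π (μ (x v) (μ (y v) (z v))) := fun v hv =>
    hμ.proj_assoc (hcomp v hv) (hcomp' v hv)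
  have key := hθ.exists_smul_eq_of_along_eq P hB (convex_ball _ _).isPreconnected
    (fun v hv => (m1 v hv).1) (fun v hv => (m2 v hv).1) hπ fun v hv w => by
    have e0 := (m0 v hv).2 w
    have e1 := (m1 v hv).2 w
    have e2 := (m2 v hv).2 w
    have e3 := (m3 v hv).2 w
    have hκv : MDifferentiableAt 𝓘(ℝ, G.PairsModel × G.isSubmersion_src.complement)
        𝓘(ℝ, G.PairsModel × G.isSubmersion_src.complement) κ.symm v :=
      (hκ.contMDiffAt (κ.open_target.mem_nhds (hBt hv))).mdifferentiableAt (by simp)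
    -- The alternating sum of the four `η` terms is `∂η`, so the two bracketings pull `θ` back to
    -- the same form.
    have h5 : (G.cobdry₂ η).along κ.symm v = 0 := by
      rw [hc.cobdry_η]; rfl
    rw [cobdry₂, DForm.along_sub, DForm.along_add, DForm.along_sub,
      DForm.along_comp η (G.contMDiff_tripleFace₀.mdifferentiable (by simp) _) hκv,
      DForm.along_comp η (G.contMDiff_tripleFace₁.mdifferentiable (by simp) _) hκv,
      DForm.along_comp η (G.contMDiff_tripleFace₂.mdifferentiable (by simp) _) hκv,
      DForm.along_comp η (G.contMDiff_tripleFace₃.mdifferentiable (by simp) _) hκv] at h5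
    have h6 := congrArg (fun F : (G.PairsModel × G.isSubmersion_src.complement) [⋀^Fin 1]→L[ℝ] ℝ =>
      F (fun _ => w)) h5
    exact eq_of_bracketings e0 e1 e2 e3 h6
  refine ⟨κ.source ∩ κ ⁻¹' B, fun p => x (κ p), fun p => y (κ p), fun p => z (κ p),
    phase (μ (μ (x (κ q)) (y (κ q))) (z (κ q))) (μ (x (κ q)) (μ (y (κ q)) (z (κ q)))),
    Filter.inter_mem (κ.open_source.mem_nhds (mem_chart_source _ q))
      ((κ.continuousAt (mem_chart_source _ q)) (hB.mem_nhds (Metric.mem_ball_self hε))), ?_⟩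
  rintro p ⟨hp, hpB⟩
  have hl : κ.symm (κ p) = p := κ.left_inv hp
  refine ⟨?_, ?_, ?_, ?_⟩
  · rw [hpx _ (b1 hpB), hl]; rfl
  · rw [hpy _ (b2 hpB), hl]; rfl
  · rw [hpz _ (b3 hpB), hl]
  · rw [← key _ hpB _ (Metric.mem_ball_self hε), P.phase_smul (hπ _ hpB)]

theorem tgt_eq_src_of_unit {a : R} {u : X₀} (ha : π a = G.unit u) :
    G.tgt (π a) = G.src (π a) := by
  rw [ha, G.tgt_unit, G.src_unit]

theorem proj_mul_self {a : R} {u : X₀} (ha : π a = G.unit u) : π (μ a a) = π a := by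
  rw [hμ.proj a a (hμ.tgt_eq_src_of_unit ha)]
  have e : π a = G.unit (G.src (π a)) :=
    ha.trans (congrArg G.unit ((congrArg G.src ha).trans (G.src_unit u)).symm)
  have e2 : (⟨π a, π a, hμ.tgt_eq_src_of_unit ha⟩ : G.Pairs) =
    ⟨G.unit (G.src (π a)), π a, G.tgt_unit _⟩ := FiberProduct.ext e rfl
  exact (congrArg G.mul e2).trans (G.unit_mul (π a))

/-- An idempotent over each unit. -/
theorem exists_idempotent (P : IsPrincipalCircleBundle E₁ ER π) {a : R} {u : X₀}
    (ha : π a = G.unit u) : μ (phase (μ a a) a • a) (phase (μ a a) a • a) = phase (μ a a) a • a := by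
  -- With `s` the phase from `a · a` to `a`: `(s a)(s a) = s (s (a a)) = s a`.
  rw [hμ.smul_smul _ _ _ _ (hμ.tgt_eq_src_of_unit ha), mul_smul,
    P.phase_smul (hμ.proj_mul_self ha)]

/-- The associator is a locally constant circle-valued function on `X₃`. Its value at any triple
equals its value at a triple of units, because the three entries can be moved to units one at a time
inside source fibres. There an idempotent shows that it is `1`. -/
theorem assoc [IsManifold 𝓘(ℝ, ER) ∞ R] {om : DForm E₁ X₁ 2} (hc : G.IsThreeCocycle η om)
    (P : IsPrincipalCircleBundle E₁ ER π) (hθ : IsConnectionForm θ) (hG : G.SConnected)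
    {a b c : R} (h : G.tgt (π a) = G.src (π b)) (h' : G.tgt (π b) = G.src (π c)) :
    μ (μ a b) c = μ a (μ b c) := by
  obtain ⟨r, hr⟩ : ∃ r : X₁ → R, ∀ x, π (r x) = x := P.surjective.hasRightInverse
  let D : G.Triples → Circle := fun q => phase (μ (μ (r q.fst.fst) (r q.fst.snd)) (r q.snd))
    (μ (r q.fst.fst) (μ (r q.fst.snd) (r q.snd)))
  -- The associator does not depend on the chosen lifts: rotating them by `s, t, u` multiplies both
  -- bracketings by `stu`. Hence the discontinuity of `r` is harmless.
  have hD : ∀ (q : G.Triples) (x y z : R) (k : Circle), π x = q.fst.fst → π y = q.fst.snd →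
      π z = q.snd → (μ x (μ y z) = k • μ (μ x y) z ↔ D q = k) := by
    intro q x y z k hx hy hz
    obtain ⟨s, hs⟩ := P.exists_smul_eq ((hr _).trans hx.symm)
    obtain ⟨t, ht⟩ := P.exists_smul_eq ((hr _).trans hy.symm)
    obtain ⟨u, hu⟩ := P.exists_smul_eq ((hr _).trans hz.symm)
    have c1 : G.tgt (π (r q.fst.fst)) = G.src (π (r q.fst.snd)) := by
      rw [hr, hr]; exact q.fst.w
    have c2 : G.tgt (π (r q.fst.snd)) = G.src (π (r q.snd)) := by
      rw [hr, hr]; exact q.w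
    have hp := hμ.proj_assoc c1 c2
    rw [← hs, ← ht, ← hu, hμ.smul_smul _ _ _ _ c1, hμ.smul_smul _ _ _ _ c2,
      hμ.smul_smul _ _ _ _ ((hμ.tgt_mul c1).trans c2),
      hμ.smul_smul _ _ _ _ (c1.trans (hμ.src_mul c2).symm), _root_.mul_assoc, _root_.smul_smul k,
      mul_comm k, mul_smul _ k]
    constructor
    · intro e
      have e := MulAction.injective (s * (t * u)) e
      exact P.phase_eq e.symm
    · rintro rfl
      exact congrArg _ (P.phase_smul hp).symm
  have hloc : IsLocallyConstant D := by
    rw [IsLocallyConstant.iff_eventually_eq]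
    intro q
    obtain ⟨W, x, y, z, k, hW, h⟩ := hμ.exists_associator_const hc P hθ q
    have hk : ∀ p ∈ W, D p = k := fun p hp => by
      obtain ⟨h1, h2, h3, h4⟩ := h p hp
      exact (hD p _ _ _ k h1 h2 h3).1 h4
    filter_upwards [hW] with p hp
    rw [hk p hp, hk q (mem_of_mem_nhds hW)]
  have conn : ∀ {S : Set X₁} (_ : IsConnected S) (f : S → G.Triples), Continuous f →
      ∀ x y : S, D (f x) = D (f y) := by
    intro S hS f hf x y
    have := isPreconnected_iff_preconnectedSpace.1 hS.isPreconnected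
    exact (hloc.comp_continuous hf).apply_eq_of_preconnectedSpace x y
  have contP : ∀ {S : Set X₁} (f : S → G.Pairs), Continuous (fun s => (f s).fst) →
      Continuous (fun s => (f s).snd) → Continuous f := fun f h1 h2 =>
    FiberProduct.isInducing_toProd.continuous_iff.2 (h1.prodMk h2)
  have contT : ∀ {S : Set X₁} (f : S → G.Triples), Continuous (fun s => (f s).fst) →
      Continuous (fun s => (f s).snd) → Continuous f := fun f h1 h2 =>
    FiberProduct.isInducing_toProd.continuous_iff.2 (h1.prodMk h2)
  have cu := G.contMDiff_unit.continuous
  have ct := G.isSubmersion_tgt.contMDiff.continuous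
  -- The last entry must move first: it ranges freely over one source fibre with the others fixed.
  -- Only once it is the unit at the target of `y` can it follow `y` as that moves, and similarly
  -- for `x`.
  have step1 : ∀ (p : G.Pairs) (z : X₁) (hz : G.tgt p.snd = G.src z),
      D ⟨p, z, hz⟩ = D ⟨p, G.unit (G.tgt p.snd), (G.src_unit _).symm⟩ := by
    intro p z hz
    refine conn (hG (G.tgt p.snd)) (fun z => ⟨p, z.1, z.2.symm⟩) ?_ ⟨z, hz.symm⟩
      ⟨G.unit (G.tgt p.snd), G.src_unit _⟩
    exact contT _ continuous_const continuous_subtype_val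
  have step2 : ∀ (x y : X₁) (hy : G.tgt x = G.src y),
      D ⟨⟨x, y, hy⟩, G.unit (G.tgt y), (G.src_unit _).symm⟩ =
        D ⟨⟨x, G.unit (G.tgt x), (G.src_unit _).symm⟩,
          G.unit (G.tgt (G.unit (G.tgt x))), (G.src_unit _).symm⟩ := by
    intro x y hy
    refine conn (hG (G.tgt x)) (fun y => ⟨⟨x, y.1, y.2.symm⟩, G.unit (G.tgt y.1),
      (G.src_unit _).symm⟩) ?_ ⟨y, hy.symm⟩ ⟨G.unit (G.tgt x), G.src_unit _⟩
    exact contT _ (contP _ continuous_const continuous_subtype_val)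
      (cu.comp (ct.comp continuous_subtype_val))
  have step3 : ∀ x : X₁, D ⟨⟨x, G.unit (G.tgt x), (G.src_unit _).symm⟩,
        G.unit (G.tgt (G.unit (G.tgt x))), (G.src_unit _).symm⟩ = 1 := by
    intro x
    have e := conn (hG (G.src x)) (fun x => ⟨⟨x.1, G.unit (G.tgt x.1), (G.src_unit _).symm⟩,
        G.unit (G.tgt (G.unit (G.tgt x.1))), (G.src_unit _).symm⟩)
        (contT _ (contP _ continuous_subtype_val (cu.comp (ct.comp continuous_subtype_val)))
          (cu.comp (ct.comp (cu.comp (ct.comp continuous_subtype_val)))))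
        ⟨x, rfl⟩ ⟨G.unit (G.src x), G.src_unit _⟩
    refine e.trans ?_
    set u := G.src x
    obtain ⟨ε, hε⟩ : ∃ ε, ε = phase (μ (r (G.unit u)) (r (G.unit u))) (r (G.unit u)) •
      r (G.unit u) := ⟨_, rfl⟩
    have hi := hμ.exists_idempotent P (hr (G.unit u))
    have hπ : π ε = G.unit u := by rw [hε, P.proj_smul, hr]
    rw [← hε] at hi
    refine (hD _ ε ε ε 1 hπ ?_ ?_).1 ?_
    · exact hπ.trans (congrArg G.unit (G.tgt_unit u).symm)
    · exact hπ.trans (congrArg G.unit ((G.tgt_unit _).trans (G.tgt_unit u)).symm)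
    · rw [hi, hi, one_smul]
  have e := (hD ⟨⟨π a, π b, h⟩, π c, h'⟩ a b c 1 rfl rfl rfl).2
    ((step1 _ _ _).trans ((step2 _ _ _).trans (step3 _)))
  rw [e, one_smul]

end Associativity

end IsFlatMul
end LieGroupoid

/-! ### Source and target of the extension are submersions. -/

/-- The composite of a circle bundle and a submersion is a submersion. -/
theorem IsPrincipalCircleBundle.isSubmersion_comp {E₀ E₁ ER X₀ X₁ R : Type*}
    [NormedAddCommGroup E₀] [NormedSpace ℝ E₀] [TopologicalSpace X₀] [ChartedSpace E₀ X₀]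
    [NormedAddCommGroup E₁] [NormedSpace ℝ E₁] [TopologicalSpace X₁] [ChartedSpace E₁ X₁]
    [NormedAddCommGroup ER] [NormedSpace ℝ ER] [TopologicalSpace R] [ChartedSpace ER R]
    [MulAction Circle R] [IsManifold 𝓘(ℝ, E₁) ∞ X₁] [IsManifold 𝓘(ℝ, ER) ∞ R]
    {π : R → X₁} (P : IsPrincipalCircleBundle E₁ ER π) {f : X₁ → X₀}
    (hf : IsSubmersion 𝓘(ℝ, E₁) 𝓘(ℝ, E₀) ∞ f) :
    IsSubmersion 𝓘(ℝ, ER) 𝓘(ℝ, E₀) ∞ (fun r => f (π r)) := by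
  have hs := hf.isSubmersionOfComplement_complement
  refine (IsSubmersionOfComplement.isSubmersion
    (F := hf.complement × EuclideanSpace ℝ (Fin 1)) ?_)
  intro r
  obtain ⟨e, he, h1, h2, -⟩ := P.locally_trivial (π r)
  have hr : r ∈ e.source := e.mem_source.2 he
  have hm : OpenPartialHomeomorph.MDifferentiable 𝓘(ℝ, ER) (𝓘(ℝ, E₁).prod (𝓡 1))
      e.toOpenPartialHomeomorph := ⟨h1.mdifferentiableOn (by simp), h2.mdifferentiableOn (by simp)⟩
  -- The model space `ER` is not given as a product; the derivative of the trivialization at `r`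
  -- identifies it with one, so that the product chart can be turned into a chart with values in
  -- `ER`.
  let L : ER ≃L[ℝ] E₁ × EuclideanSpace ℝ (Fin 1) := hm.mfderiv hr
  let φ := (hs (π r)).domChart
  let c := chartAt (EuclideanSpace ℝ (Fin 1)) (e r).2
  let D : OpenPartialHomeomorph R ER := (e.toOpenPartialHomeomorph.trans (φ.prod c)).trans
    L.symm.toHomeomorph.toOpenPartialHomeomorph
  let ψ := (hs (π r)).codChart
  have hDs : ∀ q, q ∈ D.source ↔ q ∈ e.source ∧ π q ∈ φ.source ∧ (e q).2 ∈ c.source := by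
    intro q
    simp only [D, OpenPartialHomeomorph.trans_source, OpenPartialHomeomorph.prod_source, mem_inter_iff,
      mem_preimage, mem_prod]
    constructor
    · rintro ⟨⟨h1, h2, h3⟩, -⟩
      exact ⟨h1, by rwa [← e.coe_fst h1], h3⟩
    · rintro ⟨h1, h2, h3⟩
      exact ⟨⟨h1, by rwa [← e.coe_fst h1] at h2, h3⟩, by simp⟩
  have hfc : ContinuousAt (fun r => f (π r)) r :=
    (hf.contMDiff.continuous.comp P.contMDiff_proj.continuous).continuousAt
  have hφ1 : ContMDiffOn 𝓘(ℝ, E₁) 𝓘(ℝ, E₁) ∞ φ φ.source :=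
    contMDiffOn_of_mem_maximalAtlas (hs (π r)).domChart_mem_maximalAtlas
  have hφ2 : ContMDiffOn 𝓘(ℝ, E₁) 𝓘(ℝ, E₁) ∞ φ.symm φ.target :=
    contMDiffOn_symm_of_mem_maximalAtlas (hs (π r)).domChart_mem_maximalAtlas
  have hc1 : ContMDiffOn (𝓡 1) (𝓡 1) ∞ c c.source :=
    contMDiffOn_chart (x := (e r).2)
  have hc2 : ContMDiffOn (𝓡 1) (𝓡 1) ∞ c.symm c.target :=
    contMDiffOn_chart_symm (x := (e r).2)
  refine (IsSubmersionAtOfComplement.mk_of_continuousAt hfc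
    (L.trans (((hs (π r)).equiv.prodCongr (ContinuousLinearEquiv.refl ℝ _)).trans
      (ContinuousLinearEquiv.prodAssoc ℝ _ _ _))) D ψ ?_ ?_ ?_ ?_ ?_)
  · exact (hDs r).2 ⟨hr, (hs (π r)).mem_domChart_source, mem_chart_source _ _⟩
  · exact (hs (π r)).mem_codChart_source
  · refine OpenPartialHomeomorph.mem_maximalAtlas_of_contMDiffOn (I := 𝓘(ℝ, ER)) (n := ∞) D ?_ ?_
    · have k1 : ContMDiffOn 𝓘(ℝ, ER) 𝓘(ℝ, E₁) ∞ (fun q => φ (e q).1) D.source :=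
        hφ1.comp (contMDiff_fst.comp_contMDiffOn (h1.mono fun q hq => ((hDs q).1 hq).1))
          fun q hq => by
            obtain ⟨g1, g2, -⟩ := (hDs q).1 hq
            rwa [← e.coe_fst g1] at g2
      have k2 : ContMDiffOn 𝓘(ℝ, ER) 𝓘(ℝ, EuclideanSpace ℝ (Fin 1)) ∞ (fun q => c (e q).2)
          D.source :=
        hc1.comp (contMDiff_snd.comp_contMDiffOn (h1.mono fun q hq => ((hDs q).1 hq).1))
          fun q hq => ((hDs q).1 hq).2.2
      exact L.symm.contDiff.contMDiff.comp_contMDiffOn (k1.prodMk_space k2)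
    · have hT : ∀ v ∈ D.target, (L v).1 ∈ φ.target ∧ (L v).2 ∈ c.target ∧
          (φ.symm (L v).1, c.symm (L v).2) ∈ e.target := by
        intro v hv
        simp only [D, OpenPartialHomeomorph.trans_target, mem_inter_iff, mem_preimage] at hv
        exact ⟨hv.2.1.1, hv.2.1.2, hv.2.2⟩
      have k0 : ContMDiffOn 𝓘(ℝ, ER) 𝓘(ℝ, E₁ × EuclideanSpace ℝ (Fin 1)) ∞ L D.target :=
        L.contDiff.contMDiff.contMDiffOn
      have k1 : ContMDiffOn 𝓘(ℝ, ER) 𝓘(ℝ, E₁) ∞ (fun v => φ.symm (L v).1) D.target :=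
        hφ2.comp (contDiff_fst.contMDiff.comp_contMDiffOn k0) fun v hv => (hT v hv).1
      have k2 : ContMDiffOn 𝓘(ℝ, ER) (𝓡 1) ∞ (fun v => c.symm (L v).2) D.target :=
        hc2.comp (contDiff_snd.contMDiff.comp_contMDiffOn k0) fun v hv => (hT v hv).2.1
      exact h2.comp (k1.prodMk k2) fun v hv => (hT v hv).2.2
  · exact (hs (π r)).codChart_mem_maximalAtlas
  · intro v hv
    have hv' : v ∈ D.target := by simpa using hv
    obtain ⟨q, hq, rfl⟩ : ∃ q ∈ D.source, D q = v := ⟨D.symm v, D.map_target hv', D.right_inv hv'⟩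
    obtain ⟨g1, g2, g3⟩ := (hDs q).1 hq
    have key : ψ (f (π q)) = ((hs (π r)).equiv (φ (π q))).1 := by
      have h0 := (hs (π r)).writtenInCharts
      have h := @h0 (φ (π q))
        (by rw [φ.extend_target_eq_image_source]; exact mem_image_of_mem _ g2)
      simpa [φ, ψ, (hs (π r)).domChart.left_inv g2] using h
    have e1 : D.symm (D q) = q := D.left_inv hq
    have e2 : L (D q) = (φ (e q).1, c (e q).2) := L.apply_symm_apply _
    rw [e.coe_fst g1] at e2
    simp only [Function.comp_apply, OpenPartialHomeomorph.extend_coe, OpenPartialHomeomorph.extend_coe_symm,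
      modelWithCornersSelf_coe, modelWithCornersSelf_coe_symm, id_eq]
    rw [e1]
    refine key.trans ?_
    simp [e2]

theorem eq_of_add_eq {a b c d : ℝ} (h : a + b = c + d) : b - c + a = d := by
  linarith

/-! ### Units, inverses and the central extension. -/

namespace LieGroupoid

variable {E₀ E₁ ER X₀ X₁ R : Type*}
  [NormedAddCommGroup E₀] [NormedSpace ℝ E₀] [TopologicalSpace X₀] [ChartedSpace E₀ X₀]
  [NormedAddCommGroup E₁] [NormedSpace ℝ E₁] [TopologicalSpace X₁] [ChartedSpace E₁ X₁]
  [NormedAddCommGroup ER] [NormedSpace ℝ ER] [TopologicalSpace R] [ChartedSpace ER R]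
  [MulAction Circle R] [IsManifold 𝓘(ℝ, E₀) ∞ X₀] [IsManifold 𝓘(ℝ, E₁) ∞ X₁]

namespace IsFlatMul

variable {G : LieGroupoid E₀ E₁ X₀ X₁} {π : R → X₁}
  {η : DForm G.PairsModel G.Pairs 1} {θ : DForm ER R 1} {μ : R → R → R}
  (hμ : IsFlatMul ER G π η θ μ) (P : IsPrincipalCircleBundle E₁ ER π)

include hμ P

/-- Rotation by `s` multiplies `a · a` by `s²` but `a` by `s`, so a rotated idempotent is idempotent
only for `s = 1`. -/
theorem idempotent_unique {a b : R} {u : X₀} (ha : π a = G.unit u) (hb : π b = G.unit u)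
    (ha' : μ a a = a) (hb' : μ b b = b) : a = b := by
  obtain ⟨s, rfl⟩ := P.exists_smul_eq (ha.trans hb.symm)
  rw [hμ.smul_smul _ _ _ _ (by rw [ha, G.tgt_unit, G.src_unit]), ha', mul_smul] at hb'
  have h1 := MulAction.injective s hb'
  exact h1.symm

/-- Lifts of the units and of the inversion. -/
theorem exists_unit_inv [IsManifold 𝓘(ℝ, ER) ∞ R]
    (assoc : ∀ {a b c : R}, G.tgt (π a) = G.src (π b) → G.tgt (π b) = G.src (π c) →
      μ (μ a b) c = μ a (μ b c)) :
    ∃ (e : X₀ → R) (i : R → R), ContMDiff 𝓘(ℝ, E₀) 𝓘(ℝ, ER) ∞ e ∧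
      ContMDiff 𝓘(ℝ, ER) 𝓘(ℝ, ER) ∞ i ∧ (∀ u, π (e u) = G.unit u) ∧
      (∀ a, π (i a) = G.inv (π a)) ∧ (∀ a, μ (e (G.src (π a))) a = a) ∧
      (∀ a, μ a (e (G.tgt (π a))) = a) ∧ (∀ a, μ a (i a) = e (G.src (π a))) ∧
      ∀ a, μ (i a) a = e (G.tgt (π a)) := by
  obtain ⟨r, hr⟩ : ∃ r : X₁ → R, ∀ x, π (r x) = x := P.surjective.hasRightInverse
  let e : X₀ → R := fun u => phase (μ (r (G.unit u)) (r (G.unit u))) (r (G.unit u)) • r (G.unit u)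
  have eπ : ∀ u, π (e u) = G.unit u := fun u => by simp only [e]; rw [P.proj_smul, hr]
  have eid : ∀ u, μ (e u) (e u) = e u := fun u => hμ.exists_idempotent P (hr _)
  -- `e` is built from a discontinuous section, but by uniqueness of idempotents any lift of the
  -- unit produces the same value; inserting smooth local sections later shows that `e` is smooth.
  have eun : ∀ u a, π a = G.unit u → phase (μ a a) a • a = e u := fun u a ha =>
    hμ.idempotent_unique P ((P.proj_smul _ _).trans ha) (eπ u) (hμ.exists_idempotent P ha) (eid u)
  have ecomp : ∀ a, G.tgt (π (e (G.src (π a)))) = G.src (π a) := fun a => by rw [eπ, G.tgt_unit]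
  have ecomp' : ∀ a, G.tgt (π a) = G.src (π (e (G.tgt (π a)))) := fun a => by rw [eπ, G.src_unit]
  have eself : ∀ u, G.tgt (π (e u)) = G.src (π (e u)) := fun u => by
    rw [eπ, G.tgt_unit, G.src_unit]
  have one : ∀ (s : Circle) (a : R), s • s • a = s • a → s • a = a := fun s a h =>
    MulAction.injective s h
  -- If `e a = s a`, then `s a = e a = (e e) a = e (e a) = s² a`.
  have left : ∀ a, μ (e (G.src (π a))) a = a := by
    intro a
    have hp : π a = π (μ (e (G.src (π a))) a) := by
      rw [hμ.proj _ _ (ecomp a)]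
      exact (G.unit_mul (π a)).symm.trans (congrArg G.mul (FiberProduct.ext (eπ _).symm rfl))
    obtain ⟨s, hs⟩ := P.exists_smul_eq hp
    have h1 := assoc (eself _) (ecomp a)
    have h2 := hμ.smul_smul 1 s _ _ (ecomp a)
    rw [one_smul, one_mul] at h2
    rw [eid, ← hs, h2, ← hs] at h1
    rw [← hs]
    exact one s a h1.symm
  have right : ∀ a, μ a (e (G.tgt (π a))) = a := by
    intro a
    have hp : π a = π (μ a (e (G.tgt (π a)))) := by
      rw [hμ.proj _ _ (ecomp' a)]
      exact (G.mul_unit (π a)).symm.trans (congrArg G.mul (FiberProduct.ext rfl (eπ _).symm))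
    obtain ⟨s, hs⟩ := P.exists_smul_eq hp
    have h1 := assoc (ecomp' a) (eself _)
    have h2 := hμ.smul_smul s 1 _ _ (ecomp' a)
    rw [one_smul, mul_one] at h2
    rw [eid, ← hs, h2, ← hs] at h1
    rw [← hs]
    exact one s a h1
  have icomp : ∀ a b, π b = G.inv (π a) → G.tgt (π a) = G.src (π b) := fun a b h => by
    rw [h, G.src_inv]
  have icomp' : ∀ a b, π b = G.inv (π a) → G.tgt (π b) = G.src (π a) := fun a b h => by
    rw [h, G.tgt_inv]
  have iproj : ∀ a b, π b = G.inv (π a) → π (μ a b) = π (e (G.src (π a))) := fun a b h => by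
    rw [hμ.proj _ _ (icomp a b h), eπ, ← G.mul_inv (π a)]
    exact congrArg G.mul (FiberProduct.ext rfl h)
  let i : R → R := fun a =>
    phase (μ a (r (G.inv (π a)))) (e (G.src (π a))) • r (G.inv (π a))
  have iπ : ∀ a, π (i a) = G.inv (π a) := fun a => by simp only [i]; rw [P.proj_smul, hr]
  -- The inverse is independent of the lift from which it is normalised, which again permits smooth
  -- local sections.
  have iun : ∀ a b, π b = G.inv (π a) → i a = phase (μ a b) (e (G.src (π a))) • b := by
    intro a b h
    obtain ⟨s, rfl⟩ := P.exists_smul_eq ((hr _).trans h.symm)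
    have h2 := hμ.smul_smul 1 s a (r (G.inv (π a))) (icomp a _ (hr _))
    rw [one_smul, one_mul] at h2
    rw [h2, P.phase_smul_left (iproj a _ (hr _)), _root_.smul_smul, mul_right_comm,
      inv_mul_cancel, one_mul]
  have iright : ∀ a, μ a (i a) = e (G.src (π a)) := by
    intro a
    have h2 := hμ.smul_smul 1 (phase (μ a (r (G.inv (π a)))) (e (G.src (π a)))) a
      (r (G.inv (π a))) (icomp a _ (hr _))
    rw [one_smul, one_mul] at h2
    exact h2.trans (P.phase_smul (iproj a _ (hr _)))
  -- If `(i a) a = s e`, then `a = (a (i a)) a = a ((i a) a) = s a`, so `s = 1`.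
  have ileft : ∀ a, μ (i a) a = e (G.tgt (π a)) := by
    intro a
    have hp : π (e (G.tgt (π a))) = π (μ (i a) a) := by
      rw [hμ.proj _ _ (icomp' a _ (iπ a)), eπ, ← G.inv_mul (π a)]
      exact congrArg G.mul (FiberProduct.ext (iπ a).symm rfl)
    obtain ⟨s, hs⟩ := P.exists_smul_eq hp
    have h1 := assoc (icomp a _ (iπ a)) (icomp' a _ (iπ a))
    have h2 := hμ.smul_smul 1 s _ _ (ecomp' a)
    rw [one_smul, one_mul] at h2
    rw [iright, left, ← hs, h2, right] at h1
    have s1 : s = 1 := P.smul_left_cancel (a := a) (by rw [one_smul, ← h1])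
    rw [← hs, s1, one_smul]
  have esm : ContMDiff 𝓘(ℝ, E₀) 𝓘(ℝ, ER) ∞ e := by
    intro u
    obtain ⟨U, σ, hU, hu, hσ, hσ'⟩ := P.exists_section (G.unit u)
    have hUn : ∀ᶠ v in 𝓝 u, G.unit v ∈ U :=
      G.contMDiff_unit.continuous.continuousAt (hU.mem_nhds hu)
    have s1 : ContMDiffAt 𝓘(ℝ, E₀) 𝓘(ℝ, ER) ∞ (fun v => σ (G.unit v)) u :=
      (hσ.contMDiffAt (hU.mem_nhds hu)).comp u (G.contMDiff_unit u)
    have hc : ContMDiff 𝓘(ℝ, E₀) 𝓘(ℝ, G.PairsModel) ∞ (fun v : X₀ =>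
        (⟨G.unit v, G.unit v, (G.tgt_unit v).trans (G.src_unit v).symm⟩ : G.Pairs)) :=
      FiberProduct.contMDiff_of_comp G.contMDiff_unit G.contMDiff_unit
    have hp : ∀ᶠ v in 𝓝 u, π (σ (G.unit v)) = G.unit v := hUn.mono fun v hv => hσ' _ hv
    have s2 := hμ.contMDiffAt_mul P s1 s1 (hc u) hp hp
    have s3 := P.contMDiffAt_phase s2 s1 (hp.mono fun v hv => by
      exact hμ.proj_mul_self hv)
    refine ContMDiffAt.congr_of_eventuallyEq ((P.contMDiff_smul _).comp u (s3.prodMk s1)) ?_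
    exact hp.mono fun v hv => (eun v _ hv).symm
  refine ⟨e, i, esm, fun a => ?_, eπ, iπ, left, right, iright, ileft⟩
  obtain ⟨U, σ, hU, hu, hσ, hσ'⟩ := P.exists_section (G.inv (π a))
  have hin : ContMDiff 𝓘(ℝ, ER) 𝓘(ℝ, E₁) ∞ (fun a => G.inv (π a)) :=
    G.contMDiff_inv.comp P.contMDiff_proj
  have hUn : ∀ᶠ v in 𝓝 a, G.inv (π v) ∈ U := hin.continuous.continuousAt (hU.mem_nhds hu)
  have s1 : ContMDiffAt 𝓘(ℝ, ER) 𝓘(ℝ, ER) ∞ (fun v => σ (G.inv (π v))) a :=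
    (hσ.contMDiffAt (hU.mem_nhds hu)).comp a (hin a)
  have hc : ContMDiff 𝓘(ℝ, ER) 𝓘(ℝ, G.PairsModel) ∞ (fun v : R =>
      (⟨π v, G.inv (π v), (G.src_inv (π v)).symm⟩ : G.Pairs)) :=
    FiberProduct.contMDiff_of_comp P.contMDiff_proj hin
  have hp : ∀ᶠ v in 𝓝 a, π (σ (G.inv (π v))) = G.inv (π v) := hUn.mono fun v hv => hσ' _ hv
  have s2 := hμ.contMDiffAt_mul P contMDiffAt_id s1 (hc a) (Filter.Eventually.of_forall fun v => rfl)
    hp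
  have hes : ContMDiff 𝓘(ℝ, ER) 𝓘(ℝ, ER) ∞ (fun v => e (G.src (π v))) :=
    esm.comp (G.isSubmersion_src.contMDiff.comp P.contMDiff_proj)
  have s3 := P.contMDiffAt_phase s2 (hes a) (hp.mono fun v hv => iproj v _ hv)
  refine ContMDiffAt.congr_of_eventuallyEq ((P.contMDiff_smul _).comp a (s3.prodMk s1)) ?_
  exact hp.mono fun v hv => iun v _ hv

/-- The central extension defined by a flat multiplication. -/
theorem exists_centralExtension [IsManifold 𝓘(ℝ, ER) ∞ R] {om : DForm E₁ X₁ 2}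
    (hc : G.IsThreeCocycle η om) (hθ : IsConnectionForm θ) (hcurv : θ.extD = -om.pullback π)
    (hG : G.SConnected) :
    ∃ Γ : CentralExtension ER G π, Γ.IsPseudoConnection θ η om := by
  obtain ⟨e, i, he, hi, eπ, iπ, left, right, iright, ileft⟩ :=
    hμ.exists_unit_inv P (fun h h' => hμ.assoc hc P hθ hG h h')
  have hs := P.isSubmersion_comp G.isSubmersion_src
  have ht := P.isSubmersion_comp G.isSubmersion_tgt
  have c1 : ContMDiff 𝓘(ℝ, ER × hs.complement) 𝓘(ℝ, ER) ∞
      (fun p : FiberProduct ht.contMDiff hs => p.fst) := FiberProduct.contMDiff_fst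
  have c2 : ContMDiff 𝓘(ℝ, ER × hs.complement) 𝓘(ℝ, ER) ∞
      (fun p : FiberProduct ht.contMDiff hs => p.snd) := FiberProduct.contMDiff_snd
  have c3 : ContMDiff 𝓘(ℝ, ER × hs.complement) 𝓘(ℝ, G.PairsModel) ∞
      (fun p : FiberProduct ht.contMDiff hs => (⟨π p.fst, π p.snd, p.w⟩ : G.Pairs)) :=
    FiberProduct.contMDiff_of_comp (P.contMDiff_proj.comp c1) (P.contMDiff_proj.comp c2)
  let Γ₀ : LieGroupoid E₀ ER X₀ R :=
    { src := fun a => G.src (π a)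
      tgt := fun a => G.tgt (π a)
      isSubmersion_src := hs
      isSubmersion_tgt := ht
      mul := fun p => μ p.fst p.snd
      unit := e
      inv := i
      contMDiff_mul := fun p => hμ.contMDiffAt_mul P (c1 p) (c2 p) (c3 p)
        (Filter.Eventually.of_forall fun _ => rfl) (Filter.Eventually.of_forall fun _ => rfl)
      contMDiff_unit := he
      contMDiff_inv := hi
      src_mul := fun p => hμ.src_mul p.w
      tgt_mul := fun p => hμ.tgt_mul p.w
      mul_assoc := fun x y z h h' => hμ.assoc hc P hθ hG h h'
      src_unit := fun u => by rw [eπ, G.src_unit]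
      tgt_unit := fun u => by rw [eπ, G.tgt_unit]
      unit_mul := left
      mul_unit := right
      src_inv := fun x => by rw [iπ, G.src_inv]
      tgt_inv := fun x => by rw [iπ, G.tgt_inv]
      mul_inv := iright
      inv_mul := ileft }
  let Γ : CentralExtension ER G π :=
    { toLieGroupoid := Γ₀
      isPrincipal := P
      src_eq := fun _ => rfl
      tgt_eq := fun _ => rfl
      proj_mul := fun a b h => hμ.proj a b h
      proj_unit := eπ
      smul_mul_smul := fun s t a b h => hμ.smul_smul s t a b h }
  refine ⟨Γ, hθ, ?_, hcurv⟩
  funext p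
  refine ContinuousAlternatingMap.ext fun w => ?_
  have key := (hμ.mdifferentiableAt_mul P hθ (c1.mdifferentiable (by simp) p)
    (c2.mdifferentiable (by simp) p) (c3.mdifferentiable (by simp) p)
    (Filter.Eventually.of_forall fun _ => rfl) (Filter.Eventually.of_forall fun _ => rfl)).2 (w 0)
  have hw : w = fun _ => w 0 := funext fun j => by rw [Subsingleton.elim j 0]
  rw [hw]
  change θ.pullback (EP := ER × hs.complement)
        (fun p : FiberProduct ht.contMDiff hs => p.snd) p (fun _ => w 0) -
      θ.pullback (EP := ER × hs.complement)
        (fun p : FiberProduct ht.contMDiff hs => μ p.fst p.snd) p (fun _ => w 0) +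
      θ.pullback (EP := ER × hs.complement)
        (fun p : FiberProduct ht.contMDiff hs => p.fst) p (fun _ => w 0) =
      η.pullback (EP := ER × hs.complement)
        (fun p : FiberProduct ht.contMDiff hs => (⟨π p.fst, π p.snd, p.w⟩ : G.Pairs)) p
        (fun _ => w 0)
  exact eq_of_add_eq key

end IsFlatMul
end LieGroupoid

/-! ### The double complex of singular cochains and `D² = 0`. -/

/-- The alternating double sum over a doubly indexed family satisfying the simplicial identities
vanishes. -/
theorem Fin.sum_sum_neg_one_pow_smul_eq_zero {A : Type*} [AddCommGroup A] {n : ℕ}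
    (f : Fin (n + 2) → Fin (n + 1) → A)
    (h : ∀ i j : Fin (n + 1), i ≤ j → f i.castSucc j = f j.succ i) :
    ∑ a : Fin (n + 2), (-1 : ℤ) ^ (a : ℕ) • ∑ b : Fin (n + 1), (-1 : ℤ) ^ (b : ℕ) • f a b = 0 := by
  simp_rw [Finset.smul_sum, smul_smul, ← pow_add]
  refine (Finset.sum_product' Finset.univ Finset.univ
    (fun (a : Fin (n + 2)) (b : Fin (n + 1)) =>
      (-1 : ℤ) ^ ((a : ℕ) + (b : ℕ)) • f a b)).symm.trans ?_
  have lt : ∀ {p : Fin (n + 2) × Fin (n + 1)}, (p.1 : ℕ) ≤ p.2 → (p.1 : ℕ) < n + 1 :=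
    fun {p} hp => lt_of_le_of_lt hp p.2.2
  have pos : ∀ {p : Fin (n + 2) × Fin (n + 1)}, ¬ (p.1 : ℕ) ≤ p.2 → (p.1 : ℕ) - 1 < n + 1 :=
    fun {p} hp => by have := p.1.2; omega
  -- Terms cancel in pairs: `(a, b)` with `a ≤ b` against `(b + 1, a)`, whose sign is opposite.
  refine Finset.sum_involution (fun p _ => if hp : (p.1 : ℕ) ≤ p.2 then (p.2.succ, ⟨p.1, lt hp⟩)
    else (p.2.castSucc, ⟨p.1 - 1, pos hp⟩)) ?_ ?_ ?_ ?_
  · rintro ⟨a, b⟩ -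
    by_cases hp : (a : ℕ) ≤ b
    · rw [dif_pos hp]
      have e := h ⟨a, lt (p := (a, b)) hp⟩ b hp
      change f a b = f b.succ ⟨a, _⟩ at e
      rw [e, ← add_smul]
      simp only [Fin.val_succ]
      rw [show (b : ℕ) + 1 + a = a + b + 1 by ring, pow_succ]
      simp
    · rw [dif_neg hp]
      have hb : b ≤ ⟨(a : ℕ) - 1, pos (p := (a, b)) hp⟩ := by
        change (b : ℕ) ≤ a - 1; omega
      have e := h b ⟨a - 1, pos (p := (a, b)) hp⟩ hb
      have ha : (⟨(a : ℕ) - 1, pos (p := (a, b)) hp⟩ : Fin (n + 1)).succ = a :=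
        Fin.ext (by simp only [Fin.succ_mk]; omega)
      rw [ha] at e
      rw [e, ← add_smul]
      simp only [Fin.val_castSucc]
      rw [show (a : ℕ) + b = b + (a - 1) + 1 by omega, pow_succ]
      simp
  · rintro ⟨a, b⟩ - - e
    by_cases hp : (a : ℕ) ≤ b
    · rw [dif_pos hp] at e
      have := congrArg (fun p => (p.1 : ℕ)) e
      simp at this; omega
    · rw [dif_neg hp] at e
      have := congrArg (fun p => (p.1 : ℕ)) e
      simp at this; omega
  · exact fun _ _ => Finset.mem_univ _
  · rintro ⟨a, b⟩ -
    by_cases hp : (a : ℕ) ≤ b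
    · simp only [dif_pos hp]
      rw [dif_neg (by simp only [Fin.val_succ]; omega)]
      exact Prod.ext (Fin.ext rfl) (Fin.ext (by simp))
    · simp only [dif_neg hp]
      rw [dif_pos (by simp only [Fin.val_castSucc]; omega)]
      exact Prod.ext (Fin.ext (by simp; omega)) (Fin.ext rfl)

namespace LieGroupoid

variable {E₀ E₁ X₀ X₁ : Type*}
  [NormedAddCommGroup E₀] [NormedSpace ℝ E₀] [TopologicalSpace X₀] [ChartedSpace E₀ X₀]
  [NormedAddCommGroup E₁] [NormedSpace ℝ E₁] [TopologicalSpace X₁] [ChartedSpace E₁ X₁]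
  {G : LieGroupoid E₀ E₁ X₀ X₁} {A : Type*} [AddCommGroup A]

theorem _root_.Fin.succAbove_succAbove_of_le {n : ℕ} {i j : Fin (n + 2)} (h : i ≤ j)
    (k : Fin (n + 1)) :
    i.castSucc.succAbove (j.succAbove k) = j.succ.succAbove (i.succAbove k) := by
  ext
  simp only [Fin.succAbove, Fin.lt_def, Fin.val_castSucc, Fin.val_succ]
  have := Fin.le_def.1 h
  split_ifs <;> simp_all <;> omega

namespace SingularSimplex

theorem nerveFace_nerveFace {p q : ℕ} (σ : G.SingularSimplex (p + 2) q) {i j : Fin (p + 2)}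
    (h : i ≤ j) : (σ.nerveFace i.castSucc).nerveFace j = (σ.nerveFace j.succ).nerveFace i := by
  refine SingularSimplex.ext (funext fun x => Nerve.ext (funext fun a => funext fun b => ?_))
  change (σ.toFun x).arr _ _ = (σ.toFun x).arr _ _
  rw [Fin.succAbove_succAbove_of_le h, Fin.succAbove_succAbove_of_le h]

theorem _root_.LieGroupoid.simplexCoface_simplexCoface {q : ℕ} {i j : Fin (q + 2)} (h : i ≤ j)
    (x : stdSimplex ℝ (Fin (q + 1))) :
    simplexCoface i.castSucc (simplexCoface j x) = simplexCoface j.succ (simplexCoface i x) := by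
  have e1 : j.succ.succAbove i = i.castSucc :=
    Fin.succAbove_of_castSucc_lt _ _ (by rw [Fin.lt_def]; simpa using Nat.lt_succ_of_le h)
  have e2 : i.castSucc.succAbove j = j.succ := Fin.succAbove_of_le_castSucc _ _ (by simpa using h)
  refine Subtype.ext (funext fun k => ?_)
  change i.castSucc.insertNth (α := fun _ => ℝ) 0 (j.insertNth (α := fun _ => ℝ) 0 x.1) k =
    j.succ.insertNth (α := fun _ => ℝ) 0 (i.insertNth (α := fun _ => ℝ) 0 x.1) k
  refine Fin.succAboveCases i.castSucc ?_ (fun m => ?_) k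
  · rw [Fin.insertNth_apply_same]
    conv_rhs => rw [← e1]
    rw [Fin.insertNth_apply_succAbove, Fin.insertNth_apply_same]
  · rw [Fin.insertNth_apply_succAbove]
    refine Fin.succAboveCases j ?_ (fun l => ?_) m
    · rw [Fin.insertNth_apply_same, e2, Fin.insertNth_apply_same]
    · rw [Fin.insertNth_apply_succAbove, Fin.succAbove_succAbove_of_le h,
        Fin.insertNth_apply_succAbove, Fin.insertNth_apply_succAbove]

theorem singularFace_singularFace {p q : ℕ} (σ : G.SingularSimplex p (q + 2)) {i j : Fin (q + 2)}
    (h : i ≤ j) :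
    (σ.singularFace i.castSucc).singularFace j = (σ.singularFace j.succ).singularFace i := by
  refine SingularSimplex.ext (funext fun x => ?_)
  exact congrArg σ.toFun (simplexCoface_simplexCoface h x)

end SingularSimplex

namespace Cochain

theorem simplicialD_simplicialD (c : G.Cochain A) : c.simplicialD.simplicialD = 0 := by
  funext p q σ
  match p with
  | 0 => rfl
  | 1 => exact Finset.sum_eq_zero fun i _ => smul_zero _
  | p + 2 =>
    exact Fin.sum_sum_neg_one_pow_smul_eq_zero
      (fun a b => c p q ((σ.nerveFace a).nerveFace b))
      fun i j h => congrArg _ (σ.nerveFace_nerveFace h)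

theorem singularD_singularD (c : G.Cochain A) : c.singularD.singularD = 0 := by
  funext p q σ
  match q with
  | 0 => rfl
  | 1 => exact Finset.sum_eq_zero fun i _ => smul_zero _
  | q + 2 =>
    exact Fin.sum_sum_neg_one_pow_smul_eq_zero
      (fun a b => c p q ((σ.singularFace a).singularFace b))
      fun i j h => congrArg _ (σ.singularFace_singularFace h)

theorem simplicialD_singularD (c : G.Cochain A) :
    c.simplicialD.singularD = c.singularD.simplicialD := by
  funext p q σ
  match p, q with
  | 0, 0 => rfl
  | 0, q + 1 => exact Finset.sum_eq_zero fun i _ => smul_zero _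
  | p + 1, 0 => exact (Finset.sum_eq_zero fun i _ => smul_zero _).symm
  | p + 1, q + 1 =>
    change ∑ i : Fin (q + 2), (-1 : ℤ) ^ (i : ℕ) • ∑ j : Fin (p + 2), (-1 : ℤ) ^ (j : ℕ) •
        c p q ((σ.singularFace i).nerveFace j) =
      ∑ j : Fin (p + 2), (-1 : ℤ) ^ (j : ℕ) • ∑ i : Fin (q + 2), (-1 : ℤ) ^ (i : ℕ) •
        c p q ((σ.nerveFace j).singularFace i)
    simp_rw [Finset.smul_sum]
    rw [Finset.sum_comm]
    refine Finset.sum_congr rfl fun j _ => Finset.sum_congr rfl fun i _ => ?_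
    rw [smul_comm]
    rfl

theorem simplicialD_add (c c' : G.Cochain A) :
    (c + c').simplicialD = c.simplicialD + c'.simplicialD := by
  funext p q σ
  match p with
  | 0 => exact (add_zero _).symm
  | p + 1 =>
    change ∑ i : Fin (p + 2), (-1 : ℤ) ^ (i : ℕ) • (c p q (σ.nerveFace i) + c' p q (σ.nerveFace i)) =
      (∑ i : Fin (p + 2), (-1 : ℤ) ^ (i : ℕ) • c p q (σ.nerveFace i)) +
        ∑ i : Fin (p + 2), (-1 : ℤ) ^ (i : ℕ) • c' p q (σ.nerveFace i)
    simp_rw [smul_add]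
    exact Finset.sum_add_distrib

theorem singularD_add (c c' : G.Cochain A) :
    (c + c').singularD = c.singularD + c'.singularD := by
  funext p q σ
  match q with
  | 0 => exact (add_zero _).symm
  | q + 1 =>
    change ∑ i : Fin (q + 2), (-1 : ℤ) ^ (i : ℕ) • (c p q (σ.singularFace i) + c' p q (σ.singularFace i)) =
      (∑ i : Fin (q + 2), (-1 : ℤ) ^ (i : ℕ) • c p q (σ.singularFace i)) +
        ∑ i : Fin (q + 2), (-1 : ℤ) ^ (i : ℕ) • c' p q (σ.singularFace i)
    simp_rw [smul_add]
    exact Finset.sum_add_distrib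

theorem totalD_add (c c' : G.Cochain A) : (c + c').totalD = c.totalD + c'.totalD := by
  funext p q σ
  simp only [totalD, simplicialD_add, singularD_add, Pi.add_apply, smul_add]
  abel

/-- The total differential squares to zero. -/
theorem totalD_totalD (c : G.Cochain A) : c.totalD.totalD = 0 := by
  let t : G.Cochain A := fun p q σ => (-1 : ℤ) ^ p • c.singularD p q σ
  have e : c.totalD = c.simplicialD + t := rfl
  funext p q σ
  rw [e, totalD_add]
  have h1 : c.simplicialD.totalD p q σ = (-1 : ℤ) ^ p • c.singularD.simplicialD p q σ := by
    rw [totalD, simplicialD_simplicialD, simplicialD_singularD]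
    exact zero_add _
  -- The sign `(-1)^p` is evaluated one step lower after `∂`, so the two mixed terms cancel.
  have h2 : t.totalD p q σ =
      -((-1 : ℤ) ^ p • c.singularD.simplicialD p q σ) := by
    have h3 : t.singularD p q σ = 0 := by
      match q with
      | 0 => rfl
      | q + 1 =>
        have := congrFun (congrFun (congrFun c.singularD_singularD p) (q + 1)) σ
        change ∑ i : Fin (q + 2), (-1 : ℤ) ^ (i : ℕ) • ((-1 : ℤ) ^ p • c.singularD p q
          (σ.singularFace i)) = 0
        change ∑ i : Fin (q + 2), (-1 : ℤ) ^ (i : ℕ) • c.singularD p q (σ.singularFace i) = 0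
          at this
        simp_rw [smul_comm _ ((-1 : ℤ) ^ p)]
        rw [← Finset.smul_sum, this, smul_zero]
    rw [totalD, h3, smul_zero, add_zero]
    match p with
    | 0 => exact (neg_eq_zero.2 (smul_zero _)).symm
    | p + 1 =>
      change ∑ i : Fin (p + 2), (-1 : ℤ) ^ (i : ℕ) • ((-1 : ℤ) ^ p • c.singularD p q
          (σ.nerveFace i)) = -((-1 : ℤ) ^ (p + 1) • ∑ i : Fin (p + 2), (-1 : ℤ) ^ (i : ℕ) •
            c.singularD p q (σ.nerveFace i))
      simp_rw [smul_comm _ ((-1 : ℤ) ^ p)]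
      rw [← Finset.smul_sum, pow_succ]
      simp
  change c.simplicialD.totalD p q σ + _ = 0
  rw [h1, h2, add_neg_cancel]

end Cochain
end LieGroupoid

/-! ### Locally constant circle cocycles on a normed space. -/

/-- The circle with the discrete topology. -/
def DiscreteCircle : Type := Circle

/-- The underlying point of the circle. -/
def DiscreteCircle.toCircle (s : DiscreteCircle) : Circle := s

instance : TopologicalSpace DiscreteCircle := ⊥

instance : DiscreteTopology DiscreteCircle := ⟨rfl⟩

/-- A locally constant circle-valued cocycle on a normed space is a coboundary. -/
theorem exists_trivialization_of_locally_constant_cocycle {V : Type*} [NormedAddCommGroup V]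
    [NormedSpace ℝ V] (B : V → Set V) (hB : ∀ v, IsOpen (B v)) (hv : ∀ v, v ∈ B v)
    (c : V → V → V → Circle)
    (hconst : ∀ i j, ∀ v ∈ B i ∩ B j, ∀ v' ∈ B i ∩ B j, c i j v = c i j v')
    (hself : ∀ i, ∀ v ∈ B i, c i i v = 1)
    (hcomp : ∀ i j k, ∀ v ∈ B i ∩ B j ∩ B k, c i j v * c j k v = c i k v) :
    ∃ s : V → V → Circle, (∀ i j, ∀ v ∈ B i ∩ B j, s i v * c i j v = s j v) ∧
      ∀ i, ∀ v ∈ B i, ∀ᶠ u in 𝓝 v, s i u = s i v := by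
  -- The cocycle glues a bundle with discrete fibre. Constancy on overlaps is what makes its
  -- coordinate changes continuous although the circle factor is discrete.
  let Z : FiberBundleCore V V DiscreteCircle :=
    { baseSet := B
      isOpen_baseSet := hB
      indexAt := id
      mem_baseSet_at := hv
      coordChange := fun i j v s => s.toCircle * c i j v
      coordChange_self := fun i v h s => by
        change s.toCircle * c i i v = s.toCircle
        rw [hself i v h, mul_one]
      continuousOn_coordChange := by
        intro i j
        rcases (B i ∩ B j).eq_empty_or_nonempty with h | ⟨v₀, h0⟩
        · rw [h, empty_prod]; exact continuousOn_empty _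
        · have hc : Continuous (fun p : V × DiscreteCircle =>
              (show DiscreteCircle from (show Circle from p.2.toCircle * c i j v₀))) :=
            (continuous_of_discreteTopology (f := fun s : DiscreteCircle =>
              (show DiscreteCircle from (show Circle from s.toCircle * c i j v₀)))).comp continuous_snd
          refine hc.continuousOn.congr fun p hp => ?_
          change p.2.toCircle * c i j p.1 = p.2.toCircle * c i j v₀
          rw [hconst i j p.1 hp.1 v₀ h0]
      coordChange_comp := fun i j k v h s => by
        change s.toCircle * c i j v * c j k v = s.toCircle * c i k v
        rw [mul_assoc, hcomp i j k v h] }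
  -- With discrete fibre the bundle is a covering, so the identity of `V` lifts to a global section,
  -- whose coordinates are the required trivialization.
  have cov : IsCoveringMap (Bundle.TotalSpace.proj : Z.TotalSpace → V) :=
    FiberBundle.isCoveringMap (F := DiscreteCircle) (E := Z.Fiber)
  obtain ⟨σ, ⟨-, hσ⟩, -⟩ := cov.existsUnique_continuousMap_lifts (ContinuousMap.id V) (0 : V)
    (⟨0, (1 : Circle)⟩ : Z.TotalSpace) rfl
  have hp : ∀ v, (σ v).proj = v := fun v => congrFun hσ v
  refine ⟨fun i v => DiscreteCircle.toCircle (Z.localTriv i (σ v)).2, fun i j v h => ?_,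
    fun i v h => ?_⟩
  · have h1 : Z.coordChange i j (σ v).proj (Z.coordChange (Z.indexAt (σ v).proj) i (σ v).proj
        (σ v).2) = Z.coordChange (Z.indexAt (σ v).proj) j (σ v).proj (σ v).2 := by
      refine Z.coordChange_comp _ _ _ _ ?_ _
      rw [hp]
      exact ⟨⟨hv v, h.1⟩, h.2⟩
    have h2 : DiscreteCircle.toCircle (Z.localTriv i (σ v)).2 * c i j (σ v).proj =
        DiscreteCircle.toCircle (Z.localTriv j (σ v)).2 := h1
    rw [hp] at h2
    exact h2
  · have hm : σ v ∈ (Z.localTriv i).source := by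
      rw [Z.mem_localTriv_source, hp]; exact h
    have hc : ContinuousAt (fun u => (Z.localTriv i (σ u)).2) v :=
      continuous_snd.continuousAt.comp
        (((Z.localTriv i).continuousAt hm).comp σ.continuous.continuousAt)
    have h1 : ∀ᶠ u in 𝓝 v, (Z.localTriv i (σ v)).2 = (Z.localTriv i (σ u)).2 :=
      hc (by rw [nhds_discrete]; exact Filter.mem_pure.2 rfl)
    exact h1.mono fun u hu => congrArg DiscreteCircle.toCircle hu.symm

/-! ### Lifting maps to the circle bundle with prescribed pullback of `θ`. -/

section Lifts

variable {E₁ ER X₁ R : Type*}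
  [NormedAddCommGroup E₁] [NormedSpace ℝ E₁] [TopologicalSpace X₁] [ChartedSpace E₁ X₁]
  [NormedAddCommGroup ER] [NormedSpace ℝ ER] [TopologicalSpace R] [ChartedSpace ER R]
  [MulAction Circle R] [IsManifold 𝓘(ℝ, E₁) ∞ X₁] [IsManifold 𝓘(ℝ, ER) ∞ R]
  {π : R → X₁} {θ : DForm ER R 1} {om : DForm E₁ X₁ 2}
  {V : Type*} [NormedAddCommGroup V] [NormedSpace ℝ V]

/-- A local section composed with `f` pulls `θ` back to a form with the same differential as `A`. A
primitive of the difference is the angle by which to rotate. As `A` is only `C¹`, no more than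
differentiability of the lift is recorded. -/
theorem IsConnectionForm.exists_local_lift (hθ : IsConnectionForm θ)
    (P : IsPrincipalCircleBundle E₁ ER π) (hcurv : θ.extD = -om.pullback π) {f : V → X₁}
    (hf : ContMDiff 𝓘(ℝ, V) 𝓘(ℝ, E₁) ∞ f) {A : V → V [⋀^Fin 1]→L[ℝ] ℝ} (hA : ContDiff ℝ 1 A)
    (hdA : ∀ v, extDeriv A v = -om.along f v) (v₀ : V) :
    ∃ (B : Set V) (F : V → R), IsOpen B ∧ Convex ℝ B ∧ v₀ ∈ B ∧
      (∀ v ∈ B, MDifferentiableAt 𝓘(ℝ, V) 𝓘(ℝ, ER) F v) ∧ (∀ v ∈ B, π (F v) = f v) ∧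
      ∀ v ∈ B, ∀ w, θ.along F v (fun _ => w) = A v (fun _ => w) := by
  obtain ⟨U, σ, hU, hxU, hσ, hσ'⟩ := P.exists_section (f v₀)
  obtain ⟨ε, hε, hball⟩ := Metric.isOpen_iff.1 (hU.preimage hf.continuous) v₀ hxU
  set B := Metric.ball v₀ ε
  have hB : IsOpen B := Metric.isOpen_ball
  have hs : ContMDiffOn 𝓘(ℝ, V) 𝓘(ℝ, ER) ∞ (fun v => σ (f v)) B :=
    hσ.comp hf.contMDiffOn hball
  have hsd : ∀ v ∈ B, MDifferentiableAt 𝓘(ℝ, V) 𝓘(ℝ, ER) (fun v => σ (f v)) v := fun v hv =>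
    (hs.contMDiffAt (hB.mem_nhds hv)).mdifferentiableAt (by simp)
  have hps : ∀ v ∈ B, π (σ (f v)) = f v := fun v hv => hσ' _ (hball hv)
  have hθs := hθ.smooth.contDiffOn_along hB hs
  have hβ : ContDiffOn ℝ 1 (A - θ.along fun v => σ (f v)) B :=
    hA.contDiffOn.sub (hθs.of_le (by exact_mod_cast le_top))
  obtain ⟨φ, hφ⟩ := exists_primitive_of_closed hB (convex_ball _ _) (by simp) hβ fun v hv => by
    have e : (A - θ.along fun v => σ (f v)) = A + (-1 : ℝ) • θ.along fun v => σ (f v) := by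
      ext u w; simp [sub_eq_add_neg]
    have d1 : DifferentiableAt ℝ (θ.along fun v => σ (f v)) v :=
      (hθs.contDiffAt (hB.mem_nhds hv)).differentiableAt (by simp)
    rw [e, extDeriv_add (hA.differentiable (by simp) v) (d1.const_smul _), extDeriv_smul,
      hdA, hθ.smooth.extDeriv_along hB hs hv, hcurv, DForm.along_neg,
      DForm.along_comp om (P.contMDiff_proj.mdifferentiable (by simp) _) (hsd v hv),
      om.along_congr (Filter.mem_of_superset (hB.mem_nhds hv) hps)]
    simp
  refine ⟨B, fun v => cexp (φ v) • σ (f v), hB, convex_ball _ _, Metric.mem_ball_self hε,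
    fun v hv => ?_, fun v hv => ?_, fun v hv w => ?_⟩
  · exact (P.contMDiff_cexp_smul.mdifferentiable (by simp) _).comp v
      ((hφ v hv).differentiableAt.mdifferentiableAt.prodMk (hsd v hv))
  · rw [P.proj_smul, hps v hv]
  · rw [hθ.along_cexp_smul P (hsd v hv) (hφ v hv).differentiableAt, (hφ v hv).fderiv,
      oneFormCLM_apply]
    change _ + (A v (fun _ => w) - θ.along (fun v => σ (f v)) v (fun _ => w)) = _
    ring

/-- A smooth map into the base of a circle bundle with connection lifts to the total space, with
any prescribed pullback of the connection form that is compatible with the curvature. -/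
theorem IsConnectionForm.exists_lift (hθ : IsConnectionForm θ)
    (P : IsPrincipalCircleBundle E₁ ER π) (hcurv : θ.extD = -om.pullback π) {f : V → X₁}
    (hf : ContMDiff 𝓘(ℝ, V) 𝓘(ℝ, E₁) ∞ f) {A : V → V [⋀^Fin 1]→L[ℝ] ℝ} (hA : ContDiff ℝ 1 A)
    (hdA : ∀ v, extDeriv A v = -om.along f v) :
    ∃ F : V → R, MDifferentiable 𝓘(ℝ, V) 𝓘(ℝ, ER) F ∧ (∀ v, π (F v) = f v) ∧
      ∀ v w, θ.along F v (fun _ => w) = A v (fun _ => w) := by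
  choose B F hB hconv hmem hFd hFπ hFA using hθ.exists_local_lift P hcurv hf hA hdA
  -- Two local lifts with the same pullback of `θ` differ by a constant phase on the convex overlap.
  -- The orientation from `F j` to `F i` is the one for which the rotated lifts `s i • F i` agree.
  obtain ⟨s, hs, hloc⟩ := exists_trivialization_of_locally_constant_cocycle B hB hmem
    (fun i j v => phase (F j v) (F i v))
    (fun i j v hv v' hv' => hθ.exists_smul_eq_of_along_eq P ((hB i).inter (hB j))
      ((hconv i).inter (hconv j)).isPreconnected (fun u hu => hFd j u hu.2)
      (fun u hu => hFd i u hu.1) (fun u hu => (hFπ j u hu.2).trans (hFπ i u hu.1).symm)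
      (fun u hu w => (hFA j u hu.2 w).trans (hFA i u hu.1 w).symm) v hv v' hv')
    (fun i v hv => P.phase_self _)
    (fun i j k v hv => by
      rw [mul_comm]
      exact P.phase_mul_phase ((hFπ k v hv.2).trans (hFπ j v hv.1.2).symm)
        ((hFπ j v hv.1.2).trans (hFπ i v hv.1.1).symm))
  have key : ∀ i, ∀ v ∈ B i, s v v • F v v = s i v • F i v := by
    intro i v hv
    rw [← hs i v v ⟨hv, hmem v⟩, mul_smul,
      P.phase_smul ((hFπ v v (hmem v)).trans (hFπ i v hv).symm)]
  have hev : ∀ i, (fun v => s v v • F v v) =ᶠ[𝓝 i] fun v => s i i • F i v := by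
    intro i
    filter_upwards [(hB i).mem_nhds (hmem i), hloc i i (hmem i)] with v hv h
    rw [key i v hv, h]
  refine ⟨fun v => s v v • F v v, fun i => ?_, fun v => ?_, fun i w => ?_⟩
  · exact MDifferentiableAt.congr_of_eventuallyEq
      (((P.contMDiff_const_smul (s i i)).mdifferentiable (by simp) _).comp i (hFd i i (hmem i)))
      (hev i)
  · rw [P.proj_smul, hFπ v v (hmem v)]
  · rw [θ.along_congr (hev i), ← hFA i i (hmem i) w]
    exact congrArg (fun F : V [⋀^Fin 1]→L[ℝ] ℝ => F (fun _ => w))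
      (hθ.pullback_const_smul P (s i i) (hFd i i (hmem i)))

end Lifts

/-! ### Integration over singular simplices. -/

section IntegrationOnSimplices

open MeasureTheory

/-- The simplex `{e | eᵢ ≥ 0, ∑ eᵢ ≤ 1}` in `ℝ^k`. -/
def cornerSimplex (k : ℕ) : Set (Fin k → ℝ) :=
  {e | (Fin.cons (1 - ∑ i, e i) e : Fin (k + 1) → ℝ) ∈ stdSimplex ℝ (Fin (k + 1))}

/-- The linear part of the affine map `e ↦ (1 - ∑ eᵢ, e₁, …, e_k)`. -/
noncomputable def baryLinear (k : ℕ) : (Fin k → ℝ) →L[ℝ] (Fin (k + 1) → ℝ) :=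
  ContinuousLinearMap.pi (Fin.cons (α := fun _ => (Fin k → ℝ) →L[ℝ] ℝ)
    (-∑ i, ContinuousLinearMap.proj i) fun i => ContinuousLinearMap.proj i)

theorem bary_eq {k : ℕ} (e : Fin k → ℝ) :
    (Fin.cons (1 - ∑ i, e i) e : Fin (k + 1) → ℝ) = Pi.single 0 1 + baryLinear k e := by
  funext j
  refine Fin.cases ?_ (fun i => ?_) j
  · simp [baryLinear, sub_eq_add_neg]
  · simp [baryLinear]

theorem mem_cornerSimplex {k : ℕ} {e : Fin k → ℝ} :
    e ∈ cornerSimplex k ↔ (∀ i, 0 ≤ e i) ∧ ∑ i, e i ≤ 1 := by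
  refine ⟨fun h => ⟨fun i => by simpa using h.1 i.succ, by simpa using h.1 0⟩, fun h => ⟨fun j => ?_, ?_⟩⟩
  · refine Fin.cases ?_ (fun i => ?_) j
    · simpa using h.2
    · simpa using h.1 i
  · simp [Fin.sum_univ_succ]

theorem convex_cornerSimplex (k : ℕ) : Convex ℝ (cornerSimplex k) := by
  intro x hx y hy a b ha hb hab
  rw [mem_cornerSimplex] at *
  refine ⟨fun i => ?_, ?_⟩
  · exact add_nonneg (mul_nonneg ha (hx.1 i)) (mul_nonneg hb (hy.1 i))
  · have : ∑ i, (a • x + b • y) i = a * ∑ i, x i + b * ∑ i, y i := by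
      simp [Finset.sum_add_distrib, Finset.mul_sum]
    rw [this]
    nlinarith [hx.2, hy.2]

theorem isCompact_cornerSimplex (k : ℕ) : IsCompact (cornerSimplex k) := by
  refine (isCompact_univ_pi fun _ : Fin k => isCompact_Icc (a := (0 : ℝ)) (b := 1)).of_isClosed_subset
    ?_ fun e he i _ => ?_
  · have : cornerSimplex k = (fun e => (Pi.single 0 1 + baryLinear k e : Fin (k + 1) → ℝ)) ⁻¹'
        stdSimplex ℝ (Fin (k + 1)) := by
      ext e; rw [mem_preimage, ← bary_eq]; rfl
    rw [this]
    exact (isClosed_stdSimplex _ _).preimage (by fun_prop)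
  · rw [mem_cornerSimplex] at he
    exact ⟨he.1 i, (Finset.single_le_sum (f := e) (fun j _ => he.1 j) (Finset.mem_univ i)).trans he.2⟩

theorem cornerSimplex_ae_eq (k : ℕ) :
    interior (cornerSimplex k) =ᵐ[volume] cornerSimplex k :=
  interior_ae_eq_of_null_frontier ((convex_cornerSimplex k).addHaar_frontier _)

variable {E M : Type*} [NormedAddCommGroup E] [NormedSpace ℝ E] [TopologicalSpace M]
  [ChartedSpace E M] {k n : ℕ}

/-- The integral over a singular simplex only depends on the integrand in the interior. -/
theorem integrate_eq_of_interior (α : DForm E M k) {c : stdSimplex ℝ (Fin (k + 1)) → M}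
    {g : (Fin k → ℝ) → ℝ}
    (h : ∀ e ∈ interior (cornerSimplex k), ∀ F : (Fin k → ℝ) → M,
      (∀ᶠ e' in 𝓝 e, ∃ hm, F e' = c ⟨Pi.single 0 1 + baryLinear k e', hm⟩) →
      α.along F e (fun i => Pi.single i 1) = g e) :
    LieGroupoid.integrate α c = ∫ e in cornerSimplex k, g e := by
  classical
  unfold LieGroupoid.integrate
  change ∫ e in cornerSimplex k, _ = _
  -- The extension by a constant outside the simplex has meaningless derivatives on the boundary,
  -- but the boundary of a convex set is null.
  rw [← setIntegral_congr_set (cornerSimplex_ae_eq k),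
    ← setIntegral_congr_set (cornerSimplex_ae_eq k)]
  refine setIntegral_congr_fun isOpen_interior.measurableSet fun e he => h e he _ ?_
  filter_upwards [isOpen_interior.mem_nhds he] with e' he'
  have h1 : (Fin.cons (1 - ∑ i, e' i) e' : Fin (k + 1) → ℝ) ∈ stdSimplex ℝ (Fin (k + 1)) :=
    interior_subset (s := cornerSimplex k) he'
  have h2 : (Pi.single 0 1 + baryLinear k e' : Fin (k + 1) → ℝ) ∈ stdSimplex ℝ (Fin (k + 1)) := by
    rw [← bary_eq]; exact h1
  refine ⟨h2, (dif_pos h1).trans (congrArg c (Subtype.ext (bary_eq e')))⟩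

/-- A map from the standard simplex that extends locally to smooth maps of the ambient space. -/
def LocallyExtends (E : Type*) {M : Type*} [NormedAddCommGroup E] [NormedSpace ℝ E]
    [TopologicalSpace M] [ChartedSpace E M] {n : ℕ} (c : stdSimplex ℝ (Fin (n + 1)) → M) : Prop :=
  ∀ x : stdSimplex ℝ (Fin (n + 1)), ∃ (U : Set (Fin (n + 1) → ℝ)) (g : (Fin (n + 1) → ℝ) → M),
    IsOpen U ∧ x.1 ∈ U ∧ ContMDiffOn 𝓘(ℝ, Fin (n + 1) → ℝ) 𝓘(ℝ, E) ∞ g U ∧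
    ∀ y : stdSimplex ℝ (Fin (n + 1)), y.1 ∈ U → g y.1 = c y

/-- The pullback of a form along a locally extendable map is represented by a continuous form on
the ambient space. -/
theorem LocallyExtends.exists_form [IsManifold 𝓘(ℝ, E) ∞ M] {α : DForm E M k} (hα : α.IsSmooth)
    {c : stdSimplex ℝ (Fin (n + 1)) → M} (hc : LocallyExtends E c) :
    ∃ B : (Fin (n + 1) → ℝ) → (Fin (n + 1) → ℝ) [⋀^Fin k]→L[ℝ] ℝ, Continuous B ∧
      ∀ (V : Type) [NormedAddCommGroup V] [NormedSpace ℝ V] (A : V →L[ℝ] (Fin (n + 1) → ℝ))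
        (p : Fin (n + 1) → ℝ) (e : V) (h : V → M), (∀ᶠ e' in 𝓝 e, ∃ hm, h e' = c ⟨p + A e', hm⟩) →
        ∀ w, α.along h e w = B (p + A e) (fun i => A (w i)) := by
  -- `t x` collects the values at `x` that compute the pullback along every affine map into the
  -- simplex. It is convex, so pullbacks along the local extensions can be glued by a partition of
  -- unity.
  let t : (Fin (n + 1) → ℝ) → Set ((Fin (n + 1) → ℝ) [⋀^Fin k]→L[ℝ] ℝ) := fun x =>
    {b | ∀ (V : Type) [NormedAddCommGroup V] [NormedSpace ℝ V] (A : V →L[ℝ] (Fin (n + 1) → ℝ))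
        (p : Fin (n + 1) → ℝ) (e : V) (h : V → M), x = p + A e → (∀ᶠ e' in 𝓝 e, ∃ hm, h e' = c ⟨p + A e', hm⟩) →
        ∀ w, α.along h e w = b (fun i => A (w i))}
  have ht : ∀ x, Convex ℝ (t x) := by
    intro x b hb b' hb' u v hu hv huv V _ _ A p e h hx hh w
    change _ = u * b (fun i => A (w i)) + v * b' (fun i => A (w i))
    rw [← hb V A p e h hx hh w, ← hb' V A p e h hx hh w, ← add_mul, huv, one_mul]
  obtain ⟨B, hB⟩ := exists_contMDiffMap_forall_mem_convex_of_local 𝓘(ℝ, Fin (n + 1) → ℝ) (n := ⊤)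
    ht (fun x => by
      by_cases hx : x ∈ stdSimplex ℝ (Fin (n + 1))
      · obtain ⟨U, g, hU, hxU, hg, hgc⟩ := hc ⟨x, hx⟩
        refine ⟨U, hU.mem_nhds hxU, α.along g, (hα.contDiffOn_along hU hg).contMDiffOn, ?_⟩
        rintro _ hy V _ _ A p e h rfl hh w
        have hAe : HasFDerivAt (fun e' => p + A e') A e := A.hasFDerivAt.const_add p
        have hgd : MDifferentiableAt 𝓘(ℝ, Fin (n + 1) → ℝ) 𝓘(ℝ, E) g (p + A e) :=
          (hg.contMDiffAt (hU.mem_nhds hy)).mdifferentiableAt (by simp)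
        have ev : h =ᶠ[𝓝 e] g ∘ fun e' => p + A e' := by
          have hUe : ∀ᶠ e' in 𝓝 e, p + A e' ∈ U :=
            hAe.continuousAt.preimage_mem_nhds (hU.mem_nhds hy)
          filter_upwards [hh, hUe] with e' ⟨hm, h1⟩ h2
          exact h1.trans (hgc ⟨_, hm⟩ h2).symm
        have e1 : α.along h e w = DForm.pullback (EP := V)
            (fun e' => p + A e') (DForm.pullback (EP := Fin (n + 1) → ℝ) g α) e w := by
          rw [DForm.along_congr α ev]
          exact (congrArg (fun F : V [⋀^Fin k]→L[ℝ] ℝ => F w)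
            (DForm.pullback_comp_apply α (f := g) (g := fun e' => p + A e') hgd
              hAe.differentiableAt.mdifferentiableAt)).symm
        have e2 : mfderiv 𝓘(ℝ, V) 𝓘(ℝ, Fin (n + 1) → ℝ) (fun e' => p + A e') e = A := by
          rw [mfderiv_eq_fderiv, hAe.fderiv]
        exact e1.trans (congrArg (fun L : V →L[ℝ] (Fin (n + 1) → ℝ) =>
          α.along g (p + A e) fun i => L (w i)) e2)
      -- Off the closed simplex the condition is vacuous.
      · refine ⟨_, (isClosed_stdSimplex ℝ (Fin (n + 1))).isOpen_compl.mem_nhds hx, fun _ => 0,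
          contMDiffOn_const, ?_⟩
        rintro _ hy V _ _ A p e h rfl hh w
        exact absurd hh.self_of_nhds.1 hy)
  exact ⟨B, B.contMDiff.continuous, fun V _ _ A p e h hh w => hB _ V A p e h rfl hh w⟩

theorem LocallyExtends.mdifferentiableAt {c : stdSimplex ℝ (Fin (n + 1)) → M}
    (hc : LocallyExtends E c) {V : Type*} [NormedAddCommGroup V] [NormedSpace ℝ V]
    (A : V →L[ℝ] (Fin (n + 1) → ℝ)) (p : Fin (n + 1) → ℝ) {e : V} {h : V → M}
    (hh : ∀ᶠ e' in 𝓝 e, ∃ hm, h e' = c ⟨p + A e', hm⟩) :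
    MDifferentiableAt 𝓘(ℝ, V) 𝓘(ℝ, E) h e := by
  obtain ⟨U, g, hU, hxU, hg, hgc⟩ := hc ⟨p + A e, hh.self_of_nhds.1⟩
  have hAe : HasFDerivAt (fun e' => p + A e') A e := A.hasFDerivAt.const_add p
  have hgd : MDifferentiableAt 𝓘(ℝ, Fin (n + 1) → ℝ) 𝓘(ℝ, E) g (p + A e) :=
    (hg.contMDiffAt (hU.mem_nhds hxU)).mdifferentiableAt (by simp)
  refine MDifferentiableAt.congr_of_eventuallyEq (hgd.comp e (f := fun e' => p + A e')
    hAe.differentiableAt.mdifferentiableAt) ?_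
  filter_upwards [hh, hAe.continuousAt.preimage_mem_nhds (hU.mem_nhds hxU)] with e' ⟨hm, h1⟩ h2
  exact h1.trans (hgc ⟨_, hm⟩ h2).symm

/-- The integral of a form over an affine singular simplex in a locally extendable simplex. -/
theorem LocallyExtends.exists_integrate_eq [IsManifold 𝓘(ℝ, E) ∞ M] {α : DForm E M k}
    (hα : α.IsSmooth) {c : stdSimplex ℝ (Fin (n + 1)) → M} (hc : LocallyExtends E c) :
    ∃ B : (Fin (n + 1) → ℝ) → (Fin (n + 1) → ℝ) [⋀^Fin k]→L[ℝ] ℝ, Continuous B ∧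
      ∀ (p : Fin (n + 1) → ℝ) (A : (Fin (k + 1) → ℝ) →L[ℝ] (Fin (n + 1) → ℝ))
        (h : ∀ x ∈ stdSimplex ℝ (Fin (k + 1)), p + A x ∈ stdSimplex ℝ (Fin (n + 1))),
        LieGroupoid.integrate α (fun x => c ⟨p + A x.1, h x.1 x.2⟩) =
          ∫ e in cornerSimplex k, B (p + A (Pi.single 0 1 + baryLinear k e))
            (fun i => A (baryLinear k (Pi.single i 1))) := by
  obtain ⟨B, hB, h⟩ := hc.exists_form hα
  refine ⟨B, hB, fun p A hA => integrate_eq_of_interior α fun e he F hF => ?_⟩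
  have h1 := h _ (A.comp (baryLinear k)) (p + A (Pi.single 0 1)) e F (by
    filter_upwards [hF] with e' ⟨hm, h2⟩
    have e3 : p + A (Pi.single 0 1 + baryLinear k e') =
        p + A (Pi.single 0 1) + (A.comp (baryLinear k)) e' := by
      rw [map_add, add_assoc]; rfl
    exact ⟨e3 ▸ hA _ hm, h2.trans (congrArg c (Subtype.ext e3))⟩) fun i => Pi.single i 1
  refine h1.trans ?_
  rw [map_add, ← add_assoc]
  rfl

theorem continuous_integral_affine {T : Type*} [TopologicalSpace T]
    {B : (Fin (n + 1) → ℝ) → (Fin (n + 1) → ℝ) [⋀^Fin k]→L[ℝ] ℝ} (hB : Continuous B)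
    {p : T → Fin (n + 1) → ℝ} {A : T → (Fin (k + 1) → ℝ) →L[ℝ] (Fin (n + 1) → ℝ)}
    (hp : Continuous p) (hA : Continuous A) [FirstCountableTopology T] [LocallyCompactSpace T] :
    Continuous fun t => ∫ e in cornerSimplex k, B (p t + A t (Pi.single 0 1 + baryLinear k e))
      (fun i => A t (baryLinear k (Pi.single i 1))) := by
  refine continuous_parametric_integral_of_continuous ?_ (isCompact_cornerSimplex k)
  have h1 : Continuous fun q : T × (Fin k → ℝ) =>
      p q.1 + A q.1 (Pi.single 0 1 + baryLinear k q.2) := by fun_prop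
  have h2 : Continuous fun q : T × (Fin k → ℝ) =>
      fun i : Fin k => A q.1 (baryLinear k (Pi.single i 1)) := by fun_prop
  exact continuous_eval.comp ((hB.comp h1).prodMk h2)

end IntegrationOnSimplices

/-! ### Contracting simplices: the coboundary of the de Rham cochain. -/

namespace LieGroupoid

variable {E₀ E₁ X₀ X₁ : Type*}
  [NormedAddCommGroup E₀] [NormedSpace ℝ E₀] [TopologicalSpace X₀] [ChartedSpace E₀ X₀]
  [NormedAddCommGroup E₁] [NormedSpace ℝ E₁] [TopologicalSpace X₁] [ChartedSpace E₁ X₁]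
  {G : LieGroupoid E₀ E₁ X₀ X₁} {p q n : ℕ}

namespace SingularSimplex

/-- The restriction of a singular simplex along an affine map of standard simplices. -/
def affinePull (σ : G.SingularSimplex p n) (v : Fin (n + 1) → ℝ)
    (A : (Fin (q + 1) → ℝ) →L[ℝ] (Fin (n + 1) → ℝ))
    (h : ∀ x ∈ stdSimplex ℝ (Fin (q + 1)), v + A x ∈ stdSimplex ℝ (Fin (n + 1))) :
    G.SingularSimplex p q where
  toFun x := σ.toFun ⟨v + A x.1, h x.1 x.2⟩
  smooth i j := by
    obtain ⟨f, hf, hfσ⟩ := σ.smooth i j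
    refine ⟨fun x => f (v + A x), hf.comp ?_, fun x => hfσ ⟨v + A x.1, h x.1 x.2⟩⟩
    exact (contDiff_const.add A.contDiff).contMDiff

theorem locallyExtends_arr (σ : G.SingularSimplex p n) (i j : Fin (p + 1)) :
    LocallyExtends E₁ fun x => (σ.toFun x).arr i j := by
  obtain ⟨f, hf, h⟩ := σ.smooth i j
  exact fun x => ⟨univ, f, isOpen_univ, mem_univ _, hf.contMDiffOn, fun y _ => h y⟩

variable [IsManifold 𝓘(ℝ, E₀) ∞ X₀] [IsManifold 𝓘(ℝ, E₁) ∞ X₁]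

/-- The ambient extensions `f` and `g` of the two components need not be composable off the simplex.
In a chart of `X₂`, however, only the coordinates of `f` and the complementary coordinates of `g`
are used, and these always describe a composable pair. -/
theorem locallyExtends_toPair (σ : G.SingularSimplex 2 n) :
    LocallyExtends G.PairsModel fun x => (σ.toFun x).toPair := by
  intro x
  obtain ⟨f, hf, hfσ⟩ := σ.smooth 0 1
  obtain ⟨g, hg, hgσ⟩ := σ.smooth 1 2
  set a : G.Pairs := (σ.toFun x).toPair
  let W : Set (Fin (n + 1) → ℝ) :=
    f ⁻¹' (chartAt E₁ a.fst).source ∩ g ⁻¹' a.sub.domChart.source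
  have hW : IsOpen W := ((chartAt E₁ a.fst).open_source.preimage hf.continuous).inter
    (a.sub.domChart.open_source.preimage hg.continuous)
  let u : (Fin (n + 1) → ℝ) → G.PairsModel := fun y =>
    (chartAt E₁ a.fst (f y), (a.sub.equiv (a.sub.domChart (g y))).2)
  have hu : ContMDiffOn 𝓘(ℝ, Fin (n + 1) → ℝ) 𝓘(ℝ, G.PairsModel) ∞ u W := by
    have h3 : ContMDiffOn 𝓘(ℝ, Fin (n + 1) → ℝ) 𝓘(ℝ, E₁) ∞ (fun y => chartAt E₁ a.fst (f y)) W :=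
      (contMDiffOn_chart (x := a.fst)).comp hf.contMDiffOn fun y hy => hy.1
    have h4 : ContMDiffOn 𝓘(ℝ, Fin (n + 1) → ℝ) 𝓘(ℝ, E₁) ∞ (fun y => a.sub.domChart (g y)) W :=
      (contMDiffOn_of_mem_maximalAtlas a.sub.domChart_mem_maximalAtlas).comp hg.contMDiffOn
        fun y hy => hy.2
    exact h3.prodMk_space ((contDiff_snd.comp a.sub.equiv.contDiff).contMDiff.comp_contMDiffOn h4)
  have hsrc : ∀ y : stdSimplex ℝ (Fin (n + 1)), y.1 ∈ W →
      (σ.toFun y).toPair ∈ (chartAt G.PairsModel a).source := fun y hy =>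
    ⟨(congrArg (· ∈ (chartAt E₁ a.fst).source) (hfσ y)).mp hy.1,
      (congrArg (· ∈ a.sub.domChart.source) (hgσ y)).mp hy.2⟩
  have huc : ∀ y : stdSimplex ℝ (Fin (n + 1)), u y.1 = chartAt G.PairsModel a (σ.toFun y).toPair :=
    fun y => Prod.ext (congrArg (chartAt E₁ a.fst) (hfσ y))
      (congrArg (fun z => (a.sub.equiv (a.sub.domChart z)).2) (hgσ y))
  have hxW : x.1 ∈ W := ⟨(congrArg (· ∈ (chartAt E₁ a.fst).source) (hfσ x)).mpr
      (mem_chart_source E₁ a.fst),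
    (congrArg (· ∈ a.sub.domChart.source) (hgσ x)).mpr a.sub.mem_domChart_source⟩
  refine ⟨W ∩ u ⁻¹' (chartAt G.PairsModel a).target, (chartAt G.PairsModel a).symm ∘ u,
    hu.continuousOn.isOpen_inter_preimage hW (chartAt G.PairsModel a).open_target, ⟨hxW, ?_⟩,
    (contMDiffOn_chart_symm (x := a)).comp (hu.mono inter_subset_left) fun y hy => hy.2,
    fun y hy => ?_⟩
  · rw [mem_preimage, huc]
    exact (chartAt G.PairsModel a).map_source (hsrc x hxW)
  · rw [Function.comp_apply, huc]
    exact (chartAt G.PairsModel a).left_inv (hsrc y hy.1)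

end SingularSimplex

variable [IsManifold 𝓘(ℝ, E₀) ∞ X₀] [IsManifold 𝓘(ℝ, E₁) ∞ X₁]
  {η : DForm G.PairsModel G.Pairs 1} {om : DForm E₁ X₁ 2}

theorem continuous_deRhamCochain_affinePull (hη : η.IsSmooth) (hom : om.IsSmooth)
    {T : Type*} [TopologicalSpace T] [FirstCountableTopology T] [LocallyCompactSpace T] (p q : ℕ)
    (σ : G.SingularSimplex p n)
    {v : T → Fin (n + 1) → ℝ} {A : T → (Fin (q + 1) → ℝ) →L[ℝ] (Fin (n + 1) → ℝ)}
    (hv : Continuous v) (hA : Continuous A)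
    (h : ∀ t, ∀ x ∈ stdSimplex ℝ (Fin (q + 1)), v t + A t x ∈ stdSimplex ℝ (Fin (n + 1))) :
    Continuous fun t => G.deRhamCochain η om p q (σ.affinePull (v t) (A t) (h t)) := by
  rcases p with _ | _ | _ | p <;> rcases q with _ | _ | _ | q <;> try exact continuous_const
  · obtain ⟨B, hB, hi⟩ := (σ.locallyExtends_arr 0 1).exists_integrate_eq hom
    refine (continuous_integral_affine hB hv hA).congr fun t => ?_
    exact (hi (v t) (A t) (h t)).symm
  · obtain ⟨B, hB, hi⟩ := σ.locallyExtends_toPair.exists_integrate_eq hη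
    refine (continuous_integral_affine hB hv hA).congr fun t => ?_
    exact (hi (v t) (A t) (h t)).symm

/-- A constant simplex has zero derivative, and both forms have positive degree. -/
theorem deRhamCochain_affinePull_zero (hη : η.IsSmooth) (hom : om.IsSmooth) (p q : ℕ)
    (σ : G.SingularSimplex p n) {v : Fin (n + 1) → ℝ}
    {A : (Fin (q + 1) → ℝ) →L[ℝ] (Fin (n + 1) → ℝ)} (hA : A = 0)
    (h : ∀ x ∈ stdSimplex ℝ (Fin (q + 1)), v + A x ∈ stdSimplex ℝ (Fin (n + 1))) :
    G.deRhamCochain η om p q (σ.affinePull v A h) = 0 := by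
  subst hA
  rcases p with _ | _ | _ | p <;> rcases q with _ | _ | _ | q <;> try rfl
  · obtain ⟨B, hB, hi⟩ := (σ.locallyExtends_arr 0 1).exists_integrate_eq hom
    refine (hi v 0 h).trans (MeasureTheory.integral_eq_zero_of_ae (.of_forall fun e => ?_))
    exact ContinuousAlternatingMap.map_coord_zero _ (0 : Fin 2) rfl
  · obtain ⟨B, hB, hi⟩ := σ.locallyExtends_toPair.exists_integrate_eq hη
    refine (hi v 0 h).trans (MeasureTheory.integral_eq_zero_of_ae (.of_forall fun e => ?_))
    exact ContinuousAlternatingMap.map_coord_zero _ (0 : Fin 1) rfl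

/-- The `i`-th coface of the standard simplex as a linear map. -/
def cofaceCLM {q : ℕ} (i : Fin (q + 2)) : (Fin (q + 1) → ℝ) →L[ℝ] (Fin (q + 2) → ℝ) :=
  ContinuousLinearMap.pi (i.insertNth (α := fun _ => (Fin (q + 1) → ℝ) →L[ℝ] ℝ) 0
    fun j => ContinuousLinearMap.proj j)

theorem cofaceCLM_apply {q : ℕ} (i : Fin (q + 2)) (x : Fin (q + 1) → ℝ) :
    cofaceCLM i x = i.insertNth (α := fun _ => ℝ) 0 x := by
  funext j
  refine Fin.succAboveCases i ?_ (fun k => ?_) j <;> simp [cofaceCLM]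

theorem cofaceCLM_mem {q : ℕ} (i : Fin (q + 2)) {x : Fin (q + 1) → ℝ}
    (hx : x ∈ stdSimplex ℝ (Fin (q + 1))) : cofaceCLM i x ∈ stdSimplex ℝ (Fin (q + 2)) := by
  rw [cofaceCLM_apply]
  exact (simplexCoface i ⟨x, hx⟩).2

theorem SingularSimplex.singularFace_affinePull (σ : G.SingularSimplex p n) (i : Fin (q + 2))
    (v : Fin (n + 1) → ℝ) (A : (Fin (q + 2) → ℝ) →L[ℝ] (Fin (n + 1) → ℝ))
    (h : ∀ x ∈ stdSimplex ℝ (Fin (q + 2)), v + A x ∈ stdSimplex ℝ (Fin (n + 1))) :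
    (σ.affinePull v A h).singularFace i =
      σ.affinePull v (A.comp (cofaceCLM i)) (fun x hx =>
        show v + A.comp (cofaceCLM i) x ∈ _ from h _ (cofaceCLM_mem i hx)) := by
  refine SingularSimplex.ext (funext fun x => congrArg σ.toFun (Subtype.ext ?_))
  exact congrArg (fun y => v + A y) (cofaceCLM_apply i x.1).symm

theorem continuous_totalD_deRhamCochain (hη : η.IsSmooth) (hom : om.IsSmooth)
    {T : Type*} [TopologicalSpace T] [FirstCountableTopology T] [LocallyCompactSpace T] (p q : ℕ)
    (σ : G.SingularSimplex p n)
    {v : T → Fin (n + 1) → ℝ} {A : T → (Fin (q + 1) → ℝ) →L[ℝ] (Fin (n + 1) → ℝ)}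
    (hv : Continuous v) (hA : Continuous A)
    (h : ∀ t, ∀ x ∈ stdSimplex ℝ (Fin (q + 1)), v t + A t x ∈ stdSimplex ℝ (Fin (n + 1))) :
    Continuous fun t => (G.deRhamCochain η om).totalD p q (σ.affinePull (v t) (A t) (h t)) := by
  suffices h2 : Continuous (fun t =>
      (G.deRhamCochain η om).simplicialD p q (σ.affinePull (v t) (A t) (h t))) ∧
      Continuous fun t => (G.deRhamCochain η om).singularD p q (σ.affinePull (v t) (A t) (h t)) from
    h2.1.add (h2.2.const_smul ((-1 : ℤ) ^ p))
  refine ⟨?_, ?_⟩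
  · rcases p with - | p
    · exact continuous_const
    · exact continuous_finsetSum _ fun i _ => (continuous_deRhamCochain_affinePull hη hom p q
        (σ.nerveFace i) hv hA h).const_smul ((-1 : ℤ) ^ (i : ℕ))
  · rcases q with - | q
    · exact continuous_const
    · refine continuous_finsetSum _ fun i _ => ?_
      have h1 := continuous_deRhamCochain_affinePull (A := fun t => (A t).comp (cofaceCLM i))
        hη hom p q σ hv (by fun_prop) (fun t x hx => h t _ (cofaceCLM_mem i hx))
      refine (h1.const_smul ((-1 : ℤ) ^ (i : ℕ))).congr fun t => ?_
      exact congrArg (fun τ => (-1 : ℤ) ^ (i : ℕ) • G.deRhamCochain η om p q τ)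
        (σ.singularFace_affinePull i (v t) (A t) (h t)).symm

theorem totalD_deRhamCochain_zero (hη : η.IsSmooth) (hom : om.IsSmooth) (p q : ℕ)
    (σ : G.SingularSimplex p n) {v : Fin (n + 1) → ℝ}
    {A : (Fin (q + 1) → ℝ) →L[ℝ] (Fin (n + 1) → ℝ)} (hA : A = 0)
    (h : ∀ x ∈ stdSimplex ℝ (Fin (q + 1)), v + A x ∈ stdSimplex ℝ (Fin (n + 1))) :
    (G.deRhamCochain η om).totalD p q (σ.affinePull v A h) = 0 := by
  have h1 : (G.deRhamCochain η om).simplicialD p q (σ.affinePull v A h) = 0 := by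
    rcases p with - | p
    · rfl
    · refine Finset.sum_eq_zero fun i _ => ?_
      have := deRhamCochain_affinePull_zero hη hom p q (σ.nerveFace i) hA h
      exact (congrArg ((-1 : ℤ) ^ (i : ℕ) • ·) this).trans (smul_zero _)
  have h2 : (G.deRhamCochain η om).singularD p q (σ.affinePull v A h) = 0 := by
    rcases q with - | q
    · rfl
    · refine Finset.sum_eq_zero fun i _ => ?_
      have h3 := deRhamCochain_affinePull_zero hη hom p q σ (v := v) (A := A.comp (cofaceCLM i))
        (by rw [hA]; rfl) fun x hx => h _ (cofaceCLM_mem i hx)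
      rw [SingularSimplex.singularFace_affinePull]
      exact (congrArg ((-1 : ℤ) ^ (i : ℕ) • ·) h3).trans (smul_zero _)
  rw [Cochain.totalD, h1, h2, smul_zero, add_zero]

/-- If the coboundary of the de Rham cochain of smooth forms takes integer values, it vanishes:
every simplex can be contracted to a constant one. -/
theorem totalD_deRhamCochain_eq_zero (hη : η.IsSmooth) (hom : om.IsSmooth)
    (hint : ∀ p q (σ : G.SingularSimplex p q), ∃ m : ℤ,
      (G.deRhamCochain η om).totalD p q σ = m) : (G.deRhamCochain η om).totalD = 0 := by
  funext p q σ
  -- The affine contraction of the simplex to its vertex `0`: all of `σ` at `t = 1`, a constant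
  -- simplex at `t = 0`.
  let v : unitInterval → Fin (q + 1) → ℝ := fun t => (1 - (t : ℝ)) • Pi.single 0 1
  let A : unitInterval → (Fin (q + 1) → ℝ) →L[ℝ] (Fin (q + 1) → ℝ) := fun t =>
    (t : ℝ) • ContinuousLinearMap.id ℝ _
  have h : ∀ t, ∀ x ∈ stdSimplex ℝ (Fin (q + 1)), v t + A t x ∈ stdSimplex ℝ (Fin (q + 1)) :=
    fun t x hx => (convex_stdSimplex ℝ _) (single_mem_stdSimplex ℝ 0) hx
      (sub_nonneg.2 t.2.2) t.2.1 (by ring)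
  have hc := continuous_totalD_deRhamCochain hη hom p q σ (v := v) (A := A) (by fun_prop)
    (by fun_prop) h
  choose m hm using fun t => hint p q (σ.affinePull (v t) (A t) (h t))
  -- A continuous integer-valued function on the interval is constant, so the value at `σ` equals
  -- the value `0` at the constant simplex.
  have hmc : Continuous m := by
    rw [Int.isClosedEmbedding_coe_real.isInducing.continuous_iff]
    exact hc.congr hm
  have h01 : m 1 = m 0 := PreconnectedSpace.constant inferInstance hmc
  have h0 : (m 0 : ℝ) = 0 := by
    rw [← hm]
    exact totalD_deRhamCochain_zero hη hom p q σ (by simp [A]) _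
  have h1 : σ.affinePull (v 1) (A 1) (h 1) = σ :=
    SingularSimplex.ext (funext fun x => congrArg σ.toFun (Subtype.ext (by simp [v, A])))
  have h2 := hm 1
  rw [h1, h01, h0] at h2
  exact h2

end LieGroupoid

/-! ### Lifts of paths. -/

section HorizontalLifts

variable {E₁ ER X₁ R : Type*}
  [NormedAddCommGroup E₁] [NormedSpace ℝ E₁] [TopologicalSpace X₁] [ChartedSpace E₁ X₁]
  [NormedAddCommGroup ER] [NormedSpace ℝ ER] [TopologicalSpace R] [ChartedSpace ER R]
  [MulAction Circle R] [IsManifold 𝓘(ℝ, E₁) ∞ X₁] [IsManifold 𝓘(ℝ, ER) ∞ R]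
  {π : R → X₁} {θ : DForm ER R 1} {om : DForm E₁ X₁ 2}

/-- `F` lifts the path `γ : [0, 1] → X₁` to the total space of a circle bundle, with
`F^* θ = a(e) de`. -/
structure IsPathLift (π : R → X₁) (θ : DForm ER R 1) (γ : ℝ → X₁) (a : ℝ → ℝ) (F : ℝ → R) :
    Prop where
  continuousOn : ContinuousOn F (Icc 0 1)
  proj : ∀ e ∈ Icc (0 : ℝ) 1, π (F e) = γ e
  mdifferentiableAt : ∀ e ∈ Ioo (0 : ℝ) 1, MDifferentiableAt 𝓘(ℝ, ℝ) 𝓘(ℝ, ER) F e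
  along_eq : ∀ e ∈ Ioo (0 : ℝ) 1, θ.along F e (fun _ => 1) = a e

namespace IsPathLift

variable {γ : ℝ → X₁} {a : ℝ → ℝ} {F H : ℝ → R}

theorem const_smul (hF : IsPathLift π θ γ a F) (P : IsPrincipalCircleBundle E₁ ER π)
    (hθ : IsConnectionForm θ) (s : Circle) : IsPathLift π θ γ a fun e => s • F e where
  continuousOn := (P.contMDiff_const_smul s).continuous.comp_continuousOn hF.continuousOn
  proj e he := by rw [P.proj_smul, hF.proj e he]
  mdifferentiableAt e he :=
    ((P.contMDiff_const_smul s).mdifferentiable (by simp) _).comp e (hF.mdifferentiableAt e he)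
  along_eq e he := by
    rw [← hF.along_eq e he]
    exact congrArg (fun F : ℝ [⋀^Fin 1]→L[ℝ] ℝ => F (fun _ => 1))
      (hθ.pullback_const_smul P s (hF.mdifferentiableAt e he))

/-- Two lifts of a path with the same pullback of the connection form differ by a constant. -/
theorem eq_smul (hF : IsPathLift π θ γ a F) (hH : IsPathLift π θ γ a H)
    (P : IsPrincipalCircleBundle E₁ ER π) (hθ : IsConnectionForm θ) {s : Circle}
    (h0 : F 0 = s • H 0) : F 1 = s • H 1 := by
  have hπ : ∀ e ∈ Icc (0 : ℝ) 1, π (H e) = π (F e) := fun e he =>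
    (hH.proj e he).trans (hF.proj e he).symm
  have hc : ContinuousOn (fun e => phase (H e) (F e)) (Icc 0 1) := fun e he =>
    P.continuousWithinAt_phase (hH.continuousOn e he) (hF.continuousOn e he) he hπ
  have hconst := hθ.exists_smul_eq_of_along_eq P (F := H) (G := F) (isOpen_Ioo (a := (0 : ℝ)) (b := 1))
    isPreconnected_Ioo (fun v hv => hH.mdifferentiableAt v hv)
    (fun v hv => hF.mdifferentiableAt v hv) (fun v hv => hπ v (Ioo_subset_Icc_self hv))
    (fun v hv w => by
      have hlin : ∀ K : ℝ [⋀^Fin 1]→L[ℝ] ℝ, K (fun _ => w) = w * K (fun _ => 1) := fun K => by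
        have := K.map_smul_univ (fun _ => w) (fun _ => 1)
        simpa using this
      rw [hlin, hlin (θ.along F v), hH.along_eq v hv, hF.along_eq v hv])
  have hm : (1 / 2 : ℝ) ∈ Ioo (0 : ℝ) 1 := by norm_num
  -- The phase is constant on the open interval, where the lifts are differentiable; continuity
  -- extends this to the endpoints.
  have hall : ∀ e ∈ Icc (0 : ℝ) 1, phase (H e) (F e) = phase (H (1 / 2)) (F (1 / 2)) := by
    have hcl : closure (Ioo (0 : ℝ) 1) = Icc 0 1 := closure_Ioo (by norm_num)
    have : EqOn (fun e => phase (H e) (F e)) (fun _ => phase (H (1 / 2)) (F (1 / 2)))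
        (closure (Ioo (0 : ℝ) 1)) :=
      EqOn.of_subset_closure (s := Ioo 0 1) (t := closure (Ioo 0 1))
        (fun e he => hconst e he _ hm) (by rw [hcl]; exact hc) continuousOn_const
        subset_closure subset_rfl
    rw [hcl] at this
    exact this
  have i0 : (0 : ℝ) ∈ Icc (0 : ℝ) 1 := by norm_num
  have i1 : (1 : ℝ) ∈ Icc (0 : ℝ) 1 := by norm_num
  have h2 : phase (H 0) (F 0) = s := P.phase_eq h0.symm
  rw [← h2, hall 0 i0, ← hall 1 i1, P.phase_smul (hπ 1 i1)]

/-- The endpoint of a lift compared with the endpoint of a horizontal lift. -/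
theorem eq_cexp_smul (hF : IsPathLift π θ γ a F) (ha : Continuous a) (hH : IsPathLift π θ γ 0 H)
    (P : IsPrincipalCircleBundle E₁ ER π) (hθ : IsConnectionForm θ) {s : Circle}
    (h0 : F 0 = s • H 0) : F 1 = (cexp (∫ e in (0 : ℝ)..1, a e) * s) • H 1 := by
  let φ : ℝ → ℝ := fun x => ∫ e in (0 : ℝ)..x, a e
  have hφ : ∀ x, HasDerivAt φ (a x) x := fun x => ha.integral_hasStrictDerivAt 0 x |>.hasDerivAt
  -- Rotating the horizontal lift by the primitive of `a` gives a lift with the same pullback of `θ`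
  -- as `F`, reducing the claim to `eq_smul`.
  have hK : IsPathLift π θ γ a fun e => cexp (φ e) • H e :=
    { continuousOn := P.contMDiff_cexp_smul.continuous.comp_continuousOn
        ((continuous_iff_continuousAt.2 fun x => (hφ x).continuousAt).continuousOn.prodMk
          hH.continuousOn)
      proj := fun e he => by rw [P.proj_smul, hH.proj e he]
      mdifferentiableAt := fun e he => (P.contMDiff_cexp_smul.mdifferentiable (by simp) _).comp e
        ((hφ e).differentiableAt.mdifferentiableAt.prodMk (hH.mdifferentiableAt e he))
      along_eq := fun e he => by
        rw [hθ.along_cexp_smul P (hH.mdifferentiableAt e he) (hφ e).differentiableAt,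
          hH.along_eq e he, (hφ e).hasFDerivAt.fderiv]
        simp }
  have h1 := hF.eq_smul hK P hθ (s := s) (by simp [φ, cexp_zero, h0])
  rw [h1, _root_.smul_smul, mul_comm]

end IsPathLift

/-- Two-forms on a line vanish, so the zero form meets the curvature condition of `exists_lift`; a
constant rotation adjusts the starting point. -/
theorem IsConnectionForm.exists_horizontal_lift (hθ : IsConnectionForm θ)
    (P : IsPrincipalCircleBundle E₁ ER π) (hcurv : θ.extD = -om.pullback π) {γ : ℝ → X₁}
    (hγ : ContMDiff 𝓘(ℝ, ℝ) 𝓘(ℝ, E₁) ∞ γ) {r : R} (hr : π r = γ 0) :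
    ∃ H, IsPathLift π θ γ 0 H ∧ H 0 = r := by
  obtain ⟨F, hF, hFπ, hFA⟩ := hθ.exists_lift P hcurv hγ (A := 0) contDiff_const fun v => by
    refine ContinuousAlternatingMap.ext fun w => ?_
    have h0 : ∀ K : ℝ [⋀^Fin 2]→L[ℝ] ℝ, K w = 0 := fun K => by
      refine K.toAlternatingMap.map_linearDependent w fun h => ?_
      have := h.fintype_card_le_finrank
      simp at this
    rw [h0, h0]
  have h1 : IsPathLift π θ γ 0 F := ⟨hF.continuous.continuousOn, fun e _ => hFπ e, fun e _ => hF e,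
    fun e _ => hFA e 1⟩
  obtain ⟨s, hs⟩ := P.exists_smul_eq ((hFπ 0).trans hr.symm)
  exact ⟨_, h1.const_smul P hθ s, hs⟩

end HorizontalLifts

/-! ### Parametric integrals and Fubini on the triangle. -/

section ParametricIntegrals

open MeasureTheory

theorem ContDiff.parametric_intervalIntegral {V : Type*} [NormedAddCommGroup V] [NormedSpace ℝ V]
    [FiniteDimensional ℝ V] {K : V × ℝ → ℝ} (hK : ContDiff ℝ 1 K) :
    ContDiff ℝ 1 fun v => ∫ u in (0 : ℝ)..1, K (v, u) := by
  let K' : V → ℝ → V →L[ℝ] ℝ := fun v u => (fderiv ℝ K (v, u)).comp (.inl ℝ V ℝ)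
  have hK' : Continuous (Function.uncurry K') := by
    have h1 : Continuous fun q : V × ℝ => fderiv ℝ K q := hK.continuous_fderiv (by simp)
    exact h1.clm_comp continuous_const
  have hd : ∀ v u, HasFDerivAt (fun v => K (v, u)) (K' v u) v := fun v u =>
    ((hK.differentiable (by simp) (v, u)).hasFDerivAt).comp v (hasFDerivAt_prodMk_left v u)
  rw [contDiff_one_iff_hasFDerivAt]
  refine ⟨fun v => ∫ u in (0 : ℝ)..1, K' v u,
    intervalIntegral.continuous_parametric_intervalIntegral_of_continuous' hK' 0 1, fun v => ?_⟩
  obtain ⟨C, hC⟩ := ((isCompact_closedBall v 1).prod (isCompact_Icc (a := (0 : ℝ)) (b := 1))).bddAbove_image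
    (f := fun q => ‖Function.uncurry K' q‖) hK'.norm.continuousOn
  have hKc : ∀ v, Continuous fun u => K (v, u) := fun v => hK.continuous.comp (by fun_prop)
  refine intervalIntegral.hasFDerivAt_integral_of_dominated_of_fderiv_le (bound := fun _ => C)
    (Metric.closedBall_mem_nhds v one_pos) (.of_forall fun w => (hKc w).aestronglyMeasurable)
    ((hKc v).intervalIntegrable _ _)
    (Continuous.aestronglyMeasurable (hK'.comp (f := fun u => (v, u)) (by fun_prop)))
    (.of_forall fun u hu w hw => ?_) intervalIntegrable_const (.of_forall fun u _ w _ => hd w u)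
  refine hC ⟨(w, u), ⟨hw, ?_⟩, rfl⟩
  rw [uIoc_of_le zero_le_one] at hu
  exact Ioc_subset_Icc_self hu

/-- A `C¹` function on the plane has a `C¹` primitive in the first variable. -/
theorem exists_plane_primitive {g : (Fin 2 → ℝ) → ℝ} (hg : ContDiff ℝ 1 g) :
    ∃ a : (Fin 2 → ℝ) → ℝ, ContDiff ℝ 1 a ∧ (∀ v, a v = ∫ s in (0 : ℝ)..v 0, g ![s, v 1]) ∧
      ∀ v, fderiv ℝ a v (Pi.single 0 1) = g v := by
  -- Substituting `s = v 0 * u` fixes the limits of integration, so that differentiation under the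
  -- integral gives `C¹` regularity in both variables at once.
  let a : (Fin 2 → ℝ) → ℝ := fun v => v 0 * ∫ u in (0 : ℝ)..1, g ![v 0 * u, v 1]
  have hL : ContDiff ℝ 1 fun q : (Fin 2 → ℝ) × ℝ => (![q.1 0 * q.2, q.1 1] : Fin 2 → ℝ) := by
    rw [contDiff_pi]
    intro i
    fin_cases i
    · exact ((contDiff_apply ℝ ℝ (0 : Fin 2)).comp contDiff_fst).mul contDiff_snd
    · have h : ContDiff ℝ 1 fun q : (Fin 2 → ℝ) × ℝ => q.1 1 :=
        (contDiff_apply ℝ ℝ (1 : Fin 2)).comp contDiff_fst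
      exact h
  have ha : ContDiff ℝ 1 a :=
    (contDiff_apply ℝ ℝ (0 : Fin 2)).mul (hg.comp hL).parametric_intervalIntegral
  have ha' : ∀ v, a v = ∫ s in (0 : ℝ)..v 0, g ![s, v 1] := fun v => by
    have := intervalIntegral.mul_integral_comp_mul_left (a := 0) (b := 1)
      (f := fun s => g ![s, v 1]) (v 0)
    simpa using this
  refine ⟨a, ha, ha', fun v => ?_⟩
  have hgc : Continuous fun s : ℝ => g ![s, v 1] := hg.continuous.comp (by fun_prop)
  have h1 : HasDerivAt (fun t : ℝ => ∫ s in (0 : ℝ)..t, g ![s, v 1]) (g ![v 0, v 1]) (v 0) :=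
    (hgc.integral_hasStrictDerivAt 0 (v 0)).hasDerivAt
  have hv : (![v 0, v 1] : Fin 2 → ℝ) = v := by ext i; fin_cases i <;> rfl
  have h2 : HasDerivAt (fun t : ℝ => (Function.update v 0 t)) (Pi.single 0 1) (v 0) :=
    hasDerivAt_update v 0 (v 0)
  have h3 : HasFDerivAt a (fderiv ℝ a v) (Function.update v 0 (v 0)) := by
    rw [Function.update_eq_self]
    exact (ha.differentiable (by simp) v).hasFDerivAt
  have h4 := h3.comp_hasDerivAt (v 0) h2
  have h5 : (a ∘ fun t : ℝ => Function.update v 0 t) = fun t => ∫ s in (0 : ℝ)..t, g ![s, v 1] := by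
    funext t
    rw [Function.comp_apply, ha']
    simp
  rw [h5] at h4
  rw [h4.unique h1, hv]

theorem setIntegral_cornerSimplex_one (g : (Fin 1 → ℝ) → ℝ) :
    ∫ e in cornerSimplex 1, g e = ∫ t in (0 : ℝ)..1, g fun _ => t := by
  have h := (volume_preserving_funUnique (Fin 1) ℝ).symm.setIntegral_preimage_emb
    (MeasurableEquiv.measurableEmbedding _) g (cornerSimplex 1)
  refine Eq.trans (by congr!) (h.symm.trans ?_)
  rw [intervalIntegral.integral_of_le zero_le_one, ← integral_Icc_eq_integral_Ioc]
  have hs : (MeasurableEquiv.funUnique (Fin 1) ℝ).symm ⁻¹' cornerSimplex 1 = Icc 0 1 := by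
    ext t
    rw [mem_preimage, mem_cornerSimplex]
    simp [MeasurableEquiv.funUnique]
  rw [hs]
  rfl

/-- The order of integration is chosen so that the inner integral is the primitive of
`exists_plane_primitive` evaluated at the point `(1 - y, y)` of the hypotenuse. -/
theorem setIntegral_cornerSimplex_two {g : (Fin 2 → ℝ) → ℝ} (hg : Continuous g) :
    ∫ e in cornerSimplex 2, g e = ∫ y in (0 : ℝ)..1, ∫ x in (0 : ℝ)..(1 - y), g ![x, y] := by
  have h := (volume_preserving_finTwoArrow ℝ).symm.setIntegral_preimage_emb
    (MeasurableEquiv.measurableEmbedding _) g (cornerSimplex 2)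
  set S : Set (ℝ × ℝ) := MeasurableEquiv.finTwoArrow.symm ⁻¹' cornerSimplex 2
  have hS : ∀ p : ℝ × ℝ, p ∈ S ↔ (0 ≤ p.1 ∧ 0 ≤ p.2) ∧ p.1 + p.2 ≤ 1 := fun p => by
    change (![p.1, p.2] : Fin 2 → ℝ) ∈ cornerSimplex 2 ↔ _
    rw [mem_cornerSimplex]
    simp [Fin.forall_fin_two]
  have hc : Continuous fun p : ℝ × ℝ => (![p.1, p.2] : Fin 2 → ℝ) := by fun_prop
  have hScl : IsClosed S := (isCompact_cornerSimplex 2).isClosed.preimage hc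
  have hSc : IsCompact S := by
    refine ((isCompact_Icc (a := (0 : ℝ)) (b := 1)).prod
      (isCompact_Icc (a := (0 : ℝ)) (b := 1))).of_isClosed_subset hScl fun p hp => ?_
    obtain ⟨⟨h1, h2⟩, h3⟩ := (hS p).1 hp
    exact ⟨⟨h1, by linarith⟩, ⟨h2, by linarith⟩⟩
  have hint : IntegrableOn (fun p : ℝ × ℝ => g ![p.1, p.2]) S :=
    (hg.comp hc).continuousOn.integrableOn_compact hSc
  rw [← h]
  change ∫ p in S, g ![p.1, p.2] = _
  rw [← integral_indicator hScl.measurableSet]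
  refine (integral_prod_symm _ ((integrable_indicator_iff hScl.measurableSet).2 hint)).trans ?_
  rw [intervalIntegral.integral_of_le zero_le_one, ← integral_Icc_eq_integral_Ioc,
    ← integral_indicator measurableSet_Icc]
  congr 1
  funext y
  by_cases hy : y ∈ Icc (0 : ℝ) 1
  · rw [indicator_of_mem hy, intervalIntegral.integral_of_le (by linarith [hy.2]),
      ← integral_Icc_eq_integral_Ioc, ← integral_indicator measurableSet_Icc]
    congr 1
    funext x
    have : (x, y) ∈ S ↔ x ∈ Icc 0 (1 - y) := by
      rw [hS]
      exact ⟨fun h => ⟨h.1.1, by linarith [h.2]⟩, fun h => ⟨⟨h.1, hy.1⟩, by linarith [h.2]⟩⟩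
    by_cases hx : x ∈ Icc 0 (1 - y)
    · rw [indicator_of_mem hx, indicator_of_mem (this.2 hx)]
    · rw [indicator_of_notMem hx, indicator_of_notMem (fun h => hx (this.1 h))]
  · rw [indicator_of_notMem hy]
    refine integral_eq_zero_of_ae (.of_forall fun x => indicator_of_notMem (fun h => hy ?_) _)
    obtain ⟨⟨h1, h2⟩, h3⟩ := (hS _).1 h
    exact ⟨h2, by simp only at h1 h2 h3; linarith⟩

theorem ContinuousAlternatingMap.apply_plane (K : (Fin 2 → ℝ) [⋀^Fin 2]→L[ℝ] ℝ)
    (w : Fin 2 → Fin 2 → ℝ) :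
    K w = (w 0 0 * w 1 1 - w 0 1 * w 1 0) * K fun i => Pi.single i 1 := by
  have h := congrArg (fun L => L w) (K.toAlternatingMap.eq_smul_basis_det (Pi.basisFun ℝ (Fin 2)))
  refine h.trans ?_
  have hb : (⇑(Pi.basisFun ℝ (Fin 2)) : Fin 2 → Fin 2 → ℝ) = fun i => Pi.single i 1 := by
    funext i; simp
  rw [AlternatingMap.smul_apply, Pi.basisFun_det_apply, hb, Matrix.det_fin_two, smul_eq_mul,
    mul_comm]
  rfl

end ParametricIntegrals

/-! ### Holonomy around a triangle. -/

theorem exists_int_of_cexp_eq {a b : ℝ} (h : cexp a = cexp b) : ∃ m : ℤ, a - b = m :=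
  cexp_eq_one_iff.1 (by rw [cexp_sub, h, mul_inv_cancel])

/-- The linear part of the parametrization `e ↦ (1 - e, e)` of the standard 1-simplex. -/
noncomputable def edgeCLM : ℝ →L[ℝ] (Fin 2 → ℝ) :=
  (baryLinear 1).comp (ContinuousLinearMap.pi fun _ => ContinuousLinearMap.id ℝ ℝ)

theorem edgeCLM_apply (e : ℝ) : edgeCLM e = baryLinear 1 fun _ => e := rfl

theorem single_add_edgeCLM (e : ℝ) : (Pi.single 0 1 + edgeCLM e : Fin 2 → ℝ) = ![1 - e, e] := by
  rw [edgeCLM_apply, ← bary_eq]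
  ext i; fin_cases i <;> simp

theorem single_add_edgeCLM_mem {e : ℝ} (he : e ∈ Icc (0 : ℝ) 1) :
    (Pi.single 0 1 + edgeCLM e : Fin 2 → ℝ) ∈ stdSimplex ℝ (Fin 2) := by
  rw [single_add_edgeCLM]
  refine ⟨fun i => ?_, by simp⟩
  fin_cases i
  · simpa using he.2
  · simpa using he.1

open Classical in
/-- The parametrization `e ↦ (1 - e, e)` of the standard 1-simplex by `[0, 1]`. -/
noncomputable def edge (e : ℝ) : stdSimplex ℝ (Fin 2) :=
  if h : (Pi.single 0 1 + edgeCLM e : Fin 2 → ℝ) ∈ stdSimplex ℝ (Fin 2) then ⟨_, h⟩ else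
    ⟨Pi.single 0 1, single_mem_stdSimplex ℝ 0⟩

theorem edge_eq {e : ℝ} (he : e ∈ Icc (0 : ℝ) 1) : edge e = ⟨_, single_add_edgeCLM_mem he⟩ :=
  dif_pos _

theorem eventually_edge_eq {M : Type*} (c : stdSimplex ℝ (Fin 2) → M) {e : ℝ}
    (he : e ∈ Ioo (0 : ℝ) 1) : ∀ᶠ e' in 𝓝 e, ∃ hm, c (edge e') = c ⟨Pi.single 0 1 + edgeCLM e', hm⟩ := by
  filter_upwards [Icc_mem_nhds he.1 he.2] with e' he'
  exact ⟨single_add_edgeCLM_mem he', congrArg c (edge_eq he')⟩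

namespace LieGroupoid

variable {E₀ E₁ ER X₀ X₁ R : Type*}
  [NormedAddCommGroup E₀] [NormedSpace ℝ E₀] [TopologicalSpace X₀] [ChartedSpace E₀ X₀]
  [NormedAddCommGroup E₁] [NormedSpace ℝ E₁] [TopologicalSpace X₁] [ChartedSpace E₁ X₁]
  [NormedAddCommGroup ER] [NormedSpace ℝ ER] [TopologicalSpace R] [ChartedSpace ER R]
  [MulAction Circle R] {G : LieGroupoid E₀ E₁ X₀ X₁} {π : R → X₁} {θ : DForm ER R 1}
  {om : DForm E₁ X₁ 2}

/-- The path in `X₁` described by a singular 1-simplex. -/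
noncomputable def SingularSimplex.path (σ : G.SingularSimplex 1 1) (e : ℝ) : X₁ :=
  (σ.toFun (edge e)).arr 0 1

/-- `ℓ` is the logarithm of the horizontal transport along `σ` with respect to the (discontinuous)
trivialization `r` of the circle bundle. -/
def IsLogHolonomy (π : R → X₁) (θ : DForm ER R 1) (r : X₁ → R) (σ : G.SingularSimplex 1 1)
    (ℓ : ℝ) : Prop :=
  ∃ H : ℝ → R, IsPathLift π θ σ.path 0 H ∧ H 0 = r (σ.path 0) ∧ H 1 = cexp ℓ • r (σ.path 1)

variable [IsManifold 𝓘(ℝ, E₁) ∞ X₁] [IsManifold 𝓘(ℝ, ER) ∞ R] {r : X₁ → R}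

theorem exists_isLogHolonomy (hθ : IsConnectionForm θ) (P : IsPrincipalCircleBundle E₁ ER π)
    (hcurv : θ.extD = -om.pullback π) (hr : ∀ x, π (r x) = x) (σ : G.SingularSimplex 1 1) :
    ∃ ℓ, IsLogHolonomy π θ r σ ℓ := by
  obtain ⟨f, hf, hfσ⟩ := σ.smooth 0 1
  have hp : ∀ e ∈ Icc (0 : ℝ) 1, f (Pi.single 0 1 + edgeCLM e) = σ.path e := fun e he => by
    rw [SingularSimplex.path, edge_eq he]
    exact hfσ ⟨_, single_add_edgeCLM_mem he⟩
  have hγ : ContMDiff 𝓘(ℝ, ℝ) 𝓘(ℝ, E₁) ∞ fun e => f (Pi.single 0 1 + edgeCLM e) :=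
    hf.comp (contDiff_const.add edgeCLM.contDiff).contMDiff
  have i0 : (0 : ℝ) ∈ Icc (0 : ℝ) 1 := by norm_num
  have i1 : (1 : ℝ) ∈ Icc (0 : ℝ) 1 := by norm_num
  obtain ⟨H, hH, h0⟩ := hθ.exists_horizontal_lift P hcurv hγ (r := r (σ.path 0))
    ((hr _).trans (hp 0 i0).symm)
  have hH' : IsPathLift π θ σ.path 0 H :=
    ⟨hH.continuousOn, fun e he => (hH.proj e he).trans (hp e he), hH.mdifferentiableAt, hH.along_eq⟩
  obtain ⟨s, hs⟩ := P.exists_smul_eq ((hr _).trans (hH'.proj 1 i1).symm)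
  obtain ⟨ℓ, rfl⟩ := cexp_surjective s
  exact ⟨ℓ, H, hH', h0, hs.symm⟩

/-- A map from the plane to the base of a circle bundle with connection has a lift whose pullback of
the connection form is a primitive of the curvature in the first variable. -/
theorem exists_plane_lift (hθ : IsConnectionForm θ) (P : IsPrincipalCircleBundle E₁ ER π)
    (hcurv : θ.extD = -om.pullback π) (hom : om.IsSmooth) {f : (Fin 2 → ℝ) → X₁}
    (hf : ContMDiff 𝓘(ℝ, Fin 2 → ℝ) 𝓘(ℝ, E₁) ∞ f) :
    ∃ (F : (Fin 2 → ℝ) → R) (g a : (Fin 2 → ℝ) → ℝ), MDifferentiable 𝓘(ℝ, Fin 2 → ℝ) 𝓘(ℝ, ER) F ∧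
      (∀ v, π (F v) = f v) ∧ Continuous g ∧ (∀ v, g v = om.along f v fun i => Pi.single i 1) ∧
      Continuous a ∧ (∀ v, a v = ∫ s in (0 : ℝ)..v 0, g ![s, v 1]) ∧
      ∀ v w, θ.along F v (fun _ => w) = -a v * w 1 := by
  have hΩ : ContDiff ℝ ∞ (om.along f) :=
    contDiffOn_univ.1 (hom.contDiffOn_along isOpen_univ hf.contMDiffOn)
  let g : (Fin 2 → ℝ) → ℝ := fun v => om.along f v fun i => Pi.single i 1
  have hg : ContDiff ℝ ∞ g :=
    (ContinuousAlternatingMap.apply ℝ (Fin 2 → ℝ) ℝ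
      (fun i : Fin 2 => (Pi.single i 1 : Fin 2 → ℝ))).contDiff.comp hΩ
  obtain ⟨a, ha, hag, hda⟩ := exists_plane_primitive (hg.of_le (by exact_mod_cast le_top))
  let dy : (Fin 2 → ℝ) [⋀^Fin 1]→L[ℝ] ℝ := ContinuousAlternatingMap.ofSubsingletonLIE (𝕜 := ℝ)
    (E := Fin 2 → ℝ) (F := ℝ) (0 : Fin 1) (ContinuousLinearMap.proj 1)
  -- As `a` is a primitive of `g` in the first variable, `d(-a dy) = -g dx ∧ dy = -f^*ω`, the
  -- condition for a lift.
  let A : (Fin 2 → ℝ) → (Fin 2 → ℝ) [⋀^Fin 1]→L[ℝ] ℝ := fun v => -a v • dy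
  have hA : ContDiff ℝ 1 A := ha.neg.smul contDiff_const
  have hAv : ∀ v w, A v (fun _ => w) = -a v * w 1 := fun v w => rfl
  have hdA : ∀ v, extDeriv A v = -om.along f v := fun v => by
    refine ContinuousAlternatingMap.ext fun w => ?_
    let pr : (Fin 2 → ℝ) →L[ℝ] ℝ := ContinuousLinearMap.proj 1
    have h1 : HasFDerivAt (fun v => (-a v) • pr) ((-fderiv ℝ a v).smulRight pr) v :=
      (ha.differentiable (by simp) v).hasFDerivAt.neg.smul_const pr
    have hfd : fderiv ℝ (oneFormCLM A) v = (-fderiv ℝ a v).smulRight pr := h1.fderiv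
    rw [extDeriv_oneForm_apply (hA.differentiable (by simp) v), hfd,
      ContinuousAlternatingMap.neg_apply, ContinuousAlternatingMap.apply_plane]
    change -fderiv ℝ a v (w 0) * w 1 1 - -fderiv ℝ a v (w 1) * w 0 1 = -(_ * g v)
    have hlin : ∀ u : Fin 2 → ℝ, fderiv ℝ a v u =
        u 0 * g v + u 1 * fderiv ℝ a v (Pi.single 1 1) := fun u => by
      have hu : u = u 0 • Pi.single 0 1 + u 1 • Pi.single 1 1 := by
        ext i; fin_cases i <;> simp
      conv_lhs => rw [hu]
      rw [map_add, map_smul, map_smul, hda]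
      rfl
    rw [hlin (w 0), hlin (w 1)]
    ring
  obtain ⟨F, hF, hFπ, hFA⟩ := hθ.exists_lift P hcurv hf hA hdA
  exact ⟨F, g, a, hF, hFπ, hg.continuous, fun _ => rfl, ha.continuous, hag,
    fun v w => (hFA v w).trans (hAv v w)⟩

/-- Transport around a 2-simplex is the integral of the curvature. -/
theorem integrate_sub_isLogHolonomy (hθ : IsConnectionForm θ) (P : IsPrincipalCircleBundle E₁ ER π)
    (hcurv : θ.extD = -om.pullback π) (hom : om.IsSmooth) (hr : ∀ x, π (r x) = x)
    (τ : G.SingularSimplex 1 2) {ℓ : Fin 3 → ℝ}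
    (hℓ : ∀ i, IsLogHolonomy π θ r (τ.singularFace i) (ℓ i)) :
    ∃ m : ℤ, integrate om (fun x => (τ.toFun x).arr 0 1) - (ℓ 0 - ℓ 1 + ℓ 2) = m := by
  obtain ⟨f, hf, hfτ⟩ := τ.smooth 0 1
  let f₂ : (Fin 2 → ℝ) → X₁ := fun v => f (Pi.single 0 1 + baryLinear 2 v)
  have hf₂ : ContMDiff 𝓘(ℝ, Fin 2 → ℝ) 𝓘(ℝ, E₁) ∞ f₂ :=
    hf.comp (contDiff_const.add (baryLinear 2).contDiff).contMDiff
  obtain ⟨F, g, a, hF, hFπ, hgc, hg, hac, hag, hFA⟩ := exists_plane_lift hθ P hcurv hom hf₂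
  have hedge : ∀ (i : Fin 3) (q u : Fin 2 → ℝ), (∀ e : ℝ, (i.insertNth (α := fun _ => ℝ) 0
      ![1 - e, e] : Fin 3 → ℝ) = Pi.single 0 1 + baryLinear 2 (q + e • u)) →
      ∀ e ∈ Icc (0 : ℝ) 1, f₂ (q + e • u) = (τ.singularFace i).path e := by
    intro i q u h e he
    rw [SingularSimplex.path, edge_eq he]
    refine Eq.trans ?_ (hfτ (simplexCoface i ⟨_, single_add_edgeCLM_mem he⟩))
    refine congrArg f ((h e).symm.trans ?_)
    exact congrArg (fun x => (i.insertNth (α := fun _ => ℝ) 0 x : Fin 3 → ℝ))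
      (single_add_edgeCLM e).symm
  have hlift : ∀ (i : Fin 3) (q u : Fin 2 → ℝ),
      (∀ e ∈ Icc (0 : ℝ) 1, f₂ (q + e • u) = (τ.singularFace i).path e) →
      IsPathLift π θ (τ.singularFace i).path (fun e => -a (q + e • u) * u 1)
        fun e => F (q + e • u) := by
    intro i q u h
    have hl : ∀ e : ℝ, HasDerivAt (fun e : ℝ => q + e • u) u e := fun e => by
      simpa using ((hasDerivAt_id e).smul_const u).const_add q
    refine ⟨(hF.continuous.comp (by fun_prop)).continuousOn, fun e he => (hFπ _).trans (h e he),
      fun e _ => (hF _).comp e (hl e).differentiableAt.mdifferentiableAt, fun e _ => ?_⟩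
    have h1 := congrArg (fun K : ℝ [⋀^Fin 1]→L[ℝ] ℝ => K fun _ => 1)
      (DForm.pullback_comp_apply θ (f := F) (g := fun e : ℝ => q + e • u) (hF _)
        (hl e).differentiableAt.mdifferentiableAt)
    refine h1.symm.trans ((hFA (q + e • u) _).trans ?_)
    have h2 : fderiv ℝ (fun e : ℝ => q + e • u) e 1 = u := by
      rw [fderiv_apply_one_eq_deriv, (hl e).deriv]
    have h3 := (congrArg (fun L : ℝ →L[ℝ] (Fin 2 → ℝ) => L 1)
      (mfderiv_eq_fderiv (f := fun e : ℝ => q + e • u) (x := e))).trans h2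
    exact congrArg (fun x : Fin 2 → ℝ => -a (q + e • u) * x 1) h3
  -- The plane lift restricted to the edges from `0` to `(1, 0)`, from `0` to `(0, 1)`, and along
  -- the hypotenuse from `(1, 0)` to `(0, 1)`.
  have p2 := hlift 2 0 ![1, 0] (hedge 2 0 ![1, 0] fun e => by
    rw [← bary_eq]
    ext i; fin_cases i <;> simp [Fin.insertNth, Fin.succAboveCases])
  have p1 := hlift 1 0 ![0, 1] (hedge 1 0 ![0, 1] fun e => by
    rw [← bary_eq]
    ext i; fin_cases i <;> simp [Fin.insertNth, Fin.succAboveCases])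
  have p0 := hlift 0 ![1, 0] ![-1, 1] (hedge 0 ![1, 0] ![-1, 1] fun e => by
    rw [← bary_eq]
    ext i; fin_cases i <;> simp [Fin.insertNth, Fin.succAboveCases]; ring)
  obtain ⟨H0, hH0, s0, t0⟩ := hℓ 0
  obtain ⟨H1, hH1, s1, t1⟩ := hℓ 1
  obtain ⟨H2, hH2, s2, t2⟩ := hℓ 2
  have i0 : (0 : ℝ) ∈ Icc (0 : ℝ) 1 := by norm_num
  have i1 : (1 : ℝ) ∈ Icc (0 : ℝ) 1 := by norm_num
  have hstart : ∀ q u : Fin 2 → ℝ, q + (0 : ℝ) • u = q := fun q u => by simp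
  have e2 : (0 + (1 : ℝ) • ![1, 0] : Fin 2 → ℝ) = ![1, 0] := by simp
  have e1 : (0 + (1 : ℝ) • ![0, 1] : Fin 2 → ℝ) = ![0, 1] := by simp
  have e0 : (![1, 0] + (1 : ℝ) • ![-1, 1] : Fin 2 → ℝ) = ![0, 1] := by simp
  rw [← p0.proj 0 i0, hstart, hFπ] at s0
  rw [← p1.proj 0 i0, hstart, hFπ] at s1
  rw [← p2.proj 0 i0, hstart, hFπ] at s2
  rw [← p0.proj 1 i1, e0, hFπ] at t0
  rw [← p1.proj 1 i1, e1, hFπ] at t1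
  rw [← p2.proj 1 i1, e2, hFπ] at t2
  obtain ⟨s, hs⟩ := P.exists_smul_eq ((hr (f₂ 0)).trans (hFπ 0).symm)
  have k2 := p2.eq_cexp_smul (by fun_prop) hH2 P hθ (s := s) (by rw [hstart, s2, hs])
  have k1 := p1.eq_cexp_smul (by fun_prop) hH1 P hθ (s := s) (by rw [hstart, s1, hs])
  -- On the horizontal edge `dy = 0`, on the vertical edge `a = 0`; both restrictions are horizontal
  -- and only the hypotenuse contributes.
  have z2 : ∫ e in (0 : ℝ)..1, -a (0 + e • ![1, 0]) * (![1, 0] : Fin 2 → ℝ) 1 = 0 := by simp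
  have z1 : ∫ e in (0 : ℝ)..1, -a (0 + e • ![0, 1]) * (![0, 1] : Fin 2 → ℝ) 1 = 0 := by
    simp [hag]
  rw [e2, z2, cexp_zero, one_mul, t2, _root_.smul_smul] at k2
  rw [e1, z1, cexp_zero, one_mul, t1, _root_.smul_smul] at k1
  have k0 := p0.eq_cexp_smul (by fun_prop) hH0 P hθ (s := s * cexp (ℓ 2)) (by rw [hstart, s0, k2])
  have z0 : ∫ e in (0 : ℝ)..1, -a (![1, 0] + e • ![-1, 1]) * (![-1, 1] : Fin 2 → ℝ) 1 =
      -integrate om (fun x => (τ.toFun x).arr 0 1) := by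
    have h1 : integrate om (fun x => (τ.toFun x).arr 0 1) = ∫ e in cornerSimplex 2, g e := by
      refine integrate_eq_of_interior om fun e _ K hK => ?_
      rw [hg]
      refine congrArg (fun L : (Fin 2 → ℝ) [⋀^Fin 2]→L[ℝ] ℝ => L fun i => Pi.single i 1)
        (DForm.along_congr om ?_)
      filter_upwards [hK] with e' ⟨hm, h⟩
      exact h.trans (hfτ ⟨_, hm⟩).symm
    rw [h1, setIntegral_cornerSimplex_two hgc, ← intervalIntegral.integral_neg]
    refine intervalIntegral.integral_congr fun y _ => ?_
    simp [hag, sub_eq_add_neg]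
  rw [e0, z0, t0, _root_.smul_smul, k1] at k0
  have k := P.smul_left_cancel k0
  obtain ⟨t, rfl⟩ := cexp_surjective s
  rw [← cexp_add, ← cexp_add, ← cexp_add, ← cexp_add] at k
  obtain ⟨m, hm⟩ := exists_int_of_cexp_eq k
  exact ⟨m, by linarith⟩

end LieGroupoid

/-! ### The integer cocycle. -/

namespace LieGroupoid

variable {E₀ E₁ ER X₀ X₁ R : Type*}
  [NormedAddCommGroup E₀] [NormedSpace ℝ E₀] [TopologicalSpace X₀] [ChartedSpace E₀ X₀]
  [NormedAddCommGroup E₁] [NormedSpace ℝ E₁] [TopologicalSpace X₁] [ChartedSpace E₁ X₁]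
  [NormedAddCommGroup ER] [NormedSpace ℝ ER] [TopologicalSpace R] [ChartedSpace ER R]
  [MulAction Circle R] [IsManifold 𝓘(ℝ, E₀) ∞ X₀] [IsManifold 𝓘(ℝ, E₁) ∞ X₁]
  {G : LieGroupoid E₀ E₁ X₀ X₁} {π : R → X₁} {θ : DForm ER R 1}
  {η : DForm G.PairsModel G.Pairs 1} {om : DForm E₁ X₁ 2} {μ : R → R → R} {r : X₁ → R}

/-- The topological counterpart of `contMDiffAt_mul`, for products of path lifts on the closed
interval. -/
theorem IsFlatMul.continuous_mul (hμ : IsFlatMul ER G π η θ μ)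
    (P : IsPrincipalCircleBundle E₁ ER π) {Q : Type*} [TopologicalSpace Q] {f g : Q → R}
    (hf : Continuous f) (hg : Continuous g) (h : ∀ q, G.tgt (π (f q)) = G.src (π (g q))) :
    Continuous fun q => μ (f q) (g q) := by
  let c : Q → G.Pairs := fun q => ⟨π (f q), π (g q), h q⟩
  have hc : Continuous c := FiberProduct.isInducing_toProd.continuous_iff.2
    ((P.contMDiff_proj.continuous.comp hf).prodMk (P.contMDiff_proj.continuous.comp hg))
  rw [continuous_iff_continuousAt]
  intro q
  obtain ⟨B, x, y, hB, h0, hBt, hx, hy, hz, hpx, hpy, -⟩ := hμ.flat (c q)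
  set κ := chartAt G.PairsModel (c q)
  have hv : ContinuousAt (fun p => κ (c p)) q :=
    (κ.continuousAt (mem_chart_source _ (c q))).comp hc.continuousAt
  have hBn : B ∈ 𝓝 (κ (c q)) := hB.mem_nhds h0
  let s : Set Q := {p | κ (c p) ∈ B ∧ κ.symm (κ (c p)) = c p}
  have ev : s ∈ 𝓝 q := (hv.eventually hBn).and ((hc.continuousAt.eventually
      (κ.open_source.mem_nhds (mem_chart_source _ (c q)))).mono fun p hp => κ.left_inv hp)
  have ex : ∀ p ∈ s, π (x (κ (c p))) = π (f p) := fun p hp => by rw [hpx _ hp.1, hp.2]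
  have ey : ∀ p ∈ s, π (y (κ (c p))) = π (g p) := fun p hp => by rw [hpy _ hp.1, hp.2]
  have hxv : ContinuousAt (fun p => x (κ (c p))) q := (hx.contMDiffAt hBn).continuousAt.comp
    (f := fun p => κ (c p)) hv
  have hyv : ContinuousAt (fun p => y (κ (c p))) q := (hy.contMDiffAt hBn).continuousAt.comp
    (f := fun p => κ (c p)) hv
  have hzv : ContinuousAt (fun p => μ (x (κ (c p))) (y (κ (c p)))) q :=
    (hz.contMDiffAt hBn).continuousAt.comp (f := fun p => κ (c p)) hv
  have e : (fun p => μ (f p) (g p)) =ᶠ[𝓝 q] fun p =>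
      (phase (x (κ (c p))) (f p) * phase (y (κ (c p))) (g p)) •
        μ (x (κ (c p))) (y (κ (c p))) := by
    filter_upwards [ev] with p hp
    rw [← hμ.smul_smul, P.phase_smul (ex p hp), P.phase_smul (ey p hp)]
    rw [hpx _ hp.1, hpy _ hp.1]
    exact FiberProduct.w _
  refine ContinuousAt.congr_of_eventuallyEq ?_ e
  have px := (P.continuousWithinAt_phase hxv.continuousWithinAt hf.continuousWithinAt
    (mem_of_mem_nhds ev) ex).continuousAt ev
  have py := (P.continuousWithinAt_phase hyv.continuousWithinAt hg.continuousWithinAt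
    (mem_of_mem_nhds ev) ey).continuousAt ev
  exact P.contMDiff_smul.continuous.continuousAt.comp ((px.mul py).prodMk hzv)

/-- The defect of multiplicativity of the transport is the integral of `η`. -/
theorem IsFlatMul.integrate_sub_isLogHolonomy [IsManifold 𝓘(ℝ, ER) ∞ R]
    (hμ : IsFlatMul ER G π η θ μ) (P : IsPrincipalCircleBundle E₁ ER π) (hθ : IsConnectionForm θ)
    (hη : η.IsSmooth) (hr : ∀ x, π (r x) = x) {κ : G.Pairs → ℝ}
    (hκ : ∀ p : G.Pairs, μ (r p.fst) (r p.snd) = cexp (κ p) • r (G.mul p))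
    (σ : G.SingularSimplex 2 1) {ℓ : Fin 3 → ℝ}
    (hℓ : ∀ i, IsLogHolonomy π θ r (σ.nerveFace i) (ℓ i)) :
    ∃ m : ℤ, integrate η (fun x => (σ.toFun x).toPair) + (ℓ 0 - ℓ 1 + ℓ 2) +
      (κ (σ.toFun (edge 1)).toPair - κ (σ.toFun (edge 0)).toPair) = m := by
  obtain ⟨H0, hH0, s0, t0⟩ := hℓ 0
  obtain ⟨H1, hH1, s1, t1⟩ := hℓ 1
  obtain ⟨H2, hH2, s2, t2⟩ := hℓ 2
  have i0 : (0 : ℝ) ∈ Icc (0 : ℝ) 1 := by norm_num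
  have i1 : (1 : ℝ) ∈ Icc (0 : ℝ) 1 := by norm_num
  let c : ℝ → G.Pairs := fun e => (σ.toFun (edge e)).toPair
  have c0 : ∀ e, (σ.nerveFace 0).path e = (c e).snd := fun e => rfl
  have c2 : ∀ e, (σ.nerveFace 2).path e = (c e).fst := fun e => rfl
  have c1 : ∀ e, G.mul (c e) = (σ.nerveFace 1).path e := fun e => (σ.toFun (edge e)).mul_arr 0 1 2
  have hcomp : ∀ e ∈ Icc (0 : ℝ) 1, G.tgt (π (H2 e)) = G.src (π (H0 e)) := fun e he => by
    rw [hH2.proj e he, hH0.proj e he]; exact (c e).w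
  obtain ⟨B, hB, hBc⟩ := σ.locallyExtends_toPair.exists_form hη
  let a : ℝ → ℝ := fun e => -B (Pi.single 0 1 + edgeCLM e) fun _ => edgeCLM 1
  have hac : Continuous a := (continuous_eval.comp ((hB.comp (by fun_prop)).prodMk
    continuous_const)).neg
  -- The product of the horizontal lifts over faces `2` and `0` lies over face `1`. Multiplicativity
  -- gives `0 + 0 = θ + η` along it, so it has `θ`-velocity `-η`.
  have hF : IsPathLift π θ (σ.nerveFace 1).path a fun e => μ (H2 e) (H0 e) := by
    have ce := fun (e : ℝ) (he : e ∈ Ioo (0 : ℝ) 1) =>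
      eventually_edge_eq (fun x => (σ.toFun x).toPair) he
    have key := fun (e : ℝ) (he : e ∈ Ioo (0 : ℝ) 1) => hμ.mdifferentiableAt_mul P hθ
      (hH2.mdifferentiableAt e he) (hH0.mdifferentiableAt e he)
      (σ.locallyExtends_toPair.mdifferentiableAt edgeCLM (Pi.single 0 1) (h := c)
        (ce e he))
      (Filter.mem_of_superset (Icc_mem_nhds he.1 he.2) fun e' he' => hH2.proj e' he')
      (Filter.mem_of_superset (Icc_mem_nhds he.1 he.2) fun e' he' => hH0.proj e' he')
    refine ⟨?_, fun e he => ?_, fun e he => (key e he).1, fun e he => ?_⟩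
    · rw [continuousOn_iff_continuous_domRestrict]
      exact hμ.continuous_mul P hH2.continuousOn.domRestrict hH0.continuousOn.domRestrict
        fun e => hcomp e.1 e.2
    · rw [hμ.proj _ _ (hcomp e he), ← c1]
      exact congrArg G.mul (FiberProduct.ext (hH2.proj e he) (hH0.proj e he))
    · have k1 := (key e he).2 (1 : ℝ)
      have k2 := hH2.along_eq e he
      have k3 := hH0.along_eq e he
      have k4 := hBc ℝ edgeCLM (Pi.single 0 1) e c (ce e he) fun _ => 1
      have k5 : (0 : ℝ) + 0 = θ.along (fun e => μ (H2 e) (H0 e)) e (fun _ => 1) +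
          B (Pi.single 0 1 + edgeCLM e) (fun _ => edgeCLM 1) := by
        rw [← k4]
        exact (congrArg₂ (· + ·) k2 k3).symm.trans k1
      change _ = -_
      linarith
  have hπ : ∀ e, μ (r ((σ.nerveFace 2).path e)) (r ((σ.nerveFace 0).path e)) =
      cexp (κ (c e)) • r ((σ.nerveFace 1).path e) := fun e => (hκ (c e)).trans (by rw [c1])
  have k := hF.eq_cexp_smul hac hH1 P hθ (s := cexp (κ (c 0))) (by rw [s2, s0, hπ, s1])
  have hint : ∫ e in (0 : ℝ)..1, a e = -integrate η (fun x => (σ.toFun x).toPair) := by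
    have h1 : integrate η (fun x => (σ.toFun x).toPair) = ∫ e in cornerSimplex 1,
        B (Pi.single 0 1 + baryLinear 1 e) fun i => baryLinear 1 (Pi.single i 1) :=
      integrate_eq_of_interior η fun e _ K hK => hBc _ (baryLinear 1) (Pi.single 0 1) e K hK _
    rw [h1, setIntegral_cornerSimplex_one, ← intervalIntegral.integral_neg]
    have h2 : (fun i : Fin 1 => baryLinear 1 (Pi.single i 1)) = fun _ => edgeCLM 1 := by
      funext i
      rw [edgeCLM_apply]
      congr 1
      funext j
      rw [Subsingleton.elim i j, Pi.single_eq_same]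
    rw [h2]
    rfl
  have hc1 : G.tgt (π (r ((σ.nerveFace 2).path 1))) = G.src (π (r ((σ.nerveFace 0).path 1))) := by
    rw [hr, hr]; exact (c 1).w
  rw [t2, t0, hμ.smul_smul _ _ _ _ hc1, hπ, t1, hint, _root_.smul_smul, _root_.smul_smul] at k
  have k' := P.smul_left_cancel k
  simp only [← cexp_add] at k'
  obtain ⟨m, hm⟩ := exists_int_of_cexp_eq k'
  exact ⟨m, by simp only [c] at hm; linarith⟩

/-- Associativity of `μ` makes the phases of `μ` a cocycle modulo integers. -/
theorem IsFlatMul.exists_int_cocycle [IsManifold 𝓘(ℝ, ER) ∞ R] (hμ : IsFlatMul ER G π η θ μ)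
    (hc : G.IsThreeCocycle η om) (P : IsPrincipalCircleBundle E₁ ER π) (hθ : IsConnectionForm θ)
    (hG : G.SConnected) (hr : ∀ x, π (r x) = x) {κ : G.Pairs → ℝ}
    (hκ : ∀ p : G.Pairs, μ (r p.fst) (r p.snd) = cexp (κ p) • r (G.mul p)) (a : G.Nerve 3) :
    ∃ m : ℤ, κ (a.face 0).toPair - κ (a.face 1).toPair + κ (a.face 2).toPair -
      κ (a.face 3).toPair = m := by
  have e0 : μ (r (a.arr 1 2)) (r (a.arr 2 3)) = cexp (κ (a.face 0).toPair) • r (a.arr 1 3) :=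
    (hκ (a.face 0).toPair).trans (by rw [← a.mul_arr 1 2 3]; rfl)
  have e1 : μ (r (a.arr 0 2)) (r (a.arr 2 3)) = cexp (κ (a.face 1).toPair) • r (a.arr 0 3) :=
    (hκ (a.face 1).toPair).trans (by rw [← a.mul_arr 0 2 3]; rfl)
  have e2 : μ (r (a.arr 0 1)) (r (a.arr 1 3)) = cexp (κ (a.face 2).toPair) • r (a.arr 0 3) :=
    (hκ (a.face 2).toPair).trans (by rw [← a.mul_arr 0 1 3]; rfl)
  have e3 : μ (r (a.arr 0 1)) (r (a.arr 1 2)) = cexp (κ (a.face 3).toPair) • r (a.arr 0 2) :=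
    (hκ (a.face 3).toPair).trans (by rw [← a.mul_arr 0 1 2]; rfl)
  have hw : ∀ i j k, G.tgt (π (r (a.arr i j))) = G.src (π (r (a.arr j k))) := fun i j k => by
    rw [hr, hr]; exact a.w i j k
  -- Both bracketings of the three chosen lifts are multiples of `r (a.arr 0 3)`, and equating their
  -- phases gives the relation modulo integers.
  have h := hμ.assoc hc P hθ hG (hw 0 1 2) (hw 1 2 3)
  have l := hμ.smul_smul (cexp (κ (a.face 3).toPair)) 1 _ _ (hw 0 2 3)
  have l' := hμ.smul_smul 1 (cexp (κ (a.face 0).toPair)) _ _ (hw 0 1 3)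
  rw [one_smul] at l l'
  rw [e3, e0, l, l', e1, e2, mul_one, one_mul, _root_.smul_smul, _root_.smul_smul,
    ← cexp_add, ← cexp_add] at h
  obtain ⟨m, hm⟩ := exists_int_of_cexp_eq (P.smul_left_cancel h)
  refine ⟨-m, ?_⟩
  push_cast
  linarith

theorem default_stdSimplex_apply : (default : stdSimplex ℝ (Fin 1)).1 0 = 1 :=
  (Fin.sum_univ_one _).symm.trans (default : stdSimplex ℝ (Fin 1)).2.2

theorem simplexCoface_zero_default : simplexCoface 0 (default : stdSimplex ℝ (Fin 1)) = edge 1 := by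
  rw [edge_eq (by norm_num)]
  refine Subtype.ext ?_
  refine Eq.trans (b := Fin.insertNth (α := fun _ => ℝ) 0 (0 : ℝ)
    (default : stdSimplex ℝ (Fin 1)).1) rfl (Eq.trans ?_ (single_add_edgeCLM _).symm)
  ext i
  fin_cases i <;> simp [Fin.insertNth, Fin.succAboveCases, default_stdSimplex_apply]

theorem simplexCoface_one_default : simplexCoface 1 (default : stdSimplex ℝ (Fin 1)) = edge 0 := by
  rw [edge_eq (by norm_num)]
  refine Subtype.ext ?_
  refine Eq.trans (b := Fin.insertNth (α := fun _ => ℝ) 1 (0 : ℝ)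
    (default : stdSimplex ℝ (Fin 1)).1) rfl (Eq.trans ?_ (single_add_edgeCLM _).symm)
  ext i
  fin_cases i <;> simp [Fin.insertNth, Fin.succAboveCases, default_stdSimplex_apply]

namespace Cochain

theorem IsHomogeneous.totalD {A : Type*} [AddCommGroup A] {c : G.Cochain A} {n : ℕ}
    (h : c.IsHomogeneous n) : c.totalD.IsHomogeneous (n + 1) := by
  intro p q hpq
  funext σ
  have h1 : c.simplicialD p q σ = 0 := by
    rcases p with - | p
    · rfl
    · refine Finset.sum_eq_zero fun i _ => ?_
      rw [h p q (by omega), Pi.zero_apply, smul_zero]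
  have h2 : c.singularD p q σ = 0 := by
    rcases q with - | q
    · rfl
    · refine Finset.sum_eq_zero fun i _ => ?_
      rw [h p q (by omega), Pi.zero_apply, smul_zero]
  rw [Cochain.totalD, h1, h2, smul_zero, add_zero]
  rfl

theorem totalD_intCast (z : G.Cochain ℤ) :
    Cochain.totalD (fun p q σ => (z p q σ : ℝ)) = fun p q σ => (z.totalD p q σ : ℝ) := by
  funext p q σ
  have h1 : Cochain.simplicialD (fun p q σ => (z p q σ : ℝ)) p q σ = (z.simplicialD p q σ : ℝ) := by
    rcases p with - | p
    · exact Int.cast_zero.symm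
    · simp [Cochain.simplicialD]
  have h2 : Cochain.singularD (fun p q σ => (z p q σ : ℝ)) p q σ = (z.singularD p q σ : ℝ) := by
    rcases q with - | q
    · exact Int.cast_zero.symm
    · simp [Cochain.singularD]
  simp [Cochain.totalD, h1, h2]

end Cochain

theorem deRhamCochain_isHomogeneous : (G.deRhamCochain η om).IsHomogeneous 3 := by
  intro p q hpq
  rcases p with _ | _ | _ | p <;> rcases q with _ | _ | _ | q <;> first | rfl | omega

/-- The 3-cocycle of a multiplicative circle bundle with connection is of integer class. -/
theorem IsFlatMul.isIntegerClass [IsManifold 𝓘(ℝ, ER) ∞ R] (hμ : IsFlatMul ER G π η θ μ)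
    (hc : G.IsThreeCocycle η om) (P : IsPrincipalCircleBundle E₁ ER π) (hθ : IsConnectionForm θ)
    (hcurv : θ.extD = -om.pullback π) (hG : G.SConnected) : G.IsIntegerClass η om := by
  -- Cochains are arbitrary functions of simplices, so neither `r` nor the logarithms `κ` and `ℓ`
  -- need any continuity.
  obtain ⟨r, hr⟩ : ∃ r : X₁ → R, ∀ x, π (r x) = x := P.surjective.hasRightInverse
  have hκ' : ∀ p : G.Pairs, ∃ k : ℝ, μ (r p.fst) (r p.snd) = cexp k • r (G.mul p) := fun p => by
    obtain ⟨s, hs⟩ := P.exists_smul_eq (a := r (G.mul p)) (b := μ (r p.fst) (r p.snd)) (by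
      rw [hμ.proj _ _ (by rw [hr, hr]; exact p.w), hr]
      exact congrArg G.mul (FiberProduct.ext (hr _).symm (hr _).symm))
    obtain ⟨k, rfl⟩ := cexp_surjective s
    exact ⟨k, hs.symm⟩
  choose κ hκ using hκ'
  choose ℓ hℓ using exists_isLogHolonomy (G := G) hθ P hcurv hr
  let b : G.Cochain ℝ := fun p q => match p, q with
    | 2, 0 => fun σ => -κ (σ.toFun default).toPair
    | 1, 1 => fun σ => -ℓ σ
    | _, _ => 0
  have hb : b.IsHomogeneous 2 := by
    intro p q hpq
    rcases p with _ | _ | _ | p <;> rcases q with _ | _ | q <;> first | rfl | omega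
  -- In total degree three: `(0, 3)` is trivial, `(1, 2)` is holonomy around triangles, `(2, 1)` is
  -- multiplicativity of transport, `(3, 0)` is associativity.
  have hint : ∀ p q (σ : G.SingularSimplex p q), ∃ m : ℤ,
      G.deRhamCochain η om p q σ - b.totalD p q σ = m := by
    intro p q σ
    by_cases hpq : p + q = 3
    · obtain ⟨rfl, rfl⟩ | ⟨rfl, rfl⟩ | ⟨rfl, rfl⟩ | ⟨rfl, rfl⟩ :
          (p = 0 ∧ q = 3) ∨ (p = 1 ∧ q = 2) ∨ (p = 2 ∧ q = 1) ∨ (p = 3 ∧ q = 0) := by omega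
      · refine ⟨0, ?_⟩
        have h1 : b.singularD 0 3 σ = 0 := Finset.sum_eq_zero fun i _ => smul_zero _
        rw [Cochain.totalD, h1]
        simp [Cochain.simplicialD, deRhamCochain]
      · obtain ⟨m, hm⟩ := LieGroupoid.integrate_sub_isLogHolonomy hθ P hcurv hc.smooth_om hr σ
          fun i => hℓ (σ.singularFace i)
        refine ⟨m, ?_⟩
        have h1 : b.simplicialD 1 2 σ = 0 := Finset.sum_eq_zero fun i _ => smul_zero _
        have h2 : b.singularD 1 2 σ = ∑ i : Fin 3, (-1 : ℤ) ^ (i : ℕ) • -ℓ (σ.singularFace i) := rfl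
        rw [← hm, Cochain.totalD, h1, h2, Fin.sum_univ_three]
        change integrate om (fun x => (σ.toFun x).arr 0 1) - _ = _
        simp
        ring
      · obtain ⟨m, hm⟩ := hμ.integrate_sub_isLogHolonomy P hθ hc.smooth_η hr hκ σ
          fun i => hℓ (σ.nerveFace i)
        refine ⟨m, ?_⟩
        have h1 : b.simplicialD 2 1 σ = ∑ i : Fin 3, (-1 : ℤ) ^ (i : ℕ) • -ℓ (σ.nerveFace i) := rfl
        have h2 : b.singularD 2 1 σ = ∑ i : Fin 2, (-1 : ℤ) ^ (i : ℕ) •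
          -κ (σ.toFun (simplexCoface i default)).toPair := rfl
        rw [← hm, Cochain.totalD, h1, h2, Fin.sum_univ_three, Fin.sum_univ_two,
          simplexCoface_zero_default, simplexCoface_one_default]
        change integrate η (fun x => (σ.toFun x).toPair) - _ = _
        simp
        ring
      · obtain ⟨m, hm⟩ := hμ.exists_int_cocycle hc P hθ hG hr hκ (σ.toFun default)
        refine ⟨m, ?_⟩
        have h1 : b.simplicialD 3 0 σ = ∑ i : Fin 4, (-1 : ℤ) ^ (i : ℕ) •
          -κ ((σ.toFun default).face i).toPair := rfl
        have h2 : b.singularD 3 0 σ = 0 := rfl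
        rw [← hm, Cochain.totalD, h1, h2, Fin.sum_univ_four]
        change (0 : ℝ) - _ = _
        simp
        ring
    · refine ⟨0, ?_⟩
      rw [deRhamCochain_isHomogeneous p q hpq, hb.totalD p q hpq]
      simp
  choose z hz using hint
  have hz' : G.deRhamCochain η om = (fun p q σ => (z p q σ : ℝ)) + b.totalD := by
    funext p q σ
    exact sub_eq_iff_eq_add.1 (hz p q σ)
  -- Since `D² b = 0`, the coboundary of the de Rham cochain is that of `z`, hence integer valued;
  -- the contraction argument then forces it to vanish, so `z` is a cocycle.
  have hdz : (G.deRhamCochain η om).totalD = fun p q σ => ((Cochain.totalD (A := ℤ) z p q σ : ℤ) : ℝ) := by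
    rw [hz', Cochain.totalD_add, Cochain.totalD_totalD, add_zero, Cochain.totalD_intCast]
  have h0 := totalD_deRhamCochain_eq_zero hc.smooth_η hc.smooth_om fun p q σ =>
    ⟨Cochain.totalD (A := ℤ) z p q σ, congrFun (congrFun (congrFun hdz p) q) σ⟩
  refine ⟨z, b, fun p q hpq => ?_, hb, ?_, hz'⟩
  · funext σ
    have := hz p q σ
    rw [deRhamCochain_isHomogeneous p q hpq, hb.totalD p q hpq] at this
    have h1 : (z p q σ : ℝ) = 0 := by rw [← this]; simp
    exact_mod_cast h1
  · funext p q σ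
    have h1 : ((Cochain.totalD (A := ℤ) z p q σ : ℤ) : ℝ) = 0 :=
      (congrFun (congrFun (congrFun hdz p) q) σ).symm.trans (congrFun (congrFun (congrFun h0 p) q) σ)
    exact_mod_cast h1

end LieGroupoid

theorem mainTheorem12 {E₀ E₁ ER X₀ X₁ R : Type*}
    [NormedAddCommGroup E₀] [NormedSpace ℝ E₀] [FiniteDimensional ℝ E₀]
    [TopologicalSpace X₀] [ChartedSpace E₀ X₀] [IsManifold 𝓘(ℝ, E₀) ∞ X₀]
    [T2Space X₀] [SecondCountableTopology X₀]
    [NormedAddCommGroup E₁] [NormedSpace ℝ E₁] [FiniteDimensional ℝ E₁]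
    [TopologicalSpace X₁] [ChartedSpace E₁ X₁] [IsManifold 𝓘(ℝ, E₁) ∞ X₁]
    [T2Space X₁] [SecondCountableTopology X₁]
    [NormedAddCommGroup ER] [NormedSpace ℝ ER] [FiniteDimensional ℝ ER]
    [TopologicalSpace R] [ChartedSpace ER R] [IsManifold 𝓘(ℝ, ER) ∞ R]
    [MulAction Circle R]
    (G : LieGroupoid E₀ E₁ X₀ X₁) (hG : G.SConnected)
    (η : DForm G.PairsModel G.Pairs 1) (om : DForm E₁ X₁ 2) (hcocycle : G.IsThreeCocycle η om)
    (π : R → X₁) (P : IsPrincipalCircleBundle E₁ ER π)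
    (θ : DForm ER R 1) (hθ : IsConnectionForm θ) (hcurv : θ.extD = -om.pullback π)
    (hhol : G.HolonomyFree P η θ) :
    (∃ Γ : LieGroupoid.CentralExtension ER G π, Γ.IsPseudoConnection θ η om) ∧
      G.IsIntegerClass η om := by
  obtain ⟨μ, hμ⟩ := LieGroupoid.exists_isFlatMul P hcocycle hθ hcurv hhol
  exact ⟨hμ.exists_centralExtension P hcocycle hθ hcurv hG,
    hμ.isIntegerClass hcocycle P hθ hcurv hG⟩
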